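/- Let $\alpha_1,\alpha_2\in(0,2]$ with $\max\{\alpha_1,\alpha_2\}>1$ and let $T>0$. Let $X$ and $\widetilde X$ be independent real-valued processes on a filtered probability space $(\Omega,\mathcal F,(\mathcal F_t)_{t\ge 0},P)$, where $X$ is symmetric $\alpha_1$-stable and $\widetilde X$ is symmetric $\alpha_2$-stable. Here an $(\mathcal F_t)$-adapted process $Z$ with càdlàg paths and $Z_0=0$ is called symmetric $\alpha$-stable if $E[e^{iu(Z_t-Z_s)}\mid\mathcal F_s]=e^{-(t-s)|u|^{\alpha}}$ almost surely for all $t>s\ge 0$ and $u\in\mathbb R$. For $\varepsilon>0$ put $p_\varepsilon(x)=(2\pi\varepsilon)^{-1/2}e^{-x^2/(2\varepsilon)}$ and $$\widetilde L_\varepsilon(T)=\int_0^T p_\varepsilon(X_t-\widetilde X_t)\,dt .$$ Then $\widetilde L_\varepsilon(T)$ converges in $L^2(P)$ as $\varepsilon\downarrow 0$. Its limit $\widetilde L(T)$, the collision local time of $X$ and $\widetilde X$ on $[0,T]$, is almost surely non-negative; there is a constant $C\in(0,\infty)$, depending only on $\alpha_1,\alpha_2,T$, such that $$\lim_{\varepsilon\downarrow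 0}\varepsilon^{-1}P\big(\widetilde L(T)\le\varepsilon\big)=C ;$$ and, for every real $p$, $$E\big[\widetilde L(T)^{-p}\big]<\infty\quad\text{if and only if}\quad p<1,$$ where $0^{-p}=+\infty$ for $p>0$. -/

import Mathlib

open MeasureTheory ProbabilityTheory Filter Topology
open scoped NNReal ENNReal

/-- The path `x : [0, ∞) → ℝ` lies in the Skorokhod space `D[0, ∞)`: it is right-continuous on
`[0, ∞)` and has a finite left limit at every `t > 0`. -/
def IsCadlag (x : ℝ≥0 → ℝ) : Prop :=
  (∀ t, ContinuousWithinAt x (Set.Ici t) t) ∧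
    ∀ t, 0 < t → ∃ l : ℝ, Tendsto x (𝓝[<] t) (𝓝 l)

/-- `X` is a symmetric `α`-stable process with respect to the filtration `ℱ`: it is adapted, has
càdlàg sample paths, starts at `0`, and for all `0 ≤ s < t` and all `u`
`𝔼[exp (i u (X_t - X_s)) | ℱ_s] = exp (-(t - s) |u| ^ α)` almost surely. -/
structure IsSymmetricStable {Ω : Type*} [mΩ : MeasurableSpace Ω] (P : Measure Ω)
    (ℱ : Filtration ℝ≥0 mΩ) (α : ℝ) (X : ℝ≥0 → Ω → ℝ) : Prop where
  adapted : Adapted ℱ X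
  cadlag : ∀ ω, IsCadlag (fun t => X t ω)
  zero : ∀ᵐ ω ∂P, X 0 ω = 0
  condExp_increment : ∀ s t : ℝ≥0, s < t → ∀ u : ℝ,
    condExp (ℱ s) P (fun ω => Complex.exp (Complex.I * u * ((X t ω - X s ω : ℝ) : ℂ)))
      =ᵐ[P] fun _ => ((Real.exp (-((t : ℝ) - (s : ℝ)) * |u| ^ α) : ℝ) : ℂ)

/-- The heat kernel `p_ε(x) = (2 π ε)^(-1/2) exp (-x² / (2 ε))`. -/
noncomputable def heatKernel (ε x : ℝ) : ℝ :=
  1 / (2 * Real.pi * ε) ^ (1 / 2 : ℝ) * Real.exp (-(|x| ^ 2 / (2 * ε)))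

/-- The approximation `∫_0^T p_ε(X_t - Y_t) dt` of the collision local time. -/
noncomputable def approxCollisionLocalTime {Ω : Type*} (X Y : ℝ≥0 → Ω → ℝ) (T ε : ℝ) (ω : Ω) : ℝ :=
  ∫ t in (0 : ℝ)..T, heatKernel ε (X t.toNNReal ω - Y t.toNNReal ω)

/-- `L` is (a version of) the collision local time of `X` and `Y` on `[0, T]` in `L^q(P)`, i.e. the
limit in `L^q(P)` of `∫_0^T p_ε(X_t - Y_t) dt` as `ε ↓ 0`. -/
def IsCollisionLocalTime {Ω : Type*} [MeasurableSpace Ω] (P : Measure Ω) (q : ℝ≥0∞)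
    (X Y : ℝ≥0 → Ω → ℝ) (T : ℝ) (L : Ω → ℝ) : Prop :=
  MemLp L q P ∧
    Tendsto (fun ε : ℝ => eLpNorm (fun ω => approxCollisionLocalTime X Y T ε ω - L ω) q P)
      (𝓝[>] 0) (𝓝 0)

/-! The difference `Z = X - Y` is a symmetric Lévy process with exponent `ψ u = |u| ^ α₁ + |u| ^
α₂`, and the collision local time is the local time of `Z` at zero. As `ψ` dominates `|u| ^ a` for
some `a > 1`, `Z` has continuous transition densities, and `p t = q_t(0)` is nonincreasing on `(0,
∞)`, locally integrable, vanishing at infinity and at least of order `t ^ (-1/2)` near zero.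

Iterating the Markov property expresses the moments of the approximations through iterated
potentials, which are dominated by the convolutions `1 ⋆ p ⋆ ⋯ ⋆ p` and converge to them as the
variances shrink (`tendsto_greenTerm`). Second moments give the Cauchy property in `L²`. Summing the
exponential series identifies the Laplace transform of `L(t)` with `F_r(t) = ∑ (-r)ⁿ (1 ⋆ pⁿ)(t)`,
which solves `F_r + r p ⋆ F_r = 1`; monotonicity of local time in `t` makes `F_r` nonincreasing.

The analytic core is the limit of `r F_r(T)`. The bound `r F_r(t) ∫_0^t p ≤ 1` and Helly's theorem
produce a nonincreasing `κ` with `p ⋆ κ = 1` (`exists_isSoninePartner`). Convolving the relaxation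
equation with `κ` gives convergence of the integrals of `r F_r` to those of `κ`. Since `p` is
unbounded at zero, `κ` has no jumps, so monotonicity upgrades this to `r F_r(T) → κ(T)`
(`IsSoninePartner.tendsto_relaxation`). The limit is finite, and it is positive because `p` vanishes
at infinity.

Karamata's Tauberian theorem turns `r E[exp (-r L)] → κ(T)` into `P(L ≤ ε) / ε → κ(T)`, so `C =
κ(T)`. The linear lower tail decides the negative moments by the layer-cake formula; the positive
moments are bounded by the same convolutions. -/

/-! ### Fourier inversion for real characteristic functions -/

/-- The inverse Fourier (cosine) transform of an even function `φ`. -/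
noncomputable def cosineInversion (φ : ℝ → ℝ) (x : ℝ) : ℝ :=
  (2 * Real.pi)⁻¹ * ∫ u, Real.cos (x * u) * φ u

lemma integrable_cos_mul {φ : ℝ → ℝ} (hφ : Integrable φ) (x : ℝ) :
    Integrable fun u => Real.cos (x * u) * φ u := by
  refine hφ.bdd_mul (c := 1) (by fun_prop) (ae_of_all _ fun u => ?_)
  simpa using Real.abs_cos_le_one _

lemma continuous_cosineInversion {φ : ℝ → ℝ} (hφ : Integrable φ) :
    Continuous (cosineInversion φ) := by
  unfold cosineInversion
  refine continuous_const.mul ?_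
  refine continuous_of_dominated (bound := fun u => ‖φ u‖)
    (fun x => (integrable_cos_mul hφ x).aestronglyMeasurable) (fun x => ae_of_all _ fun u => ?_)
    hφ.norm (ae_of_all _ fun u => by fun_prop)
  rw [norm_mul]
  exact mul_le_of_le_one_left (norm_nonneg _) (by simpa using Real.abs_cos_le_one _)

/-- Parseval's identity: up to a constant, the Gaussian density of variance `1 / v` centred at `y`
is the characteristic function of the Gaussian law of variance `v`, so Fubini moves the transform
onto `μ`. Only the real part survives because `φ` is real. -/
lemma gaussian_smoothing_charFun {μ : Measure ℝ} [IsProbabilityMeasure μ] {φ : ℝ → ℝ}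
    (hchar : ∀ u, charFun μ u = φ u) {v : ℝ≥0} (hv : v ≠ 0) (y : ℝ) :
    ∫ x, gaussianPDFReal y v⁻¹ x ∂μ
      = (2 * Real.pi)⁻¹ * ∫ u, Real.exp (-u ^ 2 / (2 * v)) * (Real.cos (y * u) * φ u) := by
  have hv0 : (0 : ℝ) < v := by positivity
  have h1 : ∀ x : ℝ, (Real.exp (-(v * (x - y) ^ 2 / 2)) : ℂ)
      = ∫ u, Complex.exp (u * (x - y) * Complex.I) ∂gaussianReal 0 v := by
    intro x
    have := charFun_gaussianReal (μ := 0) (v := v) (x - y)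
    rw [charFun_apply_real] at this
    rw [show (fun u : ℝ => Complex.exp (u * (x - y) * Complex.I))
      = fun u : ℝ => Complex.exp (((x - y : ℝ) : ℂ) * u * Complex.I) by
        ext u; push_cast; ring_nf]
    rw [this]; push_cast; congr 1; ring
  have hint : Integrable (Function.uncurry fun (x u : ℝ) =>
      Complex.exp (u * (x - y) * Complex.I)) (μ.prod (gaussianReal 0 v)) := by
    refine Integrable.of_bound (C := 1) (by fun_prop) (ae_of_all _ fun p => ?_)
    have := Complex.norm_exp_ofReal_mul_I (p.2 * (p.1 - y))
    push_cast at this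
    exact this.le
  have h2 : ((∫ x, Real.exp (-(v * (x - y) ^ 2 / 2)) ∂μ : ℝ) : ℂ)
      = ∫ u, Complex.exp (-(u * y) * Complex.I) * φ u ∂gaussianReal 0 v := by
    rw [← integral_complex_ofReal]
    calc ∫ x, ((Real.exp (-(v * (x - y) ^ 2 / 2)) : ℝ) : ℂ) ∂μ
        = ∫ x, ∫ u, Complex.exp (u * (x - y) * Complex.I) ∂gaussianReal 0 v ∂μ := by
          refine integral_congr_ae (ae_of_all _ fun x => ?_)
          simpa using h1 x
      _ = ∫ u, ∫ x, Complex.exp (u * (x - y) * Complex.I) ∂μ ∂gaussianReal 0 v :=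
          integral_integral_swap hint
      _ = _ := by
          refine integral_congr_ae (ae_of_all _ fun u => ?_)
          simp only
          rw [← hchar, charFun_apply_real, ← integral_const_mul]
          congr 1; ext x
          rw [← Complex.exp_add]; congr 1; ring
  have h3 : ∫ x, Real.exp (-(v * (x - y) ^ 2 / 2)) ∂μ
      = ∫ u, Real.cos (y * u) * φ u ∂gaussianReal 0 v := by
    have hI : Integrable (fun u : ℝ => Complex.exp (-(u * y) * Complex.I) * φ u)
        (gaussianReal 0 v) := by
      have hm : Measurable φ := by
        have : φ = fun u => (charFun μ u).re := by ext u; simp [hchar]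
        rw [this]; fun_prop
      refine Integrable.of_bound (C := 1) (by fun_prop) (ae_of_all _ fun u => ?_)
      rw [norm_mul, ← hchar]
      have := Complex.norm_exp_ofReal_mul_I (-(u * y))
      push_cast at this
      rw [this, one_mul]
      exact norm_charFun_le_one _
    have := congrArg Complex.re h2
    rw [Complex.ofReal_re] at this
    rw [this, ← RCLike.re_eq_complex_re, ← integral_re hI]
    refine integral_congr_ae (ae_of_all _ fun u => ?_)
    simp only [RCLike.re_eq_complex_re]
    rw [show (-((u : ℂ) * y) * Complex.I) = ((-(u * y) : ℝ) : ℂ) * Complex.I by push_cast; ring,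
      Complex.re_mul_ofReal, Complex.exp_ofReal_mul_I_re, Real.cos_neg, mul_comm y u]
  rw [integral_gaussianReal_eq_integral_smul hv] at h3
  have e1 : ∀ x, gaussianPDFReal y v⁻¹ x
      = √(v / (2 * Real.pi)) * Real.exp (-(v * (x - y) ^ 2 / 2)) := by
    intro x
    rw [gaussianPDFReal]
    congr 1
    · rw [← Real.sqrt_inv]; congr 1; push_cast; field_simp
    · congr 1; push_cast; field_simp
  simp_rw [e1]
  rw [integral_const_mul, h3, ← integral_const_mul, ← integral_const_mul]
  congr 1; ext u
  rw [gaussianPDFReal, smul_eq_mul]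
  have : √(v / (2 * Real.pi)) * (√(2 * Real.pi * v))⁻¹ = (2 * Real.pi)⁻¹ := by
    rw [← Real.sqrt_inv, ← Real.sqrt_mul (by positivity)]
    rw [show (v / (2 * Real.pi) * (2 * Real.pi * v)⁻¹ : ℝ) = ((2 * Real.pi)⁻¹) ^ 2 by
      field_simp]
    exact Real.sqrt_sq (by positivity)
  rw [sub_zero]
  linear_combination (Real.exp (-u ^ 2 / (2 * v)) * (Real.cos (y * u) * φ u)) * this

/-- The Gaussian damping factor increases to one and `|φ|` dominates. The left side is manifestly
non-negative with total mass one in `y`, so positivity and integrability of the inverse transform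
can be read off from it. -/
lemma tendsto_gaussian_smoothing {μ : Measure ℝ} [IsProbabilityMeasure μ] {φ : ℝ → ℝ}
    (hφ : Integrable φ) (hchar : ∀ u, charFun μ u = φ u) (y : ℝ) :
    Tendsto (fun n : ℕ => ∫ x, gaussianPDFReal y (n + 1 : ℝ≥0)⁻¹ x ∂μ) atTop
      (𝓝 (cosineInversion φ y)) := by
  simp_rw [gaussian_smoothing_charFun hchar (v := _ + 1) (by positivity)]
  unfold cosineInversion
  refine Tendsto.const_mul _ ?_
  refine tendsto_integral_of_dominated_convergence (fun u => ‖φ u‖)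
    (fun n => ?_) hφ.norm (fun n => ae_of_all _ fun u => ?_) (ae_of_all _ fun u => ?_)
  · exact (Continuous.aestronglyMeasurable (by fun_prop)).mul
      (integrable_cos_mul hφ y).aestronglyMeasurable
  · rw [norm_mul, norm_mul, ← mul_assoc]
    refine mul_le_of_le_one_left (norm_nonneg _) (mul_le_one₀ ?_ (norm_nonneg _) ?_)
    · rw [Real.norm_eq_abs, Real.abs_exp, Real.exp_le_one_iff, neg_div]
      exact neg_nonpos.2 (by positivity)
    · simpa using Real.abs_cos_le_one _
  · rw [show 𝓝 (Real.cos (y * u) * φ u) = 𝓝 (Real.exp 0 * (Real.cos (y * u) * φ u)) by simp]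
    refine Tendsto.mul_const _ ((Real.continuous_exp.tendsto 0).comp ?_)
    refine Tendsto.div_atTop tendsto_const_nhds ?_
    refine Tendsto.const_mul_atTop two_pos ?_
    push_cast
    exact tendsto_atTop_add_const_right _ _ tendsto_natCast_atTop_atTop

lemma cosineInversion_nonneg {μ : Measure ℝ} [IsProbabilityMeasure μ] {φ : ℝ → ℝ}
    (hφ : Integrable φ) (hchar : ∀ u, charFun μ u = φ u) (y : ℝ) :
    0 ≤ cosineInversion φ y :=
  ge_of_tendsto' (tendsto_gaussian_smoothing hφ hchar y) fun _ =>
    integral_nonneg fun _ => gaussianPDFReal_nonneg _ _ _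

/-- Fatou's lemma: the inverse transform is the limit of smoothings of `μ`, each of integral one,
since a Gaussian density is symmetric in its mean and its argument. -/
lemma integrable_cosineInversion {μ : Measure ℝ} [IsProbabilityMeasure μ] {φ : ℝ → ℝ}
    (hφ : Integrable φ) (hchar : ∀ u, charFun μ u = φ u) :
    Integrable (cosineInversion φ) := by
  refine ⟨(continuous_cosineInversion hφ).aestronglyMeasurable, ?_⟩
  have hm : ∀ n : ℕ, Measurable fun p : ℝ × ℝ => gaussianPDF p.1 (n + 1 : ℝ≥0)⁻¹ p.2 := by
    intro n
    have := measurable_uncurry_gaussianPDF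
    exact this.comp (f := fun p : ℝ × ℝ => (p.1, (n + 1 : ℝ≥0)⁻¹, p.2)) (by fun_prop)
  have h1 : ∀ n : ℕ, ∀ y, ENNReal.ofReal (∫ x, gaussianPDFReal y (n + 1 : ℝ≥0)⁻¹ x ∂μ)
      = ∫⁻ x, gaussianPDF y (n + 1 : ℝ≥0)⁻¹ x ∂μ := by
    intro n y
    rw [ofReal_integral_eq_lintegral_ofReal]
    · rfl
    · refine Integrable.of_bound (C := (√(2 * Real.pi * ((n + 1 : ℝ≥0)⁻¹ : ℝ≥0)))⁻¹)
        (measurable_gaussianPDFReal _ _).aestronglyMeasurable (ae_of_all _ fun x => ?_)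
      rw [Real.norm_of_nonneg (gaussianPDFReal_nonneg _ _ _), gaussianPDFReal]
      refine mul_le_of_le_one_right (by positivity) ?_
      rw [Real.exp_le_one_iff, neg_div]
      exact neg_nonpos.2 (by positivity)
    · exact ae_of_all _ fun x => gaussianPDFReal_nonneg _ _ _
  have h2 : ∀ n : ℕ, ∫⁻ y, ∫⁻ x, gaussianPDF y (n + 1 : ℝ≥0)⁻¹ x ∂μ = 1 := by
    intro n
    rw [lintegral_lintegral_swap (hm n).aemeasurable]
    have : ∀ x, ∫⁻ y, gaussianPDF y (n + 1 : ℝ≥0)⁻¹ x = 1 := by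
      intro x
      rw [← lintegral_gaussianPDF_eq_one x (v := (n + 1 : ℝ≥0)⁻¹) (by positivity)]
      congr 1; ext y
      simp only [gaussianPDF, gaussianPDFReal]
      rw [show (x - y) ^ 2 = (y - x) ^ 2 by ring]
    simp [this]
  calc ∫⁻ y, ‖cosineInversion φ y‖ₑ = ∫⁻ y, ENNReal.ofReal (cosineInversion φ y) := by
        congr 1; ext y
        rw [Real.enorm_of_nonneg (cosineInversion_nonneg hφ hchar y)]
    _ = ∫⁻ y, liminf (fun n : ℕ => ∫⁻ x, gaussianPDF y (n + 1 : ℝ≥0)⁻¹ x ∂μ) atTop := by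
        congr 1; ext y
        simp_rw [← h1]
        exact ((ENNReal.continuous_ofReal.tendsto _).comp
          (tendsto_gaussian_smoothing hφ hchar y)).liminf_eq.symm
    _ ≤ liminf (fun n : ℕ => ∫⁻ y, ∫⁻ x, gaussianPDF y (n + 1 : ℝ≥0)⁻¹ x ∂μ) atTop :=
        lintegral_liminf_le fun n => (hm n).lintegral_prod_right'
    _ < ∞ := by simp [h2]

open FourierTransform in
/-- A probability measure with an integrable, continuous, real characteristic function has the
density given by Fourier inversion. -/
theorem eq_withDensity_cosineInversion {μ : Measure ℝ} [IsProbabilityMeasure μ] {φ : ℝ → ℝ}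
    (hφ : Integrable φ) (hc : Continuous φ) (hchar : ∀ u, charFun μ u = φ u) :
    μ = volume.withDensity fun x => ENNReal.ofReal (cosineInversion φ x) := by
  have heven : ∀ u, φ (-u) = φ u := by
    intro u
    have h := charFun_neg (μ := μ) u
    rw [hchar, hchar, Complex.conj_ofReal] at h
    exact_mod_cast h
  have hq := integrable_cosineInversion hφ hchar
  have hqn := cosineInversion_nonneg hφ hchar
  have : IsFiniteMeasure (volume.withDensity fun x => ENNReal.ofReal (cosineInversion φ x)) :=
    isFiniteMeasure_withDensity_ofReal hq.2
  refine Measure.ext_of_charFun ?_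
  ext u
  rw [hchar, charFun_apply_real,
    integral_withDensity_eq_integral_toReal_smul
      (continuous_cosineInversion hφ).measurable.ennreal_ofReal (by simp)]
  have hpi : (2 * Real.pi) ≠ 0 := by positivity
  -- The rescaling by `2 * π` matches the normalisation `exp (2 π i x v)` of the Fourier transform
  -- `𝓕`.
  set g : ℝ → ℂ := fun v => (φ (2 * Real.pi * v) : ℂ) with hg
  have hgi : Integrable g := (hφ.comp_mul_left' hpi).ofReal
  have hgc : Continuous g := by fun_prop
  have hexp : ∀ x : ℝ, Integrable fun w : ℝ => Complex.exp (x * w * Complex.I) * φ w := by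
    intro x
    refine hφ.ofReal.bdd_mul (c := 1) (by fun_prop) (ae_of_all _ fun w => ?_)
    have := Complex.norm_exp_ofReal_mul_I (x * w)
    push_cast at this
    exact this.le
  have hinv : ∀ x, 𝓕⁻ g x = (cosineInversion φ x : ℂ) := by
    intro x
    rw [Real.fourierInv_eq']
    have h1 : ∀ v : ℝ, Complex.exp (↑(2 * Real.pi * inner ℝ v x) * Complex.I) • g v
        = (fun w : ℝ => Complex.exp (x * w * Complex.I) * φ w) (2 * Real.pi * v) := by
      intro v
      simp only [hg, smul_eq_mul]
      congr 2
      simp only [RCLike.inner_apply, conj_trivial]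
      push_cast; ring
    rw [integral_congr_ae (ae_of_all _ h1), Measure.integral_comp_mul_left
      (fun w : ℝ => Complex.exp (x * w * Complex.I) * φ w)]
    have h2 : ∫ w : ℝ, Complex.exp (x * w * Complex.I) * φ w
        = ((∫ w, Real.cos (x * w) * φ w : ℝ) : ℂ) := by
      apply Complex.ext
      · rw [Complex.ofReal_re, ← RCLike.re_eq_complex_re, ← integral_re (hexp x)]
        refine integral_congr_ae (ae_of_all _ fun w => ?_)
        simp only [RCLike.re_eq_complex_re]
        rw [← Complex.ofReal_mul, Complex.re_mul_ofReal, Complex.exp_ofReal_mul_I_re]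
      · rw [Complex.ofReal_im, ← RCLike.im_eq_complex_im, ← integral_im (hexp x)]
        have : ∀ w : ℝ, RCLike.im (Complex.exp (x * w * Complex.I) * φ w)
            = Real.sin (x * w) * φ w := by
          intro w
          simp only [RCLike.im_eq_complex_im]
          rw [← Complex.ofReal_mul, Complex.im_mul_ofReal, Complex.exp_ofReal_mul_I_im]
        simp_rw [this]
        -- The sine integrand is odd because `φ` is even, so the imaginary part is its own negative.
        have h3 := integral_neg_eq_self (fun w => Real.sin (x * w) * φ w) volume
        simp only [mul_neg, Real.sin_neg, heven, neg_mul, integral_neg] at h3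
        linarith
    rw [h2, cosineInversion, abs_of_pos (by positivity)]
    simp
  have hgi' : Integrable (𝓕 g) := by
    have h1 : 𝓕 g = fun x => (cosineInversion φ (-x) : ℂ) := by
      ext x
      rw [← hinv, Real.fourierInv_eq_fourier_neg, neg_neg]
    rw [h1]
    exact hq.comp_neg.ofReal
  have h := congrFun (hgc.fourier_fourierInv_eq hgi hgi') (-(u / (2 * Real.pi)))
  have h4 : g (-(u / (2 * Real.pi))) = φ u := by
    simp only [hg]
    rw [← heven u]; congr 2; field_simp
  rw [h4] at h
  rw [← h, Real.fourier_eq']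
  congr 1; ext x
  rw [hinv, ENNReal.toReal_ofReal (hqn x), Complex.real_smul, smul_eq_mul, mul_comm]
  congr 2
  simp only [RCLike.inner_apply, conj_trivial]
  have : (Real.pi : ℂ) ≠ 0 := by exact_mod_cast Real.pi_ne_zero
  push_cast
  field_simp

/-! ### Stable-like exponents, transition densities and diagonal bounds -/

/-- A continuous even function dominating `|u| ^ a` for some `a > 1` and growing at most
quadratically. -/
structure StableLikeExponent (ψ : ℝ → ℝ) : Prop where
  continuous : Continuous ψ
  lower : ∃ a : ℝ, 1 < a ∧ ∀ u, |u| ^ a ≤ ψ u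
  upper : ∀ u, ψ u ≤ 2 + 2 * u ^ 2

lemma abs_rpow_le_one_add_sq {a : ℝ} (ha : 0 < a) (ha' : a ≤ 2) (u : ℝ) :
    |u| ^ a ≤ 1 + u ^ 2 := by
  rcases le_total |u| 1 with h | h
  · have := Real.rpow_le_one (abs_nonneg u) h ha.le
    nlinarith [sq_nonneg u]
  · have := Real.rpow_le_rpow_of_exponent_le h ha'
    rw [Real.rpow_two, sq_abs] at this
    linarith

/-- The larger index alone gives the lower bound with `a > 1`; the restriction of both indices to at
most two gives the quadratic upper bound. -/
lemma stableLikeExponent_add {α₁ α₂ : ℝ} (hα₁ : 0 < α₁) (hα₁' : α₁ ≤ 2) (hα₂ : 0 < α₂)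
    (hα₂' : α₂ ≤ 2) (hmax : 1 < max α₁ α₂) :
    StableLikeExponent fun u => |u| ^ α₁ + |u| ^ α₂ where
  continuous := (continuous_abs.rpow_const fun _ => Or.inr hα₁.le).add
    (continuous_abs.rpow_const fun _ => Or.inr hα₂.le)
  lower := by
    refine ⟨max α₁ α₂, hmax, fun u => ?_⟩
    have h1 : 0 ≤ |u| ^ α₁ := by positivity
    have h2 : 0 ≤ |u| ^ α₂ := by positivity
    rcases max_choice α₁ α₂ with h | h <;> rw [h] <;> linarith
  upper u := by
    linarith [abs_rpow_le_one_add_sq hα₁ hα₁' u, abs_rpow_le_one_add_sq hα₂ hα₂' u]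

lemma integrable_exp_neg_mul_abs_rpow {a b : ℝ} (ha : 0 < a) (hb : 0 < b) :
    Integrable fun u : ℝ => Real.exp (-b * |u| ^ a) := by
  have h : IntegrableOn (fun u : ℝ => Real.exp (-b * |u| ^ a)) (Set.Ioi 0) := by
    refine (integrableOn_rpow_mul_exp_neg_mul_rpow (s := 0) (by norm_num) ha hb).congr_fun
      (fun u hu => ?_) measurableSet_Ioi
    simp [abs_of_pos (Set.mem_Ioi.1 hu)]
  rw [← integrableOn_univ, ← Set.Iic_union_Ioi (a := (0 : ℝ))]
  refine IntegrableOn.union ?_ h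
  rw [integrableOn_Iic_iff_integrableOn_Iio]
  have := (Measure.measurePreserving_neg (volume : Measure ℝ)).integrableOn_comp_preimage
    (f := fun u : ℝ => Real.exp (-b * |u| ^ a)) (s := Set.Ioi 0)
    (MeasurableEquiv.neg ℝ).measurableEmbedding
  rw [Function.comp_def] at this
  simpa using this.2 h

lemma integral_exp_neg_mul_abs_rpow {a b : ℝ} (ha : 0 < a) (hb : 0 < b) :
    ∫ u : ℝ, Real.exp (-b * |u| ^ a) = 2 * (b ^ (-1 / a) * Real.Gamma (1 / a + 1)) := by
  rw [integral_comp_abs (f := fun u => Real.exp (-b * u ^ a)), integral_exp_neg_mul_rpow ha hb]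

namespace StableLikeExponent

variable {ψ : ℝ → ℝ}

lemma nonneg (h : StableLikeExponent ψ) (u : ℝ) : 0 ≤ ψ u := by
  obtain ⟨a, -, ha⟩ := h.lower
  exact (by positivity : (0 : ℝ) ≤ |u| ^ a).trans (ha u)

lemma integrable_exp (h : StableLikeExponent ψ) {t : ℝ} (ht : 0 < t) : Integrable fun u => Real.exp (-(t * ψ u)) := by
  obtain ⟨a, ha1, ha⟩ := h.lower
  have hc := h.continuous
  refine (integrable_exp_neg_mul_abs_rpow (zero_lt_one.trans ha1) ht).mono'
    (by fun_prop) (ae_of_all _ fun u => ?_)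
  rw [Real.norm_eq_abs, Real.abs_exp]
  gcongr
  rw [neg_mul]
  have := mul_le_mul_of_nonneg_left (ha u) ht.le
  linarith

end StableLikeExponent

/-- The density at `x` of a symmetric Lévy process with exponent `ψ` at time `t`, extended by `0`
to `t ≤ 0`. -/
noncomputable def transDensity (ψ : ℝ → ℝ) (t x : ℝ) : ℝ≥0∞ :=
  if 0 < t then ENNReal.ofReal (cosineInversion (fun u => Real.exp (-(t * ψ u))) x) else 0

lemma transDensity_of_nonpos (ψ : ℝ → ℝ) {t : ℝ} (ht : t ≤ 0) (x : ℝ) :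
    transDensity ψ t x = 0 := if_neg ht.not_gt

lemma transDensity_ne_top (ψ : ℝ → ℝ) (t x : ℝ) : transDensity ψ t x ≠ ∞ := by
  unfold transDensity; split_ifs <;> simp

/-- The properties of the on-diagonal density `t ↦ q_t(0)` used by the renewal argument. -/
structure PotentialKernel (p : ℝ → ℝ≥0∞) : Prop where
  measurable : Measurable p
  of_nonpos : ∀ t ≤ 0, p t = 0
  ne_top : ∀ t, p t ≠ ∞
  antitoneOn : AntitoneOn p (Set.Ioi 0)
  lintegral_lt_top : ∀ t, ∫⁻ u in Set.Iio t, p u < ∞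
  tendsto_zero : Tendsto p atTop (𝓝 0)
  lower : ∀ M : ℝ, 0 < M → ∃ c : ℝ, 0 < c ∧
    ∀ t, 0 < t → t ≤ M → ENNReal.ofReal (c * t ^ (-(1 / 2) : ℝ)) ≤ p t

namespace StableLikeExponent

variable {ψ : ℝ → ℝ}

lemma measurable_transDensity (h : StableLikeExponent ψ) : Measurable (Function.uncurry (transDensity ψ)) := by
  have hc := h.continuous
  have h1 : Measurable fun p : ℝ × ℝ =>
      cosineInversion (fun u => Real.exp (-(p.1 * ψ u))) p.2 := by
    unfold cosineInversion
    refine Measurable.const_mul ?_ _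
    have : StronglyMeasurable fun q : (ℝ × ℝ) × ℝ =>
        Real.cos (q.1.2 * q.2) * Real.exp (-(q.1.1 * ψ q.2)) :=
      Continuous.stronglyMeasurable (by fun_prop)
    exact this.integral_prod_right.measurable
  unfold transDensity
  exact Measurable.ite (measurableSet_lt measurable_const measurable_fst) h1.ennreal_ofReal
    measurable_const

/-- Bounding the cosine by one shows that the density is largest at the origin. This makes the
on-diagonal density a majorant for every iterated potential. -/
lemma transDensity_le (h : StableLikeExponent ψ) (t x : ℝ) : transDensity ψ t x ≤ transDensity ψ t 0 := by
  unfold transDensity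
  split_ifs with ht
  · refine ENNReal.ofReal_le_ofReal ?_
    unfold cosineInversion
    refine mul_le_mul_of_nonneg_left ?_ (by positivity)
    refine integral_mono (integrable_cos_mul (h.integrable_exp ht) _)
      (integrable_cos_mul (h.integrable_exp ht) _) fun u => ?_
    simp only [zero_mul, Real.cos_zero]
    exact mul_le_mul_of_nonneg_right (Real.cos_le_one _) (Real.exp_pos _).le
  · exact le_rfl

lemma continuous_transDensity (h : StableLikeExponent ψ) (t : ℝ) : Continuous (transDensity ψ t) := by
  unfold transDensity
  split_ifs with ht
  · exact ENNReal.continuous_ofReal.comp (continuous_cosineInversion (h.integrable_exp ht))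
  · exact continuous_const

lemma transDensity_zero {t : ℝ} (ht : 0 < t) : transDensity ψ t 0
    = ENNReal.ofReal ((2 * Real.pi)⁻¹ * ∫ u, Real.exp (-(t * ψ u))) := by
  simp [transDensity, ht, cosineInversion]

/-- Comparison with the exponent `|u| ^ a` and scaling. Since `a > 1`, the power `-1 / a` lies in
`(-1, 0)`: the bound is integrable at zero and vanishes at infinity. -/
lemma exists_transDensity_le (h : StableLikeExponent ψ) : ∃ a c : ℝ, 1 < a ∧ 0 ≤ c ∧ ∀ t, 0 < t →
    transDensity ψ t 0 ≤ ENNReal.ofReal (c * t ^ (-1 / a)) := by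
  obtain ⟨a, ha1, ha⟩ := h.lower
  have ha0 := zero_lt_one.trans ha1
  refine ⟨a, (2 * Real.pi)⁻¹ * (2 * Real.Gamma (1 / a + 1)), ha1, ?_, fun t ht => ?_⟩
  · have := Real.Gamma_pos_of_pos (show 0 < 1 / a + 1 by positivity)
    positivity
  · rw [transDensity_zero ht]
    refine ENNReal.ofReal_le_ofReal ?_
    rw [mul_assoc]
    refine mul_le_mul_of_nonneg_left ?_ (by positivity)
    calc ∫ u, Real.exp (-(t * ψ u)) ≤ ∫ u, Real.exp (-t * |u| ^ a) := by
          refine integral_mono (h.integrable_exp ht) (integrable_exp_neg_mul_abs_rpow ha0 ht)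
            fun u => ?_
          simp only
          gcongr
          rw [neg_mul]
          have := mul_le_mul_of_nonneg_left (ha u) ht.le
          linarith
      _ = _ := by rw [integral_exp_neg_mul_abs_rpow ha0 ht]; ring

lemma potentialKernel (h : StableLikeExponent ψ) : PotentialKernel fun t => transDensity ψ t 0 where
  measurable := h.measurable_transDensity.comp (f := fun t : ℝ => (t, (0 : ℝ))) (by fun_prop)
  of_nonpos t ht := transDensity_of_nonpos ψ ht 0
  ne_top t := transDensity_ne_top ψ t 0
  antitoneOn s hs t ht hst := by
    simp only [transDensity_zero (Set.mem_Ioi.1 hs), transDensity_zero (Set.mem_Ioi.1 ht)]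
    refine ENNReal.ofReal_le_ofReal ?_
    refine mul_le_mul_of_nonneg_left ?_ (by positivity)
    refine integral_mono (h.integrable_exp ht) (h.integrable_exp hs) fun u => ?_
    simp only
    gcongr
    exact h.nonneg u
  lintegral_lt_top t := by
    obtain ⟨a, c, ha, hc, hle⟩ := h.exists_transDensity_le
    rcases le_or_gt t 0 with ht | ht
    · rw [setLIntegral_congr_fun (g := fun _ => 0) measurableSet_Iio
        fun u hu => transDensity_of_nonpos ψ ((Set.mem_Iio.1 hu).le.trans ht) 0]
      simp
    have hi : IntegrableOn (fun u : ℝ => c * u ^ (-1 / a)) (Set.Ioo 0 t) := by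
      have h1 : -1 < -1 / a := by
        rw [neg_div, neg_lt_neg_iff, div_lt_one (by linarith)]; exact ha
      have := (intervalIntegral.intervalIntegrable_rpow' (a := 0) (b := t) h1).const_mul c
      rw [intervalIntegrable_iff_integrableOn_Ioo_of_le ht.le] at this
      exact this
    calc ∫⁻ u in Set.Iio t, transDensity ψ u 0
        = ∫⁻ u in Set.Ioo 0 t, transDensity ψ u 0 := by
          rw [← lintegral_indicator measurableSet_Iio, ← lintegral_indicator measurableSet_Ioo]
          congr 1; ext u
          by_cases hu : 0 < u
          · simp [Set.indicator_apply, hu]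
          · simp [Set.indicator_apply, hu, transDensity_of_nonpos ψ (not_lt.1 hu)]
      _ ≤ ∫⁻ u in Set.Ioo 0 t, ENNReal.ofReal (c * u ^ (-1 / a)) :=
          setLIntegral_mono' measurableSet_Ioo fun u hu => hle u hu.1
      _ < ∞ := hi.lintegral_lt_top
  tendsto_zero := by
    obtain ⟨a, c, ha, hc, hle⟩ := h.exists_transDensity_le
    have h1 : Tendsto (fun t : ℝ => ENNReal.ofReal (c * t ^ (-1 / a))) atTop (𝓝 0) := by
      rw [← ENNReal.ofReal_zero]
      refine (ENNReal.continuous_ofReal.tendsto _).comp ?_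
      rw [← mul_zero c, neg_div]
      exact (tendsto_rpow_neg_atTop (by positivity)).const_mul c
    exact tendsto_of_tendsto_of_tendsto_of_le_of_le' tendsto_const_nhds h1
      (Eventually.of_forall fun _ => zero_le)
      ((eventually_gt_atTop 0).mono fun t ht => hle t ht)
  lower M hM := by
    -- From `ψ u ≤ 2 + 2 u²`, the integral of `exp (-(t ψ u))` is at least `exp (-2 t) √(π / (2
    -- t))`, and `t ≤ M` bounds the first factor below.
    refine ⟨(2 * Real.pi)⁻¹ * (Real.exp (-(2 * M)) * √(Real.pi / 2)), by positivity,
      fun t ht htM => ?_⟩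
    rw [transDensity_zero ht]
    refine ENNReal.ofReal_le_ofReal ?_
    rw [mul_assoc]
    refine mul_le_mul_of_nonneg_left ?_ (by positivity)
    have hg : Integrable fun u : ℝ => Real.exp (-(2 * t) * u ^ 2) :=
      integrable_exp_neg_mul_sq (by positivity)
    calc Real.exp (-(2 * M)) * √(Real.pi / 2) * t ^ (-(1 / 2) : ℝ)
        ≤ Real.exp (-(2 * t)) * √(Real.pi / 2) * t ^ (-(1 / 2) : ℝ) := by gcongr
      _ = ∫ u : ℝ, Real.exp (-(2 * t)) * Real.exp (-(2 * t) * u ^ 2) := by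
          rw [integral_const_mul, integral_gaussian, mul_assoc]
          congr 1
          rw [← div_div, Real.sqrt_div (by positivity) t, Real.rpow_neg ht.le,
            ← Real.sqrt_eq_rpow, ← div_eq_mul_inv]
      _ ≤ ∫ u, Real.exp (-(t * ψ u)) := by
          refine integral_mono (hg.const_mul _) (h.integrable_exp ht) fun u => ?_
          simp only
          rw [← Real.exp_add]
          gcongr
          nlinarith [h.upper u]

lemma eq_withDensity_transDensity (h : StableLikeExponent ψ) {μ : Measure ℝ} [IsProbabilityMeasure μ] {t : ℝ} (ht : 0 < t)
    (hchar : ∀ u, charFun μ u = Real.exp (-(t * ψ u))) :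
    μ = volume.withDensity (transDensity ψ t) := by
  have hc := h.continuous
  rw [eq_withDensity_cosineInversion (h.integrable_exp ht) (by fun_prop) hchar]
  congr 1; ext x
  simp [transDensity, ht]

end StableLikeExponent

/-! ### Convolution on the half-line and potential kernels -/

/-- The indicator function of `(0, ∞)`. -/
noncomputable def unitStep : ℝ → ℝ≥0∞ := (Set.Ioi 0).indicator 1

lemma measurable_unitStep : Measurable unitStep := measurable_one.indicator measurableSet_Ioi

lemma unitStep_of_pos {t : ℝ} (ht : 0 < t) : unitStep t = 1 := by simp [unitStep, ht]

lemma unitStep_of_nonpos {t : ℝ} (ht : t ≤ 0) : unitStep t = 0 := by simp [unitStep, ht]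

lemma unitStep_le_one (t : ℝ) : unitStep t ≤ 1 := by
  rcases lt_or_ge 0 t with h | h
  · rw [unitStep_of_pos h]
  · simp [unitStep_of_nonpos h]

lemma lconvolution_unitStep (f : ℝ → ℝ≥0∞) (t : ℝ) :
    (f ⋆ₗ unitStep) t = ∫⁻ u in Set.Iio t, f u := by
  rw [lconvolution_def, ← lintegral_indicator measurableSet_Iio]
  congr 1; ext u
  by_cases hu : u < t
  · rw [unitStep_of_pos (by linarith), Set.indicator_of_mem (by exact hu), mul_one]
  · rw [unitStep_of_nonpos (by linarith), Set.indicator_of_notMem (by exact hu), mul_zero]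

lemma lconvolution_of_nonpos {f g : ℝ → ℝ≥0∞} (hf : ∀ t ≤ 0, f t = 0) (hg : ∀ t ≤ 0, g t = 0)
    {t : ℝ} (ht : t ≤ 0) : (f ⋆ₗ g) t = 0 := by
  rw [lconvolution_def, lintegral_eq_zero_of_ae_eq_zero]
  refine ae_of_all _ fun u => ?_
  rcases le_or_gt u 0 with hu | hu
  · simp [hf u hu]
  · simp [hg (-u + t) (by linarith)]

/-- If `f` and `g` vanish on `(-∞, 0]` and `g` is nonincreasing on `(0, ∞)`, then `f ⋆ g (t)`
dominates `g (t) ∫_0^t f`. -/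
lemma mul_lintegral_le_lconvolution {f g : ℝ → ℝ≥0∞} (hf : Measurable f)
    (hf0 : ∀ t ≤ 0, f t = 0) (hg : AntitoneOn g (Set.Ioi 0)) (t : ℝ) :
    g t * ∫⁻ u in Set.Iio t, f u ≤ (f ⋆ₗ g) t := by
  rw [lconvolution_def, ← lintegral_const_mul _ hf]
  refine (lintegral_mono_ae ?_).trans (setLIntegral_le_lintegral (Set.Iio t) _)
  filter_upwards [ae_restrict_mem measurableSet_Iio] with u hu
  have hu : u < t := hu
  rcases le_or_gt u 0 with h | h
  · simp [hf0 u h]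
  · rw [mul_comm]
    gcongr
    exact hg (Set.mem_Ioi.2 (by linarith)) (Set.mem_Ioi.2 (by linarith)) (by linarith)

namespace PotentialKernel

variable {p : ℝ → ℝ≥0∞}

lemma pos (hp : PotentialKernel p) {t : ℝ} (ht : 0 < t) : 0 < p t := by
  obtain ⟨c, hc, h⟩ := hp.lower t ht
  exact lt_of_lt_of_le (ENNReal.ofReal_pos.2 (by positivity)) (h t ht le_rfl)

lemma mul_le_lintegral (hp : PotentialKernel p) {t : ℝ} (ht : 0 < t) :
    ENNReal.ofReal t * p t ≤ ∫⁻ u in Set.Iio t, p u := by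
  calc ENNReal.ofReal t * p t = ∫⁻ _ in Set.Ioo 0 t, p t := by
        rw [setLIntegral_const, Real.volume_Ioo, sub_zero, mul_comm]
    _ ≤ ∫⁻ u in Set.Ioo 0 t, p u := setLIntegral_mono' measurableSet_Ioo fun u hu =>
        hp.antitoneOn (Set.mem_Ioi.2 hu.1) (Set.mem_Ioi.2 ht) hu.2.le
    _ ≤ _ := lintegral_mono_set Set.Ioo_subset_Iio_self

lemma lintegral_pos (hp : PotentialKernel p) {t : ℝ} (ht : 0 < t) :
    0 < ∫⁻ u in Set.Iio t, p u :=
  lt_of_lt_of_le (ENNReal.mul_pos (by simpa using ht) (hp.pos ht).ne') (hp.mul_le_lintegral ht)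

/-- The lower bound of order `s ^ (-1/2)` forces `p` to blow up at zero. This is what excludes jumps
of the Sonine partner. -/
lemma exists_lt_apply (hp : PotentialKernel p) {b : ℝ≥0∞} (hb : b ≠ ∞) {δ : ℝ} (hδ : 0 < δ) :
    ∃ s, 0 < s ∧ s < δ ∧ b < p s := by
  obtain ⟨c, hc, h⟩ := hp.lower δ hδ
  have h1 : Tendsto (fun s : ℝ => c * s ^ (-(1 / 2) : ℝ)) (𝓝[>] 0) atTop :=
    (tendsto_rpow_neg_nhdsGT_zero (by norm_num)).const_mul_atTop hc
  obtain ⟨s, hs, hsδ⟩ := ((h1.eventually_gt_atTop b.toReal).and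
    (Ioo_mem_nhdsGT hδ)).exists
  refine ⟨s, hsδ.1, hsδ.2, lt_of_lt_of_le ?_ (h s hsδ.1 hsδ.2.le)⟩
  exact (ENNReal.lt_ofReal_iff_toReal_lt hb).2 hs

end PotentialKernel

/-! ### The renewal series and the relaxation equation -/

/-- The `n`-fold convolution `1 ⋆ p ⋆ ⋯ ⋆ p`. -/
noncomputable def renewalTerm (p : ℝ → ℝ≥0∞) : ℕ → ℝ → ℝ≥0∞
  | 0 => unitStep
  | n + 1 => p ⋆ₗ renewalTerm p n

/-- `F` solves the relaxation equation `F + r p ⋆ F = 1` on `(0, ∞)` and is nonincreasing. -/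
structure IsRelaxation (p : ℝ → ℝ≥0∞) (r : ℝ≥0∞) (F : ℝ → ℝ≥0∞) : Prop where
  measurable : Measurable F
  of_nonpos : ∀ t ≤ 0, F t = 0
  antitoneOn : AntitoneOn F (Set.Ioi 0)
  eq : ∀ t, F t + r * (p ⋆ₗ F) t = unitStep t

/-- `κ` is the nonincreasing solution of `p ⋆ κ = 1` on `(0, ∞)`. -/
structure IsSoninePartner (p κ : ℝ → ℝ≥0∞) : Prop where
  measurable : Measurable κ
  of_nonpos : ∀ t ≤ 0, κ t = 0
  antitoneOn : AntitoneOn κ (Set.Ioi 0)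
  eq : ∀ t, (p ⋆ₗ κ) t = unitStep t

section RenewalTerm

variable {p : ℝ → ℝ≥0∞}

lemma measurable_renewalTerm (hp : Measurable p) : ∀ n, Measurable (renewalTerm p n)
  | 0 => measurable_unitStep
  | n + 1 => measurable_lconvolution volume hp (measurable_renewalTerm hp n)

lemma renewalTerm_of_nonpos (hp : ∀ t ≤ 0, p t = 0) :
    ∀ (n : ℕ) {t : ℝ}, t ≤ 0 → renewalTerm p n t = 0
  | 0, _, ht => unitStep_of_nonpos ht
  | n + 1, _, ht => lconvolution_of_nonpos hp (fun _ => renewalTerm_of_nonpos hp n) ht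

/-- The convolution powers of `p` are summable against any geometric weight. -/
lemma exists_renewalTerm_le (hp : PotentialKernel p) (T : ℝ) {ρ : ℝ≥0∞} (hρ : 0 < ρ) :
    ∃ K : ℝ≥0∞, K ≠ ∞ ∧ ∀ n, ∀ t ≤ T, renewalTerm p n t ≤ K * ρ ^ n := by
  -- An exponential weight makes convolution with `p` a contraction: for `k` large the integral of
  -- `exp (-k u) p u` over `(0, T)` is below `ρ`. Each convolution then costs a factor `ρ` against
  -- the weight `exp (k t)`.
  have h1 : Tendsto (fun k : ℕ => ∫⁻ u in Set.Iio T, ENNReal.ofReal (Real.exp (-(k * u))) * p u)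
      atTop (𝓝 (∫⁻ _ in Set.Iio T, 0)) := by
    refine tendsto_lintegral_of_dominated_convergence p (fun k => ?_) (fun k => ae_of_all _ ?_)
      (hp.lintegral_lt_top T).ne (ae_of_all _ ?_)
    · exact Measurable.mul (by fun_prop) hp.measurable
    · intro u
      rcases le_or_gt u 0 with h | h
      · simp [hp.of_nonpos u h]
      · refine mul_le_of_le_one_left' ?_
        rw [ENNReal.ofReal_le_one, Real.exp_le_one_iff, neg_nonpos]
        positivity
    · intro u
      rcases le_or_gt u 0 with h | h
      · simp [hp.of_nonpos u h]
      · rw [← zero_mul (p u)]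
        refine ENNReal.Tendsto.mul_const ?_ (Or.inr (hp.ne_top u))
        rw [← ENNReal.ofReal_zero]
        refine (ENNReal.continuous_ofReal.tendsto _).comp (Real.tendsto_exp_neg_atTop_nhds_zero.comp
          (tendsto_natCast_atTop_atTop.atTop_mul_const h))
  rw [lintegral_zero] at h1
  obtain ⟨k, hk⟩ := (h1.eventually (gt_mem_nhds hρ)).exists
  have key : ∀ n, ∀ t ≤ T, renewalTerm p n t ≤ ENNReal.ofReal (Real.exp (k * t)) * ρ ^ n := by
    intro n
    induction n with
    | zero =>
      intro t _
      rcases le_or_gt t 0 with h | h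
      · simp [renewalTerm, unitStep_of_nonpos h]
      · rw [renewalTerm, unitStep_of_pos h, pow_zero, mul_one, ENNReal.one_le_ofReal,
          Real.one_le_exp_iff]
        positivity
    | succ n ih =>
      intro t htT
      calc renewalTerm p (n + 1) t = ∫⁻ u, p u * renewalTerm p n (-u + t) := rfl
        _ ≤ ∫⁻ u, (Set.Iio T).indicator (fun u => (ENNReal.ofReal (Real.exp (k * t)) * ρ ^ n) *
              (ENNReal.ofReal (Real.exp (-(k * u))) * p u)) u := by
            refine lintegral_mono fun u => ?_
            rcases le_or_gt u 0 with h | h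
            · simp [hp.of_nonpos u h]
            rcases le_or_gt t u with h' | h'
            · simp [renewalTerm_of_nonpos hp.of_nonpos n (show -u + t ≤ 0 by linarith)]
            · rw [Set.indicator_of_mem (Set.mem_Iio.2 (h'.trans_le htT))]
              calc p u * renewalTerm p n (-u + t)
                  ≤ p u * (ENNReal.ofReal (Real.exp (k * (-u + t))) * ρ ^ n) := by
                    gcongr; exact ih _ (by linarith)
                _ = _ := by
                    rw [show (k : ℝ) * (-u + t) = k * t + -(k * u) by ring, Real.exp_add,
                      ENNReal.ofReal_mul (Real.exp_pos _).le]
                    ring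
        _ = (ENNReal.ofReal (Real.exp (k * t)) * ρ ^ n) *
              ∫⁻ u in Set.Iio T, ENNReal.ofReal (Real.exp (-(k * u))) * p u := by
            rw [lintegral_indicator measurableSet_Iio, lintegral_const_mul]
            exact Measurable.mul (by fun_prop) hp.measurable
        _ ≤ _ := by
            rw [pow_succ, ← mul_assoc]
            gcongr
  refine ⟨ENNReal.ofReal (Real.exp (k * T)), ENNReal.ofReal_ne_top, fun n t ht => ?_⟩
  refine (key n t ht).trans ?_
  gcongr

lemma tsum_renewalTerm_lt_top (hp : PotentialKernel p) (t : ℝ) (r : ℝ≥0) :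
    ∑' n, (r : ℝ≥0∞) ^ n * renewalTerm p n t < ∞ := by
  -- With this ratio, `r * ρ ≤ 1 / 2`, so the weighted series is dominated by a geometric series.
  have hρ : (0 : ℝ≥0∞) < ((2 * (r + 1))⁻¹ : ℝ≥0) := by
    rw [ENNReal.coe_pos]; positivity
  obtain ⟨K, hK, h⟩ := exists_renewalTerm_le hp t hρ
  calc ∑' n, (r : ℝ≥0∞) ^ n * renewalTerm p n t ≤ ∑' n, K * (2⁻¹ : ℝ≥0∞) ^ n := by
        refine ENNReal.tsum_le_tsum fun n => ?_
        calc (r : ℝ≥0∞) ^ n * renewalTerm p n t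
            ≤ (r : ℝ≥0∞) ^ n * (K * ((2 * (r + 1))⁻¹ : ℝ≥0) ^ n) := by gcongr; exact h n t le_rfl
          _ = K * ((r * (2 * (r + 1))⁻¹ : ℝ≥0) : ℝ≥0∞) ^ n := by
              push_cast; ring
          _ ≤ _ := by
              gcongr
              rw [← ENNReal.coe_ofNat, ← ENNReal.coe_inv two_ne_zero, ENNReal.coe_le_coe, mul_inv,
                mul_left_comm]
              refine mul_le_of_le_one_right' ?_
              rw [← div_eq_mul_inv]
              exact div_le_one_of_le₀ (by simp) (by positivity)
    _ = K * 2 := by rw [ENNReal.tsum_mul_left, ENNReal.tsum_geometric_two]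
    _ < ∞ := ENNReal.mul_lt_top hK.lt_top (by simp)

/-- The even part of the series `∑ (-r)ⁿ 1 ⋆ pⁿ`. -/
noncomputable def renewalEven (p : ℝ → ℝ≥0∞) (r : ℝ≥0∞) (t : ℝ) : ℝ≥0∞ :=
  ∑' n : ℕ, r ^ (2 * n) * renewalTerm p (2 * n) t

/-- Minus the odd part of the series `∑ (-r)ⁿ 1 ⋆ pⁿ`. -/
noncomputable def renewalOdd (p : ℝ → ℝ≥0∞) (r : ℝ≥0∞) (t : ℝ) : ℝ≥0∞ :=
  ∑' n : ℕ, r ^ (2 * n + 1) * renewalTerm p (2 * n + 1) t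

lemma renewalEven_lt_top (hp : PotentialKernel p) (r : ℝ≥0) (t : ℝ) :
    renewalEven p r t < ∞ :=
  (ENNReal.tsum_comp_le_tsum_of_injective
    (show Function.Injective fun n : ℕ => 2 * n from fun a b h => by simpa using h)
    (fun n => (r : ℝ≥0∞) ^ n * renewalTerm p n t)).trans_lt (tsum_renewalTerm_lt_top hp t r)

lemma renewalOdd_lt_top (hp : PotentialKernel p) (r : ℝ≥0) (t : ℝ) :
    renewalOdd p r t < ∞ :=
  (ENNReal.tsum_comp_le_tsum_of_injective
    (show Function.Injective fun n : ℕ => 2 * n + 1 from fun a b h => by simpa using h)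
    (fun n => (r : ℝ≥0∞) ^ n * renewalTerm p n t)).trans_lt (tsum_renewalTerm_lt_top hp t r)

lemma lconvolution_tsum {f : ℝ → ℝ≥0∞} {g : ℕ → ℝ → ℝ≥0∞} (hf : Measurable f)
    (hg : ∀ n, Measurable (g n)) (t : ℝ) :
    (f ⋆ₗ fun s => ∑' n, g n s) t = ∑' n, (f ⋆ₗ g n) t := by
  simp only [lconvolution_def, ← ENNReal.tsum_mul_left]
  rw [lintegral_tsum]
  intro n
  have := hg n
  fun_prop

lemma lconvolution_const_mul {f g : ℝ → ℝ≥0∞} (hf : Measurable f) (hg : Measurable g)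
    (r : ℝ≥0∞) (t : ℝ) : (f ⋆ₗ fun s => r * g s) t = r * (f ⋆ₗ g) t := by
  simp only [lconvolution_def]
  rw [← lintegral_const_mul _ (by fun_prop)]
  congr 1; ext u; ring

lemma lconvolution_add_right {f g k : ℝ → ℝ≥0∞} (hf : Measurable f) (hg : Measurable g) (t : ℝ) :
    (f ⋆ₗ fun s => g s + k s) t = (f ⋆ₗ g) t + (f ⋆ₗ k) t := by
  simp only [lconvolution_def, mul_add]
  rw [lintegral_add_left (by fun_prop)]

/-- Each term is `p` convolved with its predecessor, so the odd part is generated from the even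
part, and conversely apart from the initial term. The alternating series is kept as two non-negative
series because all functions take values in `[0, ∞]`. -/
lemma renewalOdd_eq (hp : Measurable p) (r : ℝ≥0∞) (t : ℝ) :
    renewalOdd p r t = r * (p ⋆ₗ renewalEven p r) t := by
  have hm := measurable_renewalTerm hp
  unfold renewalEven
  rw [lconvolution_tsum hp (fun n => (hm _).const_mul _), ← ENNReal.tsum_mul_left]
  unfold renewalOdd
  congr 1; ext n
  rw [lconvolution_const_mul hp (hm _), ← mul_assoc, ← pow_succ']
  rfl

lemma renewalEven_eq (hp : Measurable p) (r : ℝ≥0∞) (t : ℝ) :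
    renewalEven p r t = unitStep t + r * (p ⋆ₗ renewalOdd p r) t := by
  have hm := measurable_renewalTerm hp
  unfold renewalOdd
  rw [lconvolution_tsum hp (fun n => (hm _).const_mul _), ← ENNReal.tsum_mul_left]
  unfold renewalEven
  rw [tsum_eq_zero_add' ENNReal.summable]
  congr 1
  · simp [renewalTerm]
  · congr 1; ext n
    rw [lconvolution_const_mul hp (hm _), ← mul_assoc, ← pow_succ']
    rfl

lemma measurable_renewalEven (hp : Measurable p) (r : ℝ≥0∞) : Measurable (renewalEven p r) :=
  Measurable.tsum fun _ => (measurable_renewalTerm hp _).const_mul _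

lemma measurable_renewalOdd (hp : Measurable p) (r : ℝ≥0∞) : Measurable (renewalOdd p r) :=
  Measurable.tsum fun _ => (measurable_renewalTerm hp _).const_mul _

/-- The relaxation function `∑ (-r)ⁿ 1 ⋆ pⁿ`. -/
noncomputable def relaxation (p : ℝ → ℝ≥0∞) (r : ℝ≥0∞) (t : ℝ) : ℝ≥0∞ :=
  renewalEven p r t - renewalOdd p r t

/-- The equation follows by subtracting the two recursions for the even and odd parts. Neither the
sign nor the monotonicity is visible in the alternating series; both are hypotheses here, to be
supplied by the Laplace transform of the local time. -/
lemma isRelaxation_relaxation (hp : PotentialKernel p) (r : ℝ≥0)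
    (hle : ∀ t, renewalOdd p r t ≤ renewalEven p r t)
    (hanti : AntitoneOn (relaxation p r) (Set.Ioi 0)) : IsRelaxation p r (relaxation p r) where
  measurable := (measurable_renewalEven hp.measurable r).sub (measurable_renewalOdd hp.measurable r)
  of_nonpos t ht := by
    simp [relaxation, renewalEven, renewalTerm_of_nonpos hp.of_nonpos _ ht]
  antitoneOn := hanti
  eq t := by
    have hpm := hp.measurable
    have hE := measurable_renewalEven hpm r
    have hO := measurable_renewalOdd hpm r
    have hF : Measurable (relaxation p r) := hE.sub hO
    have hsum : ∀ t, relaxation p r t + renewalOdd p r t = renewalEven p r t := fun t =>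
      tsub_add_cancel_of_le (hle t)
    have h1 : r * (p ⋆ₗ relaxation p r) t + r * (p ⋆ₗ renewalOdd p r) t = renewalOdd p r t := by
      rw [renewalOdd_eq hpm, ← mul_add, ← lconvolution_add_right hpm hF]
      congr 2; ext s; exact hsum s
    have h2 := renewalEven_eq hpm r t
    have hfin : renewalOdd p r t ≠ ∞ := (renewalOdd_lt_top hp r t).ne
    have hfin2 : r * (p ⋆ₗ renewalOdd p r) t ≠ ∞ :=
      ((le_add_self.trans h2.ge).trans_lt (renewalEven_lt_top hp r t)).ne
    -- Subtraction is replaced by adding the finite quantity `r p ⋆ renewalOdd` to both sides and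
    -- cancelling it.
    have h3 : relaxation p r t + r * (p ⋆ₗ relaxation p r) t
        + r * (p ⋆ₗ renewalOdd p r) t = unitStep t + r * (p ⋆ₗ renewalOdd p r) t := by
      rw [add_assoc, h1, hsum, ← h2]
    exact (ENNReal.add_left_inj hfin2).1 h3

end RenewalTerm

/-! ### Sonine partners and the limit of the relaxation functions -/

section Sonine

variable {p κ F : ℝ → ℝ≥0∞} {r : ℝ≥0∞}

namespace IsRelaxation

lemma le_one (hF : IsRelaxation p r F) (t : ℝ) : F t ≤ 1 :=
  (le_self_add.trans (hF.eq t).le).trans (unitStep_le_one t)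

/-- Monotonicity of `F` bounds `F t ∫_0^t p` by `(p ⋆ F) t`, and the relaxation equation bounds `r`
times the latter by one. This estimate is uniform in `r`. -/
lemma mul_mul_le_one (hp : PotentialKernel p) (hF : IsRelaxation p r F) (t : ℝ) :
    r * F t * ∫⁻ u in Set.Iio t, p u ≤ 1 := by
  rw [mul_assoc]
  calc r * (F t * ∫⁻ u in Set.Iio t, p u) ≤ r * (p ⋆ₗ F) t := by
        gcongr
        exact mul_lintegral_le_lconvolution hp.measurable hp.of_nonpos hF.antitoneOn t
    _ ≤ F t + r * (p ⋆ₗ F) t := le_add_self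
    _ ≤ 1 := (hF.eq t).le.trans (unitStep_le_one t)

lemma mul_le (hp : PotentialKernel p) (hF : IsRelaxation p r F) (t : ℝ) :
    r * F t ≤ (∫⁻ u in Set.Iio t, p u)⁻¹ :=
  ENNReal.le_inv_iff_mul_le.2 (hF.mul_mul_le_one hp t)

end IsRelaxation

/-- The a priori bound gives `F t ≤ 1 / (r ∫_0^t p)`, with a positive integral when `t > 0`. -/
lemma tendsto_relaxation_zero (hp : PotentialKernel p) {ι : Type*} {l : Filter ι} {r : ι → ℝ≥0}
    {F : ι → ℝ → ℝ≥0∞} (hr : Tendsto r l atTop) (hF : ∀ᶠ i in l, IsRelaxation p (r i) (F i))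
    (t : ℝ) : Tendsto (fun i => F i t) l (𝓝 0) := by
  rcases le_or_gt t 0 with ht | ht
  · refine tendsto_const_nhds.congr' ?_
    filter_upwards [hF] with i hi
    rw [hi.of_nonpos t ht]
  have h1 : Tendsto (fun i => (∫⁻ u in Set.Iio t, p u)⁻¹ * (r i : ℝ≥0∞)⁻¹) l (𝓝 0) := by
    rw [← mul_zero ((∫⁻ u in Set.Iio t, p u)⁻¹)]
    refine ENNReal.Tendsto.const_mul ?_ (Or.inr (ENNReal.inv_ne_top.2 (hp.lintegral_pos ht).ne'))
    have := tendsto_inv_iff.2 (ENNReal.tendsto_coe_nhds_top.2 hr)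
    rwa [ENNReal.inv_top] at this
  refine tendsto_of_tendsto_of_tendsto_of_le_of_le' tendsto_const_nhds h1
    (Eventually.of_forall fun _ => zero_le) ?_
  filter_upwards [hF, hr.eventually_gt_atTop 0] with i hi hri
  rw [← div_eq_mul_inv, ENNReal.le_div_iff_mul_le (by simp [hri.ne']) (by simp), mul_comm]
  exact hi.mul_le hp t

namespace IsSoninePartner

lemma mul_lintegral_le_one (hp : PotentialKernel p) (hκ : IsSoninePartner p κ) (t : ℝ) :
    κ t * ∫⁻ u in Set.Iio t, p u ≤ 1 :=
  (mul_lintegral_le_lconvolution hp.measurable hp.of_nonpos hκ.antitoneOn t).trans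
    ((hκ.eq t).le.trans (unitStep_le_one t))

lemma ne_top (hp : PotentialKernel p) (hκ : IsSoninePartner p κ) (t : ℝ) : κ t ≠ ∞ := by
  rcases le_or_gt t 0 with ht | ht
  · simp [hκ.of_nonpos t ht]
  intro h
  have := hκ.mul_lintegral_le_one hp t
  rw [h, ENNReal.top_mul (hp.lintegral_pos ht).ne'] at this
  simp at this

/-- The roles of the two factors are exchanged: `p` is nonincreasing, so `p t ∫_0^t κ ≤ (κ ⋆ p) t ≤
1` with `p t > 0`. -/
lemma lintegral_ne_top (hp : PotentialKernel p) (hκ : IsSoninePartner p κ) {t : ℝ} (ht : 0 < t) :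
    ∫⁻ u in Set.Iio t, κ u ≠ ∞ := by
  intro h
  have h1 := mul_lintegral_le_lconvolution hκ.measurable hκ.of_nonpos hp.antitoneOn t
  rw [lconvolution_comm, hκ.eq, h, ENNReal.mul_top (hp.pos ht).ne'] at h1
  exact absurd (h1.trans (unitStep_le_one t)) (by simp)

/-- If `κ T = 0`, then `κ` lives on `(0, T)` and `(κ ⋆ p) (s + T) ≤ p s ∫_0^T κ`, which tends to
zero as `s → ∞`. This contradicts `κ ⋆ p = 1`. -/
lemma pos (hp : PotentialKernel p) (hκ : IsSoninePartner p κ) {T : ℝ} (hT : 0 < T) :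
    0 < κ T := by
  rw [pos_iff_ne_zero]
  intro h0
  have h1 : Tendsto (fun t => p t * ∫⁻ u in Set.Iio T, κ u) atTop (𝓝 0) := by
    rw [← zero_mul (∫⁻ u in Set.Iio T, κ u)]
    exact ENNReal.Tendsto.mul_const hp.tendsto_zero (Or.inr (hκ.lintegral_ne_top hp hT))
  obtain ⟨s, hs, hs0⟩ := ((h1.eventually (gt_mem_nhds zero_lt_one)).and
    (eventually_gt_atTop 0)).exists
  have h2 : (κ ⋆ₗ p) (s + T) ≤ p s * ∫⁻ u in Set.Iio T, κ u := by
    rw [lconvolution_def, ← lintegral_const_mul _ hκ.measurable,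
      ← lintegral_indicator measurableSet_Iio]
    refine lintegral_mono fun u => ?_
    rcases le_or_gt u 0 with hu | hu
    · simp [hκ.of_nonpos u hu]
    rcases lt_or_ge u T with hu' | hu'
    · rw [Set.indicator_of_mem (Set.mem_Iio.2 hu'), mul_comm]
      gcongr
      exact hp.antitoneOn (Set.mem_Ioi.2 hs0) (Set.mem_Ioi.2 (by linarith)) (by linarith)
    · have : κ u = 0 := le_antisymm
        ((hκ.antitoneOn (Set.mem_Ioi.2 hT) (Set.mem_Ioi.2 hu) hu').trans h0.le) zero_le
      simp [this]
  rw [lconvolution_comm, hκ.eq, unitStep_of_pos (by linarith)] at h2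
  exact absurd hs h2.not_gt

/-- The Sonine partner has no jumps. -/
lemma not_jump (hp : PotentialKernel p) (hκ : IsSoninePartner p κ) {T : ℝ} (hT : 0 < T)
    {J : ℝ≥0∞} (hJ : 0 < J) : ¬ ∀ s₁ s₂, 0 < s₁ → s₁ < T → T < s₂ → κ s₂ + J ≤ κ s₁ := by
  intro hjump
  have hpm := hp.measurable
  have hκm := hκ.measurable
  -- With this choice `T - δ = δ`, so `κ (T + h - y) ≤ κ δ` for all `y` in the window `(δ, δ + h]`.
  set δ := T / 2 with hδ
  have hδ0 : 0 < δ := by positivity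
  -- Compare `p ⋆ κ = 1` at `T` and at `T + h`. For `0 < y < h` the arguments `T - y` and `T + h -
  -- y` lie on opposite sides of the jump, so passing to `T + h` loses at least `J ∫_0^h p ≥ J h
  -- p(h)`. Beyond `δ + h`, a shift by `h` and the monotonicity of `p` show that nothing is gained.
  -- The only possible compensation is the window `(δ, δ + h]`, worth at most `h p(δ) κ(δ)`.
  -- Dividing by `h` bounds `p` near zero, which is impossible.
  have key : ∀ h, 0 < h → h < δ → J * p h ≤ p δ * κ δ := by
    intro h hh hhδ
    have hR : ∫⁻ y in Set.Ioi (δ + h), p y * κ (-y + (T + h))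
        ≤ ∫⁻ y in Set.Ioi δ, p y * κ (-y + T) := by
      rw [← lintegral_indicator measurableSet_Ioi, ← lintegral_indicator measurableSet_Ioi,
        ← lintegral_add_right_eq_self _ h]
      refine lintegral_mono fun y => ?_
      by_cases hy : δ < y
      · rw [Set.indicator_of_mem (by simpa using hy), Set.indicator_of_mem (by simpa using hy),
          show -(y + h) + (T + h) = -y + T by ring]
        gcongr
        exact hp.antitoneOn (Set.mem_Ioi.2 (hδ0.trans hy)) (Set.mem_Ioi.2 (by linarith))
          (by linarith)
      · rw [Set.indicator_of_notMem (by simpa using hy)]; exact zero_le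
    have hM : ∫⁻ y in Set.Ioc δ (δ + h), p y * κ (-y + (T + h))
        ≤ p δ * κ δ * ENNReal.ofReal h := by
      calc _ ≤ ∫⁻ _ in Set.Ioc δ (δ + h), p δ * κ δ := by
            refine setLIntegral_mono' measurableSet_Ioc fun y hy => ?_
            refine mul_le_mul'
              (hp.antitoneOn (Set.mem_Ioi.2 hδ0) (Set.mem_Ioi.2 (hδ0.trans hy.1)) hy.1.le)
              (hκ.antitoneOn (Set.mem_Ioi.2 hδ0) (Set.mem_Ioi.2 ?_) ?_) <;>
            linarith [hy.1, hy.2]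
        _ = _ := by rw [setLIntegral_const, Real.volume_Ioc]; congr 2; ring
    have hL : (∫⁻ y in Set.Iic δ, p y * κ (-y + (T + h))) + J * ∫⁻ y in Set.Iio h, p y
        ≤ ∫⁻ y in Set.Iic δ, p y * κ (-y + T) := by
      rw [← lintegral_const_mul _ hpm, ← lintegral_indicator measurableSet_Iic,
        ← lintegral_indicator measurableSet_Iio, ← lintegral_indicator measurableSet_Iic,
        ← lintegral_add_left ((by fun_prop : Measurable _).indicator measurableSet_Iic)]
      refine lintegral_mono fun y => ?_
      rcases le_or_gt y 0 with hy | hy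
      · simp [Set.indicator_apply, hp.of_nonpos y hy]
      rcases lt_or_ge y h with hyh | hyh
      · have hyδ : y ≤ δ := by linarith
        rw [Set.indicator_of_mem (by simpa using hyδ), Set.indicator_of_mem (by simpa using hyh),
          Set.indicator_of_mem (by simpa using hyδ), mul_comm J, ← mul_add]
        gcongr
        exact hjump _ _ (by linarith) (by linarith) (by linarith)
      · rw [Set.indicator_of_notMem (s := Set.Iio h) (by simpa using hyh), add_zero]
        refine Set.indicator_le_indicator' fun hyδ => ?_
        have hyδ : y ≤ δ := hyδ
        gcongr
        exact hκ.antitoneOn (Set.mem_Ioi.2 (by linarith)) (Set.mem_Ioi.2 (by linarith))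
          (by linarith)
    have hsplit : ∀ b t : ℝ, (∫⁻ y in Set.Iic b, p y * κ (-y + t))
        + ∫⁻ y in Set.Ioi b, p y * κ (-y + t) = unitStep t := by
      intro b t
      rw [← hκ.eq t, lconvolution_def, ← Set.compl_Iic]
      exact lintegral_add_compl (fun y => p y * κ (-y + t)) measurableSet_Iic
    have hunion : ∫⁻ y in Set.Iic (δ + h), p y * κ (-y + (T + h))
        = (∫⁻ y in Set.Iic δ, p y * κ (-y + (T + h)))
          + ∫⁻ y in Set.Ioc δ (δ + h), p y * κ (-y + (T + h)) := by
      rw [← lintegral_union measurableSet_Ioc (Set.Iic_disjoint_Ioc le_rfl),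
        Set.Iic_union_Ioc_eq_Iic (by linarith)]
    have h1 : 1 + J * ∫⁻ y in Set.Iio h, p y ≤ 1 + p δ * κ δ * ENNReal.ofReal h := by
      calc 1 + J * ∫⁻ y in Set.Iio h, p y
          = (∫⁻ y in Set.Iic δ, p y * κ (-y + (T + h)))
            + (∫⁻ y in Set.Ioc δ (δ + h), p y * κ (-y + (T + h)))
            + (∫⁻ y in Set.Ioi (δ + h), p y * κ (-y + (T + h)))
            + J * ∫⁻ y in Set.Iio h, p y := by
            rw [← hunion, hsplit, unitStep_of_pos (by linarith)]
        _ = ((∫⁻ y in Set.Iic δ, p y * κ (-y + (T + h))) + J * ∫⁻ y in Set.Iio h, p y)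
            + (∫⁻ y in Set.Ioi (δ + h), p y * κ (-y + (T + h)))
            + (∫⁻ y in Set.Ioc δ (δ + h), p y * κ (-y + (T + h))) := by ring
        _ ≤ (∫⁻ y in Set.Iic δ, p y * κ (-y + T)) + (∫⁻ y in Set.Ioi δ, p y * κ (-y + T))
            + p δ * κ δ * ENNReal.ofReal h := by gcongr
        _ = _ := by rw [hsplit, unitStep_of_pos hT]
    have h2 := (ENNReal.add_le_add_iff_left ENNReal.one_ne_top).1 h1
    have h3 : ENNReal.ofReal h * (J * p h) ≤ ENNReal.ofReal h * (p δ * κ δ) := by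
      calc ENNReal.ofReal h * (J * p h) = J * (ENNReal.ofReal h * p h) := by ring
        _ ≤ J * ∫⁻ y in Set.Iio h, p y := by gcongr; exact hp.mul_le_lintegral hh
        _ ≤ _ := h2.trans_eq (mul_comm _ _)
    exact (ENNReal.mul_le_mul_iff_right (by simpa using hh) ENNReal.ofReal_ne_top).1 h3
  have hB : p δ * κ δ / J ≠ ∞ :=
    ENNReal.div_ne_top (ENNReal.mul_ne_top (hp.ne_top _) (hκ.ne_top hp _)) hJ.ne'
  obtain ⟨s, hs0, hsδ, hs⟩ := hp.exists_lt_apply hB hδ0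
  have hJt : J ≠ ∞ := by
    intro h
    have := (hjump δ (T + 1) hδ0 (by linarith) (by linarith))
    rw [h, add_top, top_le_iff] at this
    exact hκ.ne_top hp _ this
  rw [ENNReal.div_lt_iff (Or.inl hJ.ne') (Or.inl hJt), mul_comm (p s)] at hs
  exact absurd (key s hs0 hsδ) hs.not_ge

lemma exists_lt_add (hp : PotentialKernel p) (hκ : IsSoninePartner p κ) {T : ℝ} (hT : 0 < T)
    {ε : ℝ≥0∞} (hε : 0 < ε) : ∃ s₁ s₂, 0 < s₁ ∧ s₁ < T ∧ T < s₂ ∧ κ s₁ < κ s₂ + ε := by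
  have := hκ.not_jump hp hT hε
  push Not at this
  obtain ⟨s₁, s₂, h1, h2, h3, h4⟩ := this
  exact ⟨s₁, s₂, h1, h2, h3, h4⟩

/-- The functions `r F_r` converge to the Sonine partner as `r → ∞`. -/
theorem tendsto_relaxation (hp : PotentialKernel p) (hκ : IsSoninePartner p κ) {ι : Type*}
    {l : Filter ι} [l.IsCountablyGenerated] {r : ι → ℝ≥0}
    {F : ι → ℝ → ℝ≥0∞} (hr : Tendsto r l atTop) (hF : ∀ᶠ i in l, IsRelaxation p (r i) (F i))
    {T : ℝ} (hT : 0 < T) : Tendsto (fun i => r i * F i T) l (𝓝 (κ T)) := by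
  have hpm := hp.measurable
  have hκm := hκ.measurable
  -- Convolve `F + r p ⋆ F = 1` with `κ` and use `κ ⋆ p = 1`: the integral of `r F` differs from
  -- that of `κ` only by `κ ⋆ F`.
  have hid : ∀ᶠ i in l, ∀ t, r i * (∫⁻ u in Set.Iio t, F i u) + (κ ⋆ₗ F i) t
      = ∫⁻ u in Set.Iio t, κ u := by
    filter_upwards [hF] with i hi t
    have hFm := hi.measurable
    have h1 : unitStep = fun s => F i s + r i * (p ⋆ₗ F i) s := funext fun s => (hi.eq s).symm
    have h2 : κ ⋆ₗ p = unitStep := by rw [lconvolution_comm]; exact funext hκ.eq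
    have hm := measurable_lconvolution (volume : Measure ℝ) hpm hFm
    rw [← lconvolution_unitStep κ, ← lconvolution_unitStep (F i) t]
    conv_rhs => rw [h1]
    rw [lconvolution_add_right hκm hFm, lconvolution_const_mul hκm hm,
      lconvolution_assoc hκm hpm hFm, h2, add_comm, lconvolution_comm (f := F i)]
  -- The remainder `κ ⋆ F` vanishes by dominated convergence, since `F ≤ 1`, `F → 0` pointwise and
  -- `κ` is integrable on bounded intervals.
  have hlim : ∀ t, 0 < t → Tendsto (fun i => r i * ∫⁻ u in Set.Iio t, F i u) l
      (𝓝 (∫⁻ u in Set.Iio t, κ u)) := by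
    intro t ht
    have h0 : Tendsto (fun i => (κ ⋆ₗ F i) t) l (𝓝 0) := by
      have : Tendsto (fun i => ∫⁻ u in Set.Iio t, κ u * F i (-u + t)) l
          (𝓝 (∫⁻ u in Set.Iio t, 0)) := by
        refine tendsto_lintegral_filter_of_dominated_convergence κ ?_ ?_
          (hκ.lintegral_ne_top hp ht) (ae_of_all _ fun u => ?_)
        · filter_upwards [hF] with i hi
          have := hi.measurable
          fun_prop
        · filter_upwards [hF] with i hi
          exact ae_of_all _ fun u => mul_le_of_le_one_right' (hi.le_one _)
        · rw [← mul_zero (κ u)]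
          exact ENNReal.Tendsto.const_mul (tendsto_relaxation_zero hp hr hF _)
            (Or.inr (hκ.ne_top hp u))
      rw [lintegral_zero] at this
      refine this.congr' ?_
      filter_upwards [hF] with i hi
      rw [lconvolution_def, ← lintegral_indicator measurableSet_Iio]
      congr 1; ext u
      by_cases hu : u < t
      · rw [Set.indicator_of_mem (by simpa using hu)]
      · rw [Set.indicator_of_notMem (by simpa using hu),
          hi.of_nonpos (-u + t) (by linarith), mul_zero]
    have h1 : Tendsto (fun i => (∫⁻ u in Set.Iio t, κ u) - (κ ⋆ₗ F i) t) l
        (𝓝 ((∫⁻ u in Set.Iio t, κ u) - 0)) :=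
      ENNReal.Tendsto.sub tendsto_const_nhds h0 (Or.inr ENNReal.zero_ne_top)
    rw [tsub_zero] at h1
    refine h1.congr' ?_
    filter_upwards [hid] with i hi
    have hfin : (κ ⋆ₗ F i) t ≠ ∞ := ne_top_of_le_ne_top (hκ.lintegral_ne_top hp ht)
      (le_add_self.trans (hi t).le)
    rw [← hi t, ENNReal.add_sub_cancel_right hfin]
  have hIco : ∀ s t, 0 < s → s < t → Tendsto (fun i => r i * ∫⁻ u in Set.Ico s t, F i u) l
      (𝓝 (∫⁻ u in Set.Ico s t, κ u)) := by
    intro s t hs hst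
    have hsub : ∀ f : ℝ → ℝ≥0∞, (∫⁻ u in Set.Iio t, f u)
        = (∫⁻ u in Set.Iio s, f u) + ∫⁻ u in Set.Ico s t, f u := by
      intro f
      have hd : Disjoint (Set.Iio s) (Set.Ico s t) :=
        Set.disjoint_left.2 fun y (hy : y < s) hy' => not_le.2 hy hy'.1
      rw [← lintegral_union measurableSet_Ico hd, Set.Iio_union_Ico_eq_Iio hst.le]
    have h1 := ENNReal.Tendsto.sub (hlim t (hs.trans hst)) (hlim s hs)
      (Or.inr (hκ.lintegral_ne_top hp hs))
    rw [hsub κ, ENNReal.add_sub_cancel_left (hκ.lintegral_ne_top hp hs)] at h1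
    refine h1.congr' ?_
    filter_upwards [hid] with i hi
    rw [hsub (F i), mul_add, ENNReal.add_sub_cancel_left]
    exact ne_top_of_le_ne_top (hκ.lintegral_ne_top hp hs) (le_self_add.trans (hi s).le)
  have hbound : ∀ s t, 0 < s → s < t → ∀ f : ℝ → ℝ≥0∞, AntitoneOn f (Set.Ioi 0) →
      ENNReal.ofReal (t - s) * f t ≤ (∫⁻ u in Set.Ico s t, f u) ∧
        (∫⁻ u in Set.Ico s t, f u) ≤ ENNReal.ofReal (t - s) * f s := by
    intro s t hs hst f hf
    have hc : ∀ c : ℝ≥0∞, ENNReal.ofReal (t - s) * c = ∫⁻ _ in Set.Ico s t, c := by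
      intro c; rw [setLIntegral_const, Real.volume_Ico, mul_comm]
    rw [hc, hc]
    exact ⟨setLIntegral_mono' measurableSet_Ico fun u hu => hf (Set.mem_Ioi.2 (hs.trans_le hu.1))
      (Set.mem_Ioi.2 (hs.trans hst)) hu.2.le, setLIntegral_mono' measurableSet_Ico fun u hu =>
      hf (Set.mem_Ioi.2 hs) (Set.mem_Ioi.2 (hs.trans_le hu.1)) hu.1⟩
  -- A nonincreasing function at `T` lies between its averages over an interval to the right and one
  -- to the left. These averages converge to those of `κ`, and the absence of a jump puts both close
  -- to `κ T`.
  rw [tendsto_order]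
  constructor
  · intro b hb
    obtain ⟨s₁, s₂, h1, h2, h3, h4⟩ := hκ.exists_lt_add hp hT (tsub_pos_of_lt hb)
    have hbs : b < κ s₂ := by
      have h5 : κ T < κ s₂ + (κ T - b) :=
        lt_of_le_of_lt (hκ.antitoneOn (Set.mem_Ioi.2 h1) (Set.mem_Ioi.2 hT) h2.le) h4
      have hfin : κ T - b ≠ ∞ := ENNReal.sub_ne_top (hκ.ne_top hp T)
      have h6 : b + (κ T - b) < κ s₂ + (κ T - b) := by rwa [add_tsub_cancel_of_le hb.le]
      exact (ENNReal.add_lt_add_iff_right hfin).1 h6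
    have h5 : ENNReal.ofReal (s₂ - T) * b < ∫⁻ u in Set.Ico T s₂, κ u :=
      lt_of_lt_of_le ((ENNReal.mul_lt_mul_iff_right (by simpa using h3) ENNReal.ofReal_ne_top).2 hbs)
        (hbound T s₂ hT h3 κ hκ.antitoneOn).1
    filter_upwards [(hIco T s₂ hT h3).eventually (lt_mem_nhds h5), hF] with i hi hFi
    have h6 := hi.trans_le (mul_le_mul_right (hbound T s₂ hT h3 _ hFi.antitoneOn).2 _)
    rw [mul_left_comm] at h6
    exact (ENNReal.mul_lt_mul_iff_right (by simpa using h3) ENNReal.ofReal_ne_top).1 h6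
  · intro b hb
    obtain ⟨s₁, s₂, h1, h2, h3, h4⟩ := hκ.exists_lt_add hp hT (tsub_pos_of_lt hb)
    have hbs : κ s₁ < b := by
      refine h4.trans_le ?_
      calc κ s₂ + (b - κ T) ≤ κ T + (b - κ T) := by
            gcongr
            exact hκ.antitoneOn (Set.mem_Ioi.2 hT) (Set.mem_Ioi.2 (hT.trans h3)) h3.le
        _ = b := add_tsub_cancel_of_le hb.le
    have h5 : ∫⁻ u in Set.Ico s₁ T, κ u < ENNReal.ofReal (T - s₁) * b :=
      lt_of_le_of_lt (hbound s₁ T h1 h2 κ hκ.antitoneOn).2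
        ((ENNReal.mul_lt_mul_iff_right (by simpa using h2) ENNReal.ofReal_ne_top).2 hbs)
    filter_upwards [(hIco s₁ T h1 h2).eventually (gt_mem_nhds h5), hF] with i hi hFi
    have h6 := (mul_le_mul_right (hbound s₁ T h1 h2 _ hFi.antitoneOn).1 _).trans_lt hi
    rw [mul_left_comm] at h6
    exact (ENNReal.mul_lt_mul_iff_right (by simpa using h2) ENNReal.ofReal_ne_top).1 h6

end IsSoninePartner

/-- Helly's selection theorem for `[0, ∞]`-valued functions that are nonincreasing on `(0, ∞)`. -/
theorem exists_subseq_tendsto_of_antitoneOn {G : ℕ → ℝ → ℝ≥0∞} (hGm : ∀ k, Measurable (G k))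
    (hGa : ∀ k, AntitoneOn (G k) (Set.Ioi 0)) (hG0 : ∀ k, ∀ t ≤ 0, G k t = 0) :
    ∃ (φ : ℕ → ℕ) (κ : ℝ → ℝ≥0∞), StrictMono φ ∧ Measurable κ ∧ (∀ t ≤ 0, κ t = 0) ∧
      AntitoneOn κ (Set.Ioi 0) ∧ ∀ᵐ t, Tendsto (fun k => G (φ k) t) atTop (𝓝 (κ t)) := by
  -- Compactness of `[0, ∞] ^ ℚ` replaces the diagonal argument and gives convergence at all
  -- rationals. The limsup along the subsequence then extends the limit monotonically to every real
  -- point.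
  obtain ⟨g, φ, hφ, hg⟩ := CompactSpace.tendsto_subseq (fun n : ℕ => fun q : ℚ => G n q)
  rw [tendsto_pi_nhds] at hg
  obtain ⟨κ, hκ⟩ : ∃ κ : ℝ → ℝ≥0∞, ∀ t, κ t = limsup (fun k => G (φ k) t) atTop :=
    ⟨_, fun _ => rfl⟩
  have hκa : AntitoneOn κ (Set.Ioi 0) := fun s hs t ht hst => by
    rw [hκ, hκ]
    exact limsup_le_limsup (Eventually.of_forall fun k => hGa _ hs ht hst)
  have hκ0 : ∀ t ≤ 0, κ t = 0 := fun t ht => by simp only [hκ, hG0 _ t ht, limsup_const]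
  have hκm : Measurable κ := by
    rw [funext hκ]
    exact Measurable.limsup fun k => hGm _
  refine ⟨φ, κ, hφ, hκm, hκ0, hκa, ?_⟩
  -- At a continuity point, the value at a rational slightly to the right bounds the liminf from
  -- below. A monotone function has only countably many discontinuities, hence almost everywhere
  -- convergence.
  have hconv : ∀ t, 0 < t → ContinuousWithinAt κ (Set.Ioi 0) t →
      Tendsto (fun k => G (φ k) t) atTop (𝓝 (κ t)) := by
    intro t ht hc
    have hc' : ContinuousAt κ t := hc.continuousAt (Ioi_mem_nhds ht)
    refine tendsto_of_le_liminf_of_limsup_le ?_ (hκ t).ge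
    refine le_of_forall_lt fun b hb => ?_
    have h1 : ∀ᶠ s in 𝓝[>] t, b < κ s := (hc'.eventually (lt_mem_nhds hb)).filter_mono
      nhdsWithin_le_nhds
    obtain ⟨u, hu, hsub⟩ := mem_nhdsGT_iff_exists_Ioo_subset.1 h1
    obtain ⟨q, hq1, hq2⟩ := exists_rat_btwn (show t < u from hu)
    have h2 : b < κ q := hsub ⟨hq1, hq2⟩
    have h3 : κ q = liminf (fun k => G (φ k) q) atTop :=
      (hκ q).trans (((hg q).limsup_eq).trans (hg q).liminf_eq.symm)
    rw [h3] at h2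
    exact h2.trans_le (liminf_le_liminf (Eventually.of_forall fun k =>
      hGa _ (Set.mem_Ioi.2 ht) (Set.mem_Ioi.2 (ht.trans hq1)) hq1.le))
  filter_upwards [hκa.countable_not_continuousWithinAt.ae_notMem (volume : Measure ℝ)] with t ht
  rcases le_or_gt t 0 with h | h
  · simp only [hκ0 t h, hG0 _ t h]
    exact tendsto_const_nhds
  · refine hconv t h ?_
    by_contra hn
    exact ht ⟨h, hn⟩

/-- The two singularities are separated by cutting at `t / 2`: on the left `p (t - y) ≤ p (t / 2)`
and `y ^ (-1/2)` is integrable, on the right the power is bounded and `p` is integrable. The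
integrand serves as majorant for the convolutions `G ⋆ p` in the existence proof. -/
lemma lintegral_rpow_mul_lt_top (hp : PotentialKernel p) {t : ℝ} (ht : 0 < t) (c : ℝ≥0) :
    ∫⁻ y, (Set.Ioo 0 t).indicator
      (fun y => ENNReal.ofReal (c * y ^ (-(1 / 2) : ℝ)) * p (-y + t)) y < ∞ := by
  have hpm := hp.measurable
  have hrp : ∫⁻ y in Set.Ioo 0 (t / 2), ENNReal.ofReal (c * y ^ (-(1 / 2) : ℝ)) < ∞ := by
    have := (intervalIntegral.intervalIntegrable_rpow' (a := 0) (b := t / 2)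
      (show (-1 : ℝ) < -(1 / 2) by norm_num)).const_mul (c : ℝ)
    rw [intervalIntegrable_iff_integrableOn_Ioo_of_le (by positivity)] at this
    exact this.lintegral_lt_top
  have hmi : Measurable ((Set.Iio t).indicator p) := hpm.indicator measurableSet_Iio
  have hm1 : Measurable fun y : ℝ => ENNReal.ofReal (c * y ^ (-(1 / 2) : ℝ)) * p (t / 2) := by
    fun_prop
  refine lt_of_le_of_lt (b := (∫⁻ y in Set.Ioo 0 (t / 2),
      ENNReal.ofReal (c * y ^ (-(1 / 2) : ℝ)) * p (t / 2))
      + ∫⁻ y, ENNReal.ofReal (c * (t / 2) ^ (-(1 / 2) : ℝ)) *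
        (Set.Iio t).indicator p (-y + t)) ?_ ?_
  · rw [← lintegral_indicator measurableSet_Ioo, ← lintegral_add_left
      (hm1.indicator measurableSet_Ioo)]
    refine lintegral_mono fun y => ?_
    by_cases hy : y ∈ Set.Ioo 0 t
    · rw [Set.indicator_of_mem hy]
      rcases lt_or_ge y (t / 2) with h | h
      · rw [Set.indicator_of_mem (show y ∈ Set.Ioo 0 (t / 2) from ⟨hy.1, h⟩)]
        refine le_add_right ?_
        gcongr
        exact hp.antitoneOn (Set.mem_Ioi.2 (by positivity)) (Set.mem_Ioi.2 (by linarith [hy.2]))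
          (by linarith)
      · refine le_add_left ?_
        rw [Set.indicator_of_mem (show -y + t ∈ Set.Iio t by simpa using hy.1)]
        gcongr ?_ * _
        refine ENNReal.ofReal_le_ofReal ?_
        refine mul_le_mul_of_nonneg_left ?_ (by positivity)
        exact Real.rpow_le_rpow_of_nonpos (by positivity) h (by norm_num)
    · rw [Set.indicator_of_notMem hy]; exact zero_le
  · rw [lintegral_mul_const _ (by fun_prop), lintegral_const_mul _ (by fun_prop)]
    refine (ENNReal.add_lt_top.2 ⟨ENNReal.mul_lt_top hrp (hp.ne_top _).lt_top,
      ENNReal.mul_lt_top ENNReal.ofReal_lt_top ?_⟩)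
    have := lintegral_sub_left_eq_self (μ := (volume : Measure ℝ)) ((Set.Iio t).indicator p) t
    rw [lintegral_indicator measurableSet_Iio] at this
    simp_rw [neg_add_eq_sub, this]
    exact hp.lintegral_lt_top t

/-- The chain is `r F y ≤ 1 / ∫_0^y p ≤ 1 / (y p(y)) ≤ c⁻¹ y ^ (-1/2)`; the bound does not depend on
`r`. -/
lemma IsRelaxation.mul_le_rpow (hp : PotentialKernel p) (hF : IsRelaxation p r F) {c t : ℝ}
    (hc : 0 < c) (hlow : ∀ y, 0 < y → y ≤ t → ENNReal.ofReal (c * y ^ (-(1 / 2) : ℝ)) ≤ p y)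
    {y : ℝ} (hy : 0 < y) (hyt : y ≤ t) :
    r * F y ≤ ENNReal.ofReal (c⁻¹ * y ^ (-(1 / 2) : ℝ)) := by
  refine (hF.mul_le hp y).trans ?_
  have h4 : ENNReal.ofReal (c * y ^ (1 / 2 : ℝ)) ≤ ∫⁻ u in Set.Iio y, p u := by
    refine le_trans ?_ (hp.mul_le_lintegral hy)
    refine le_trans ?_ (mul_le_mul_right (hlow y hy hyt) _)
    rw [← ENNReal.ofReal_mul hy.le]
    refine ENNReal.ofReal_le_ofReal (le_of_eq ?_)
    rw [mul_left_comm]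
    congr 1
    nth_rewrite 2 [← Real.rpow_one y]
    rw [← Real.rpow_add hy]
    norm_num
  refine (ENNReal.inv_le_inv.2 h4).trans_eq ?_
  rw [← ENNReal.ofReal_inv_of_pos (by positivity), mul_inv, Real.rpow_neg hy.le]

/-- A family of relaxation functions yields a Sonine partner in the limit. -/
theorem exists_isSoninePartner (hp : PotentialKernel p) {F : ℕ → ℝ → ℝ≥0∞}
    (hF : ∀ n : ℕ, IsRelaxation p (n + 1 : ℝ≥0) (F n)) : ∃ κ, IsSoninePartner p κ := by
  have hpm := hp.measurable
  obtain ⟨G, hG⟩ : ∃ G : ℕ → ℝ → ℝ≥0∞,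
      ∀ k t, G k t = ((k + 1 : ℝ≥0) : ℝ≥0∞) * F k t := ⟨_, fun _ _ => rfl⟩
  have hGm : ∀ k, Measurable (G k) := fun k => by
    rw [funext (hG k)]; exact (hF _).measurable.const_mul _
  have hG0 : ∀ k, ∀ t ≤ 0, G k t = 0 := fun k t ht => by simp [hG, (hF _).of_nonpos t ht]
  have hGa : ∀ k, AntitoneOn (G k) (Set.Ioi 0) := fun k s hs t ht hst => by
    rw [hG, hG]; exact mul_le_mul_right ((hF k).antitoneOn hs ht hst) _
  obtain ⟨φ, κ, hφ, hκm, hκ0, hκa, hae⟩ := exists_subseq_tendsto_of_antitoneOn hGm hGa hG0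
  have hr : Tendsto (fun k => (φ k + 1 : ℝ≥0)) atTop atTop :=
    tendsto_atTop_mono (fun _ => le_self_add)
      (tendsto_natCast_atTop_atTop.comp hφ.tendsto_atTop)
  refine ⟨κ, hκm, hκ0, hκa, fun t => ?_⟩
  rcases le_or_gt t 0 with ht | ht
  · rw [lconvolution_of_nonpos hp.of_nonpos hκ0 ht, unitStep_of_nonpos ht]
  have h1 : Tendsto (fun k => (p ⋆ₗ G (φ k)) t) atTop (𝓝 (unitStep t)) := by
    have h2 := tendsto_relaxation_zero hp hr (F := fun k => F (φ k))
      (Eventually.of_forall fun k => hF (φ k)) t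
    have h3 := ENNReal.Tendsto.sub (tendsto_const_nhds (x := unitStep t)) h2
      (Or.inr ENNReal.zero_ne_top)
    rw [tsub_zero] at h3
    refine h3.congr fun k => ?_
    rw [← (hF (φ k)).eq t, ENNReal.add_sub_cancel_left
      (ne_top_of_le_ne_top ENNReal.one_ne_top ((hF _).le_one t)),
      ← lconvolution_const_mul hpm (hF _).measurable, ← funext (hG (φ k))]
  -- The same sequence `p ⋆ (r F)` has the limit one by the relaxation equation, as `F → 0`, and the
  -- limit `p ⋆ κ` by dominated convergence.
  refine tendsto_nhds_unique ?_ h1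
  simp_rw [lconvolution_comm (f := p), lconvolution_def]
  obtain ⟨c, hc, hlow⟩ := hp.lower t ht
  have hB := lintegral_rpow_mul_lt_top hp ht (NNReal.mk c⁻¹ (by positivity))
  refine tendsto_lintegral_of_dominated_convergence _ (fun k => (hGm _).mul (by fun_prop))
    (fun k => ae_of_all _ fun y => ?_) hB.ne ?_
  · rcases le_or_gt y 0 with hy | hy
    · simp [hG0 _ y hy]
    rcases le_or_gt t y with hyt | hyt
    · simp [hp.of_nonpos (-y + t) (by linarith)]
    rw [Set.indicator_of_mem (show y ∈ Set.Ioo 0 t from ⟨hy, hyt⟩)]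
    refine mul_le_mul_left ?_ _
    rw [hG]
    exact (hF _).mul_le_rpow hp hc hlow hy hyt.le
  · filter_upwards [hae] with y hy
    exact ENNReal.Tendsto.mul_const hy (Or.inr (hp.ne_top _))





end Sonine

/-! ### The difference process and its Markov property -/

/-- `Z` is a right-continuous Lévy process with real exponent `ψ`, started at `0`, relative to the
filtration `𝒢`. -/
structure IsLevyProcess {Ω : Type*} [mΩ : MeasurableSpace Ω] (P : Measure Ω)
    (𝒢 : Filtration ℝ≥0 mΩ) (ψ : ℝ → ℝ) (Z : ℝ≥0 → Ω → ℝ) : Prop where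
  adapted : Adapted 𝒢 Z
  rightCont : ∀ ω t, ContinuousWithinAt (fun t => Z t ω) (Set.Ici t) t
  zero : ∀ᵐ ω ∂P, Z 0 ω = 0
  indep : ∀ s t : ℝ≥0, s < t →
    Indep (𝒢 s) (MeasurableSpace.comap (fun ω => Z t ω - Z s ω) inferInstance) P
  charFun_eq : ∀ s t : ℝ≥0, s < t → ∀ u : ℝ,
    charFun (P.map fun ω => Z t ω - Z s ω) u = Real.exp (-((t - s : ℝ) * ψ u))

/-- Integrating the conditional identity over `A ∈ m` shows that the law of `D` under `P` restricted
to `A` has characteristic function `P A * φ`. By uniqueness it equals `P A` times the law of `D`,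
which is independence. -/
lemma indep_of_condExp_cexp {Ω : Type*} {m mΩ : MeasurableSpace Ω} {P : Measure Ω}
    [IsProbabilityMeasure P] (hm : m ≤ mΩ)
    {D : Ω → ℝ} (hD : Measurable D) {φ : ℝ → ℝ}
    (h : ∀ u : ℝ, condExp m P (fun ω => Complex.exp (Complex.I * u * (D ω : ℂ)))
      =ᵐ[P] fun _ => (φ u : ℂ)) :
    Indep m (MeasurableSpace.comap D inferInstance) P ∧ ∀ u, charFun (P.map D) u = φ u := by
  have key : ∀ A, MeasurableSet[m] A → ∀ u : ℝ,
      ∫ ω in A, Complex.exp (u * (D ω : ℂ) * Complex.I) ∂P = P.real A * φ u := by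
    intro A hA u
    have hint : Integrable (fun ω => Complex.exp (Complex.I * u * (D ω : ℂ))) P := by
      refine Integrable.of_bound (C := 1) (by fun_prop) (ae_of_all _ fun ω => ?_)
      have := Complex.norm_exp_ofReal_mul_I (u * D ω)
      rw [show Complex.I * u * (D ω : ℂ) = ((u * D ω : ℝ) : ℂ) * Complex.I by push_cast; ring]
      exact this.le
    have h1 := setIntegral_condExp hm hint hA
    rw [setIntegral_congr_ae (g := fun _ => (φ u : ℂ)) (hm A hA) ((h u).mono fun ω hω _ => hω),
      setIntegral_const] at h1
    rw [Complex.real_smul] at h1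
    rw [h1]
    congr 1; ext ω; congr 1; ring
  have hchar : ∀ u, charFun (P.map D) u = φ u := by
    intro u
    rw [charFun_apply_real, integral_map hD.aemeasurable (by fun_prop)]
    simpa using key Set.univ MeasurableSet.univ u
  refine ⟨?_, hchar⟩
  rw [Indep_iff]
  rintro A _ hA ⟨B, hB, rfl⟩
  have : (P.restrict A).map D = P A • P.map D := by
    have : IsFiniteMeasure (P A • P.map D) := Measure.smul_finite _ (measure_ne_top P A)
    refine Measure.ext_of_charFun ?_
    ext u
    rw [charFun_apply_real, charFun_apply_real, integral_map hD.aemeasurable (by fun_prop),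
      integral_smul_measure, ← charFun_apply_real, hchar, key A hA u]
    rfl
  have h2 := congrArg (fun μ : Measure ℝ => μ B) this
  simp only [Measure.smul_apply, smul_eq_mul, Measure.map_apply hD hB] at h2
  rw [Measure.restrict_apply (hD hB), Set.inter_comm] at h2
  exact h2

section

variable {Ω : Type*} {mΩ : MeasurableSpace Ω} {P : Measure Ω}

lemma comap_prodMk_eq_generateFrom {δ δ' : Type*} [MeasurableSpace δ] [MeasurableSpace δ']
    (f : Ω → δ × δ') : MeasurableSpace.comap f inferInstance = MeasurableSpace.generateFrom
      {s | ∃ t ∈ Set.image2 (· ×ˢ ·) {s : Set δ | MeasurableSet s} {t : Set δ' | MeasurableSet t},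
        f ⁻¹' t = s} := by
  rw [← generateFrom_prod, MeasurableSpace.comap_generateFrom]
  rfl

/-- If the pairs `(a, b)` and `(c, d)` are independent, and so are `a, b` and `c, d`, then `(a, c)`
and `(b, d)` are independent. -/
lemma IndepFun.prodMk_prodMk_of_indepFun [IsProbabilityMeasure P] {β β' γ γ' : Type*}
    [MeasurableSpace β] [MeasurableSpace β'] [MeasurableSpace γ] [MeasurableSpace γ']
    {a : Ω → β} {b : Ω → β'} {c : Ω → γ} {d : Ω → γ'} (ha : Measurable a) (hb : Measurable b)
    (hc : Measurable c) (hd : Measurable d)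
    (h : IndepFun (fun ω => (a ω, b ω)) (fun ω => (c ω, d ω)) P)
    (hab : IndepFun a b P) (hcd : IndepFun c d P) :
    IndepFun (fun ω => (a ω, c ω)) (fun ω => (b ω, d ω)) P := by
  rw [IndepFun_iff_Indep]
  refine IndepSets.indep (ha.prodMk hc).comap_le (hb.prodMk hd).comap_le
    (isPiSystem_prod.comap _) (isPiSystem_prod.comap _) (comap_prodMk_eq_generateFrom _)
    (comap_prodMk_eq_generateFrom _) ?_
  rw [IndepSets_iff]
  rintro _ _ ⟨_, ⟨A, hA, C, hC, rfl⟩, rfl⟩ ⟨_, ⟨B, hB, D, hD, rfl⟩, rfl⟩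
  simp only [Set.mem_ofPred_eq] at hA hB hC hD
  have hac : IndepFun a c P := h.comp measurable_fst measurable_fst
  have hbd : IndepFun b d P := h.comp measurable_snd measurable_snd
  have h1 := h.measure_inter_preimage_eq_mul _ _ (hA.prod hB) (hC.prod hD)
  simp only [Set.mk_preimage_prod] at h1 ⊢
  rw [hab.measure_inter_preimage_eq_mul _ _ hA hB,
    hcd.measure_inter_preimage_eq_mul _ _ hC hD] at h1
  rw [hac.measure_inter_preimage_eq_mul _ _ hA hC, hbd.measure_inter_preimage_eq_mul _ _ hB hD,
    Set.inter_inter_inter_comm, h1]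
  ring

/-- The difference of two independent symmetric stable processes is a Lévy process relative to its
own history. -/
theorem IsSymmetricStable.isLevyProcess_sub [IsProbabilityMeasure P] {ℱ : Filtration ℝ≥0 mΩ}
    {α₁ α₂ : ℝ} {X Y : ℝ≥0 → Ω → ℝ} (hX : IsSymmetricStable P ℱ α₁ X)
    (hY : IsSymmetricStable P ℱ α₂ Y)
    (hXY : IndepFun (fun ω t => X t ω) (fun ω t => Y t ω) P) :
    ∃ 𝒢 : Filtration ℝ≥0 mΩ, IsLevyProcess P 𝒢 (fun u => |u| ^ α₁ + |u| ^ α₂)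
      (fun t ω => X t ω - Y t ω) := by
  have hXm : ∀ t, Measurable (X t) := fun t => (hX.adapted t).mono (ℱ.le t) le_rfl
  have hYm : ∀ t, Measurable (Y t) := fun t => (hY.adapted t).mono (ℱ.le t) le_rfl
  have hXY' : ∀ t, StronglyMeasurable fun ω => (X t ω, Y t ω) := fun t =>
    ((hXm t).prodMk (hYm t)).stronglyMeasurable
  have hincr : ∀ {α : ℝ} {W : ℝ≥0 → Ω → ℝ}, IsSymmetricStable P ℱ α W → ∀ s t : ℝ≥0, s < t →
      Indep (ℱ s) (MeasurableSpace.comap (fun ω => W t ω - W s ω) inferInstance) P ∧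
      ∀ u, charFun (P.map fun ω => W t ω - W s ω) u
        = (Real.exp (-((t : ℝ) - (s : ℝ)) * |u| ^ α) : ℝ) := by
    intro α W hW s t hst
    have hWm : ∀ t, Measurable (W t) := fun t => (hW.adapted t).mono (ℱ.le t) le_rfl
    exact indep_of_condExp_cexp (ℱ.le s) ((hWm t).sub (hWm s))
      (φ := fun u => Real.exp (-((t : ℝ) - (s : ℝ)) * |u| ^ α))
      fun u => hW.condExp_increment s t hst u
  have hpast : ∀ {α : ℝ} {W : ℝ≥0 → Ω → ℝ}, IsSymmetricStable P ℱ α W → ∀ s t : ℝ≥0, s < t →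
      IndepFun (fun ω (j : Set.Iic s) => W j ω) (fun ω => W t ω - W s ω) P := by
    intro α W hW s t hst
    rw [IndepFun_iff_Indep]
    refine indep_of_indep_of_le_left (hincr hW s t hst).1 ?_
    refine Measurable.comap_le ?_
    exact @measurable_pi_lambda _ _ _ (ℱ s) _ _ fun j => (hW.adapted j).mono (ℱ.mono j.2) le_rfl
  have hpair : ∀ s t : ℝ≥0, s < t →
      IndepFun (fun ω => ((fun j : Set.Iic s => X j ω), X t ω - X s ω))
        (fun ω => ((fun j : Set.Iic s => Y j ω), Y t ω - Y s ω)) P := by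
    intro s t hst
    have hg : Measurable fun x : ℝ≥0 → ℝ => ((fun j : Set.Iic s => x j), x t - x s) := by
      fun_prop
    exact hXY.comp hg hg
  -- The history of the pair `(X, Y)` replaces `ℱ`: each increment is independent of `ℱ s`, but the
  -- pair of increments need not be. For the pair's own history, independence of the two paths
  -- suffices.
  refine ⟨Filtration.natural (fun t ω => (X t ω, Y t ω)) hXY', ?_, ?_, ?_, ?_, ?_⟩
  · intro t
    have h1 : Measurable[Filtration.natural (fun t ω => (X t ω, Y t ω)) hXY' t]
        fun ω => (X t ω, Y t ω) :=
      (Filtration.stronglyAdapted_natural hXY' t).measurable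
    exact (measurable_fst.sub measurable_snd).comp h1
  · exact fun ω t => ((hX.cadlag ω).1 t).sub ((hY.cadlag ω).1 t)
  · filter_upwards [hX.zero, hY.zero] with ω h1 h2
    rw [h1, h2, sub_zero]
  · intro s t hst
    have h := IndepFun.prodMk_prodMk_of_indepFun
      (a := fun ω (j : Set.Iic s) => X j ω) (b := fun ω => X t ω - X s ω)
      (c := fun ω (j : Set.Iic s) => Y j ω) (d := fun ω => Y t ω - Y s ω)
      (measurable_pi_lambda _ fun j => hXm j) ((hXm t).sub (hXm s))
      (measurable_pi_lambda _ fun j => hYm j) ((hYm t).sub (hYm s))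
      (hpair s t hst) (hpast hX s t hst) (hpast hY s t hst)
    have h2 : IndepFun (fun ω (j : Set.Iic s) => (X j ω, Y j ω))
        (fun ω => (X t ω - Y t ω) - (X s ω - Y s ω)) P := by
      have := h.comp
        (φ := fun q : (Set.Iic s → ℝ) × (Set.Iic s → ℝ) => fun j : Set.Iic s => (q.1 j, q.2 j))
        (ψ := fun q : ℝ × ℝ => q.1 - q.2) (by fun_prop) (by fun_prop)
      have he : (fun ω => (X t ω - Y t ω) - (X s ω - Y s ω))
          = fun ω => (X t ω - X s ω) - (Y t ω - Y s ω) := by ext ω; ring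
      rw [he]
      exact this
    rw [IndepFun_iff_Indep] at h2
    rw [Filtration.natural_eq_comap]
    exact h2
  · intro s t hst u
    have hd : IndepFun (fun ω => X t ω - X s ω) (fun ω => -(Y t ω - Y s ω)) P :=
      (hpair s t hst).comp measurable_snd measurable_snd.neg
    have he : (fun ω => X t ω - Y t ω - (X s ω - Y s ω))
        = fun ω => (X t ω - X s ω) + -(Y t ω - Y s ω) := by ext ω; ring
    have hdX : Measurable fun ω => X t ω - X s ω := (hXm t).sub (hXm s)
    have hdY : Measurable fun ω => Y t ω - Y s ω := (hYm t).sub (hYm s)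
    have hdY' : Measurable fun ω => -(Y t ω - Y s ω) := hdY.neg
    rw [he, hd.charFun_map_fun_add_eq_mul hdX.aemeasurable hdY'.aemeasurable, Pi.mul_apply,
      (hincr hX s t hst).2]
    have hneg : charFun (P.map fun ω => -(Y t ω - Y s ω)) u
        = charFun (P.map fun ω => Y t ω - Y s ω) (-u) := by
      rw [charFun_apply_real, charFun_apply_real, integral_map hdY'.aemeasurable (by fun_prop),
        integral_map hdY.aemeasurable (by fun_prop)]
      congr 1; ext ω; push_cast; congr 1; ring
    rw [hneg, (hincr hY s t hst).2, abs_neg, ← Complex.ofReal_mul, ← Real.exp_add]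
    congr 2; ring

/-- A right-continuous process is jointly measurable. -/
lemma measurable_uncurry_of_rightCont {Z : ℝ≥0 → Ω → ℝ} (hZm : ∀ t, Measurable (Z t))
    (hZ : ∀ ω t, ContinuousWithinAt (fun t => Z t ω) (Set.Ici t) t) :
    Measurable fun q : ℝ≥0 × Ω => Z q.1 q.2 := by
  -- Time is rounded up to the next point of the grid of mesh `1 / (n + 1)`. The added one keeps the
  -- grid point to the right of `t`, where continuity is available.
  refine measurable_of_tendsto_metrizable (f := fun (n : ℕ) (q : ℝ≥0 × Ω) =>
    Z ((⌊(n + 1 : ℝ≥0) * q.1⌋₊ + 1) / (n + 1)) q.2) (fun n => ?_) ?_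
  · have h1 : Measurable fun q : ℕ × Ω => Z ((q.1 + 1) / (n + 1)) q.2 :=
      measurable_from_prod_countable_right fun k => hZm ((k + 1) / (n + 1))
    have h2 : Measurable fun q : ℝ≥0 × Ω => (⌊(n + 1 : ℝ≥0) * q.1⌋₊, q.2) :=
      (Nat.measurable_floor.comp (measurable_fst.const_mul _)).prodMk measurable_snd
    have h3 := h1.comp h2
    simp only [Function.comp_def] at h3
    exact h3
  · rw [tendsto_pi_nhds]
    rintro ⟨t, ω⟩
    refine Tendsto.comp (hZ ω t) (tendsto_nhdsWithin_iff.2 ⟨?_, Eventually.of_forall fun n => ?_⟩)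
    · have hb : Tendsto (fun n : ℕ => t + ((n : ℝ≥0) + 1)⁻¹) atTop (𝓝 t) := by
        have : Tendsto (fun n : ℕ => ((n : ℝ≥0) + 1)⁻¹) atTop (𝓝 0) := by
          rw [← NNReal.tendsto_coe]
          simpa [one_div] using tendsto_one_div_add_atTop_nhds_zero_nat (𝕜 := ℝ)
        simpa using tendsto_const_nhds.add this
      refine tendsto_of_tendsto_of_tendsto_of_le_of_le tendsto_const_nhds hb (fun n => ?_)
        (fun n => ?_)
      · rw [le_div_iff₀ (by positivity), mul_comm]
        exact (Nat.lt_floor_add_one _).le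
      · simp only
        rw [div_le_iff₀ (by positivity), add_mul t, inv_mul_cancel₀ (by positivity), mul_comm t]
        gcongr
        exact Nat.floor_le zero_le
    · rw [Set.mem_Ici, le_div_iff₀ (by positivity), mul_comm]
      exact (Nat.lt_floor_add_one _).le

namespace IsLevyProcess

variable {𝒢 : Filtration ℝ≥0 mΩ} {ψ : ℝ → ℝ} {Z : ℝ≥0 → Ω → ℝ}

lemma measurable (hZ : IsLevyProcess P 𝒢 ψ Z) (t : ℝ≥0) : Measurable (Z t) :=
  (hZ.adapted t).mono (𝒢.le t) le_rfl

lemma measurable_uncurry (hZ : IsLevyProcess P 𝒢 ψ Z) :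
    Measurable fun q : ℝ≥0 × Ω => Z q.1 q.2 :=
  measurable_uncurry_of_rightCont hZ.measurable hZ.rightCont

/-- The Markov property at a fixed time. -/
theorem lintegral_mul_comp [IsProbabilityMeasure P] (hZ : IsLevyProcess P 𝒢 ψ Z)
    (hψ : StableLikeExponent ψ) {s t : ℝ≥0} (hst : s < t) {G : Ω → ℝ≥0∞}
    (hG : Measurable[𝒢 s] G) {h : ℝ → ℝ≥0∞} (hh : Measurable h) :
    ∫⁻ ω, G ω * h (Z t ω) ∂P
      = ∫⁻ ω, G ω * (∫⁻ z, h z * transDensity ψ (t - s) (z - Z s ω)) ∂P := by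
  have hD : Measurable fun ω => Z t ω - Z s ω := (hZ.measurable t).sub (hZ.measurable s)
  have hV : Measurable[𝒢 s] fun ω => (G ω, Z s ω) := hG.prodMk (hZ.adapted s)
  have hV' : Measurable fun ω => (G ω, Z s ω) := hV.mono (𝒢.le s) le_rfl
  have hind : IndepFun (fun ω => (G ω, Z s ω)) (fun ω => Z t ω - Z s ω) P := by
    rw [IndepFun_iff_Indep]
    exact indep_of_indep_of_le_left (hZ.indep s t hst) (Measurable.comap_le hV)
  have hmap := (indepFun_iff_map_prod_eq_prod_map_map hV'.aemeasurable hD.aemeasurable).1 hind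
  have : IsProbabilityMeasure (P.map fun ω => Z t ω - Z s ω) :=
    Measure.isProbabilityMeasure_map hD.aemeasurable
  have hlaw : P.map (fun ω => Z t ω - Z s ω) = volume.withDensity (transDensity ψ (t - s)) :=
    hψ.eq_withDensity_transDensity (sub_pos.2 (NNReal.coe_lt_coe.2 hst)) (hZ.charFun_eq s t hst)
  have hq : Measurable (transDensity ψ (t - s)) := (hψ.continuous_transDensity _).measurable
  have hf : Measurable fun q : (ℝ≥0∞ × ℝ) × ℝ => q.1.1 * h (q.1.2 + q.2) := by fun_prop
  calc ∫⁻ ω, G ω * h (Z t ω) ∂P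
      = ∫⁻ ω, (fun q : (ℝ≥0∞ × ℝ) × ℝ => q.1.1 * h (q.1.2 + q.2))
          ((G ω, Z s ω), Z t ω - Z s ω) ∂P := by simp
    _ = ∫⁻ q, q.1.1 * h (q.1.2 + q.2)
          ∂((P.map fun ω => (G ω, Z s ω)).prod (P.map fun ω => Z t ω - Z s ω)) := by
        rw [← hmap, lintegral_map hf (hV'.prodMk hD)]
    _ = ∫⁻ ω, ∫⁻ d, G ω * h (Z s ω + d) ∂(P.map fun ω => Z t ω - Z s ω) ∂P := by
        rw [lintegral_prod _ hf.aemeasurable, lintegral_map hf.lintegral_prod_right' hV']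
    _ = _ := by
        refine lintegral_congr fun ω => ?_
        rw [lintegral_const_mul _ (by fun_prop), hlaw,
          lintegral_withDensity_eq_lintegral_mul _ hq (by fun_prop)]
        congr 1
        conv_rhs => rw [← lintegral_add_right_eq_self _ (Z s ω)]
        refine lintegral_congr fun d => ?_
        simp only [Pi.mul_apply, add_sub_cancel_right]
        rw [mul_comm, add_comm]

end IsLevyProcess

end

/-! ### Heat kernels and calculus along right-continuous paths -/

section HeatKernel

lemma heatKernel_nonneg {ε : ℝ} (hε : 0 < ε) (x : ℝ) : 0 ≤ heatKernel ε x := by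
  unfold heatKernel; positivity

lemma continuous_heatKernel (ε : ℝ) : Continuous (heatKernel ε) := by
  unfold heatKernel; fun_prop

lemma heatKernel_le {ε : ℝ} (hε : 0 < ε) (x : ℝ) :
    heatKernel ε x ≤ 1 / (2 * Real.pi * ε) ^ (1 / 2 : ℝ) := by
  unfold heatKernel
  refine mul_le_of_le_one_right (by positivity) ?_
  rw [Real.exp_le_one_iff, neg_nonpos]
  positivity

/-- The heat kernel is the density of `√ε` times a standard Gaussian variable. After this
substitution the measure no longer depends on `ε`, so the limit `ε → 0` becomes dominated
convergence. -/
lemma lintegral_heatKernel_mul {ε : ℝ} (hε : 0 < ε) {h : ℝ → ℝ≥0∞} (hh : Measurable h) :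
    ∫⁻ z, ENNReal.ofReal (heatKernel ε z) * h z = ∫⁻ w, h (√ε * w) ∂gaussianReal 0 1 := by
  have h1 := gaussianReal_map_const_mul (μ := 0) (v := 1) √ε
  have hv : NNReal.mk (√ε ^ 2) (sq_nonneg _) * 1 = ε.toNNReal := by
    ext
    simp [Real.sq_sqrt hε.le, hε.le]
  rw [hv, mul_zero] at h1
  rw [← lintegral_map hh (by fun_prop), h1, gaussianReal_of_var_ne_zero _ (by simpa using hε),
    lintegral_withDensity_eq_lintegral_mul _ (measurable_gaussianPDF _ _) hh]
  refine lintegral_congr fun z => ?_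
  rw [Pi.mul_apply]
  congr 1
  unfold gaussianPDF gaussianPDFReal heatKernel
  rw [Real.coe_toNNReal _ hε.le, Real.sqrt_eq_rpow, sub_zero, sq_abs, one_div, neg_div]

end HeatKernel

section Calculus

/-- Bounded, nonnegative, measurable and right-continuous functions on the line. -/
structure IsRightContDensity (f : ℝ → ℝ) : Prop where
  measurable : Measurable f
  nonneg : ∀ r, 0 ≤ f r
  bounded : ∃ C, ∀ r, f r ≤ C
  rightCont : ∀ r, ContinuousWithinAt f (Set.Ici r) r

namespace IsRightContDensity

variable {f g : ℝ → ℝ}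

lemma intervalIntegrable (hf : IsRightContDensity f) (a b : ℝ) :
    IntervalIntegrable f volume a b := by
  obtain ⟨C, hC⟩ := hf.bounded
  refine IntervalIntegrable.mono_fun' (g := fun _ => C) (by simp)
    hf.measurable.aestronglyMeasurable (ae_of_all _ fun r => ?_)
  exact (Real.norm_of_nonneg (hf.nonneg r)).trans_le (hC r)

lemma continuous_integral (hf : IsRightContDensity f) (t : ℝ) :
    Continuous fun r => ∫ u in r..t, f u := by
  simp_rw [intervalIntegral.integral_symm t]
  exact (intervalIntegral.continuous_primitive hf.intervalIntegrable t).neg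

/-- Paths with jumps give only a right derivative, which is enough for the fundamental theorem of
calculus used below. -/
lemma hasDerivWithinAt_integral (hf : IsRightContDensity f) (t r : ℝ) :
    HasDerivWithinAt (fun r => ∫ u in r..t, f u) (-f r) (Set.Ioi r) r :=
  (intervalIntegral.integral_hasDerivWithinAt_left (hf.intervalIntegrable r t)
    (s := Set.Ici r) (t := Set.Ioi r)
    (hf.measurable.stronglyMeasurable.stronglyMeasurableAtFilter)
    ((hf.rightCont r).mono Set.Ioi_subset_Ici_self)).mono Set.Ioi_subset_Ici_self

lemma integral_nonneg (hf : IsRightContDensity f) {r t : ℝ} (h : r ≤ t) :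
    0 ≤ ∫ u in r..t, f u := intervalIntegral.integral_nonneg h fun u _ => hf.nonneg u

lemma lintegral_Ioo_eq {F : ℝ → ℝ} {s t : ℝ} (hst : s ≤ t)
    (hF : IntervalIntegrable F volume s t) (h0 : ∀ r ∈ Set.Ioo s t, 0 ≤ F r) :
    ∫⁻ r in Set.Ioo s t, ENNReal.ofReal (F r) = ENNReal.ofReal (∫ r in s..t, F r) := by
  rw [intervalIntegral.integral_of_le hst, integral_Ioc_eq_integral_Ioo,
    ofReal_integral_eq_lintegral_ofReal]
  · exact (intervalIntegrable_iff_integrableOn_Ioo_of_le hst).1 hF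
  · exact (ae_restrict_iff' measurableSet_Ioo).2 (ae_of_all _ h0)

/-- The integrand is the right derivative of `-(∫_r^t f) ^ (n + 1) / (n + 1)!`. By induction,
iterated integrals over ordered times become powers divided by factorials. -/
lemma lintegral_mul_pow (hf : IsRightContDensity f) {s t : ℝ} (hst : s ≤ t) (n : ℕ) :
    ∫⁻ r in Set.Ioo s t, ENNReal.ofReal (f r) *
        ENNReal.ofReal ((∫ u in r..t, f u) ^ n / n.factorial)
      = ENNReal.ofReal ((∫ u in s..t, f u) ^ (n + 1) / (n + 1).factorial) := by
  have hc := hf.continuous_integral t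
  have hint : IntervalIntegrable (fun r => f r * ((∫ u in r..t, f u) ^ n / n.factorial))
      volume s t := (hf.intervalIntegrable s t).mul_continuousOn (by fun_prop)
  have h1 : ∫ r in s..t, f r * ((∫ u in r..t, f u) ^ n / n.factorial)
      = (∫ u in s..t, f u) ^ (n + 1) / (n + 1).factorial := by
    rw [intervalIntegral.integral_eq_sub_of_hasDeriv_right
      (f := fun r => -((∫ u in r..t, f u) ^ (n + 1) / (n + 1).factorial)) (by fun_prop) ?_ hint]
    · simp
    · intro r _
      have := (((hf.hasDerivWithinAt_integral t r).pow (n + 1)).div_const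
        ((n + 1).factorial : ℝ)).neg
      refine this.congr_deriv ?_
      rw [Nat.factorial_succ]
      push_cast
      field_simp
  rw [← h1, ← lintegral_Ioo_eq hst hint]
  · refine lintegral_congr fun r => ?_
    rw [ENNReal.ofReal_mul (hf.nonneg r)]
  · intro r hr
    have := hf.integral_nonneg hr.2.le
    have := hf.nonneg r
    positivity

/-- Product rule for `(∫_r^t f) (∫_r^t g)`: the square of times is the union of its two ordered
triangles. -/
lemma lintegral_mul_add_mul (hf : IsRightContDensity f) (hg : IsRightContDensity g) {s t : ℝ}
    (hst : s ≤ t) :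
    (∫⁻ r in Set.Ioo s t, ENNReal.ofReal (f r) * ENNReal.ofReal (∫ u in r..t, g u))
      + ∫⁻ r in Set.Ioo s t, ENNReal.ofReal (g r) * ENNReal.ofReal (∫ u in r..t, f u)
      = ENNReal.ofReal ((∫ u in s..t, f u) * ∫ u in s..t, g u) := by
  have hcf := hf.continuous_integral t
  have hcg := hg.continuous_integral t
  have hint1 : IntervalIntegrable (fun r => f r * (∫ u in r..t, g u)) volume s t :=
    (hf.intervalIntegrable s t).mul_continuousOn (by fun_prop)
  have hint2 : IntervalIntegrable (fun r => g r * (∫ u in r..t, f u)) volume s t :=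
    (hg.intervalIntegrable s t).mul_continuousOn (by fun_prop)
  have h1 : (∫ r in s..t, f r * (∫ u in r..t, g u)) + ∫ r in s..t, g r * (∫ u in r..t, f u)
      = (∫ u in s..t, f u) * ∫ u in s..t, g u := by
    rw [← intervalIntegral.integral_add hint1 hint2,
      intervalIntegral.integral_eq_sub_of_hasDeriv_right
      (f := fun r => -((∫ u in r..t, f u) * ∫ u in r..t, g u)) (by fun_prop) ?_
      (hint1.add hint2)]
    · simp
    · intro r _
      refine ((hf.hasDerivWithinAt_integral t r).mul
        (hg.hasDerivWithinAt_integral t r)).neg.congr_deriv ?_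
      ring
  have hn1 : ∀ r ∈ Set.Ioo s t, 0 ≤ f r * (∫ u in r..t, g u) := fun r hr =>
    mul_nonneg (hf.nonneg r) (hg.integral_nonneg hr.2.le)
  have hn2 : ∀ r ∈ Set.Ioo s t, 0 ≤ g r * (∫ u in r..t, f u) := fun r hr =>
    mul_nonneg (hg.nonneg r) (hf.integral_nonneg hr.2.le)
  simp_rw [← ENNReal.ofReal_mul (hf.nonneg _), ← ENNReal.ofReal_mul (hg.nonneg _)]
  rw [lintegral_Ioo_eq hst hint1 hn1, lintegral_Ioo_eq hst hint2 hn2, ← h1, ENNReal.ofReal_add]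
  · rw [intervalIntegral.integral_of_le hst, integral_Ioc_eq_integral_Ioo]
    exact setIntegral_nonneg measurableSet_Ioo hn1
  · rw [intervalIntegral.integral_of_le hst, integral_Ioc_eq_integral_Ioo]
    exact setIntegral_nonneg measurableSet_Ioo hn2

end IsRightContDensity

end Calculus

/-! ### Iterated potentials and their limits -/

section Green

/-- The iterated potentials describing the moments of the approximate local times: `greenTerm ψ ε n`
is the expectation, started at `x` with remaining time `ρ`, of the `n`-fold iterated time integral
of the heat kernels with variances `ε (n - 1), …, ε 0`. -/
noncomputable def greenTerm (ψ : ℝ → ℝ) (ε : ℕ → ℝ) : ℕ → ℝ → ℝ → ℝ≥0∞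
  | 0, ρ, _ => unitStep ρ
  | n + 1, ρ, x => ∫⁻ u, ∫⁻ w, transDensity ψ u (√(ε n) * w - x) *
      greenTerm ψ ε n (-u + ρ) (√(ε n) * w) ∂gaussianReal 0 1

variable {ψ : ℝ → ℝ}

lemma greenTerm_of_nonpos (ψ : ℝ → ℝ) (ε : ℕ → ℝ) :
    ∀ (n : ℕ) {ρ : ℝ} (_ : ρ ≤ 0) (x : ℝ), greenTerm ψ ε n ρ x = 0
  | 0, _, h, _ => unitStep_of_nonpos h
  | n + 1, ρ, h, x => by
    rw [greenTerm, lintegral_eq_zero_of_ae_eq_zero]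
    refine ae_of_all _ fun u => ?_
    rcases le_or_gt u 0 with hu | hu
    · simp [transDensity_of_nonpos ψ hu]
    · simp [greenTerm_of_nonpos ψ ε n (show -u + ρ ≤ 0 by linarith)]

lemma measurable_greenTerm (hψ : StableLikeExponent ψ) (ε : ℕ → ℝ) :
    ∀ n, Measurable (Function.uncurry (greenTerm ψ ε n))
  | 0 => measurable_unitStep.comp measurable_fst
  | n + 1 => by
    have ih := measurable_greenTerm hψ ε n
    have hq := hψ.measurable_transDensity
    have h1 : Measurable fun q : ((ℝ × ℝ) × ℝ) × ℝ =>
        transDensity ψ q.1.2 (√(ε n) * q.2 - q.1.1.2) *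
          greenTerm ψ ε n (-q.1.2 + q.1.1.1) (√(ε n) * q.2) := by
      refine Measurable.mul ?_ ?_
      · exact hq.comp (f := fun q : ((ℝ × ℝ) × ℝ) × ℝ => (q.1.2, √(ε n) * q.2 - q.1.1.2))
          (by fun_prop)
      · exact ih.comp (f := fun q : ((ℝ × ℝ) × ℝ) × ℝ => (-q.1.2 + q.1.1.1, √(ε n) * q.2))
          (by fun_prop)
    exact (h1.lintegral_prod_right' (ν := gaussianReal 0 1)).lintegral_prod_right'

lemma measurable_greenTerm_integrand (hψ : StableLikeExponent ψ) (ε : ℕ → ℝ) (n : ℕ) (u ρ x : ℝ) :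
    Measurable fun w => transDensity ψ u (√(ε n) * w - x) *
      greenTerm ψ ε n (-u + ρ) (√(ε n) * w) := by
  refine Measurable.mul ?_ ?_
  · exact (hψ.continuous_transDensity u).measurable.comp (by fun_prop)
  · exact (measurable_greenTerm hψ ε n).comp (f := fun w => (-u + ρ, √(ε n) * w)) (by fun_prop)

lemma measurable_lintegral_greenTerm_integrand (hψ : StableLikeExponent ψ) (ε : ℕ → ℝ) (n : ℕ)
    (ρ : ℝ) : Measurable fun q : ℝ × ℝ => ∫⁻ w, transDensity ψ q.1 (√(ε n) * w - q.2) *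
      greenTerm ψ ε n (-q.1 + ρ) (√(ε n) * w) ∂gaussianReal 0 1 := by
  have h1 : Measurable fun q : (ℝ × ℝ) × ℝ =>
      transDensity ψ q.1.1 (√(ε n) * q.2 - q.1.2) *
        greenTerm ψ ε n (-q.1.1 + ρ) (√(ε n) * q.2) := by
    refine Measurable.mul ?_ ?_
    · exact hψ.measurable_transDensity.comp
        (f := fun q : (ℝ × ℝ) × ℝ => (q.1.1, √(ε n) * q.2 - q.1.2)) (by fun_prop)
    · exact (measurable_greenTerm hψ ε n).comp
        (f := fun q : (ℝ × ℝ) × ℝ => (-q.1.1 + ρ, √(ε n) * q.2)) (by fun_prop)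
  exact h1.lintegral_prod_right'

/-- Every density is replaced by its maximum, attained at the origin. The bound is uniform in the
variances and the starting point and serves in all the dominated convergence arguments below. -/
lemma greenTerm_le (hψ : StableLikeExponent ψ) (ε : ℕ → ℝ) :
    ∀ (n : ℕ) (ρ x : ℝ), greenTerm ψ ε n ρ x ≤ renewalTerm (fun t => transDensity ψ t 0) n ρ
  | 0, _, _ => le_rfl
  | n + 1, ρ, x => by
    refine lintegral_mono fun u => ?_
    calc _ ≤ ∫⁻ _, transDensity ψ u 0 * renewalTerm (fun t => transDensity ψ t 0) n (-u + ρ)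
          ∂gaussianReal 0 1 := by
          refine lintegral_mono fun w => ?_
          exact mul_le_mul' (hψ.transDensity_le _ _) (greenTerm_le hψ ε n _ _)
      _ = _ := by simp

lemma renewalTerm_ne_top {p : ℝ → ℝ≥0∞} (hp : PotentialKernel p) (n : ℕ) (t : ℝ) :
    renewalTerm p n t ≠ ∞ := by
  obtain ⟨K, hK, h⟩ := exists_renewalTerm_le hp t one_pos
  exact ne_top_of_le_ne_top (by simpa using hK) (h n t le_rfl)

/-- As the variances and the starting point tend to zero, the iterated potentials converge to the
iterated convolutions of the on-diagonal density. -/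
theorem tendsto_greenTerm (hψ : StableLikeExponent ψ) {ι : Type*} {l : Filter ι}
    [l.IsCountablyGenerated] {ε : ι → ℕ → ℝ} (hε : ∀ k, Tendsto (fun i => ε i k) l (𝓝 0)) :
    ∀ (n : ℕ) (ρ : ℝ) (x : ι → ℝ), Tendsto x l (𝓝 0) →
      Tendsto (fun i => greenTerm ψ (ε i) n ρ (x i)) l
        (𝓝 (renewalTerm (fun t => transDensity ψ t 0) n ρ))
  | 0, _, _, _ => tendsto_const_nhds
  | n + 1, ρ, x, hx => by
    have hp := hψ.potentialKernel
    have hfin := renewalTerm_ne_top hp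
    refine tendsto_lintegral_filter_of_dominated_convergence (fun u => transDensity ψ u 0 *
      renewalTerm (fun t => transDensity ψ t 0) n (-u + ρ)) ?_ ?_ (hfin (n + 1) ρ) ?_
    · refine Eventually.of_forall fun i => ?_
      exact (measurable_lintegral_greenTerm_integrand hψ (ε i) n ρ).comp
        (f := fun u => (u, x i)) (by fun_prop)
    · refine Eventually.of_forall fun i => ae_of_all _ fun u => ?_
      calc _ ≤ ∫⁻ _, transDensity ψ u 0 * renewalTerm (fun t => transDensity ψ t 0) n (-u + ρ)
            ∂gaussianReal 0 1 := by
            refine lintegral_mono fun w => ?_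
            exact mul_le_mul' (hψ.transDensity_le _ _) (greenTerm_le hψ (ε i) n _ _)
        _ = _ := by simp
    · refine ae_of_all _ fun u => ?_
      have h1 : Tendsto (fun i => ∫⁻ w, transDensity ψ u (√(ε i n) * w - x i) *
          greenTerm ψ (ε i) n (-u + ρ) (√(ε i n) * w) ∂gaussianReal 0 1) l
          (𝓝 (∫⁻ _, transDensity ψ u 0 * renewalTerm (fun t => transDensity ψ t 0) n (-u + ρ)
            ∂gaussianReal 0 1)) := by
        refine tendsto_lintegral_filter_of_dominated_convergence (fun _ => transDensity ψ u 0 *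
          renewalTerm (fun t => transDensity ψ t 0) n (-u + ρ)) ?_ ?_ ?_ ?_
        · exact Eventually.of_forall fun i =>
            measurable_greenTerm_integrand hψ (ε i) n u ρ (x i)
        · exact Eventually.of_forall fun i => ae_of_all _ fun w =>
            mul_le_mul' (hψ.transDensity_le _ _) (greenTerm_le hψ (ε i) n _ _)
        · simpa using ENNReal.mul_ne_top (transDensity_ne_top ψ u 0) (hfin n (-u + ρ))
        · refine ae_of_all _ fun w => ?_
          -- The next starting point `√ε w` also moves to zero; for this reason the induction allows
          -- a variable starting point.
          have hw : Tendsto (fun i => √(ε i n) * w) l (𝓝 0) := by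
            have := ((Real.continuous_sqrt.tendsto 0).comp (hε n)).mul_const w
            simpa using this
          refine ENNReal.Tendsto.mul ?_ (Or.inr (hfin n _))
            (tendsto_greenTerm hψ hε n (-u + ρ) _ hw) (Or.inr (transDensity_ne_top ψ u 0))
          refine ((hψ.continuous_transDensity u).tendsto 0).comp ?_
          simpa using hw.sub hx
      simpa using h1

end Green

/-! ### Moments of the approximate local times -/

section Moments

variable {Ω : Type*} {mΩ : MeasurableSpace Ω} {P : Measure Ω} {𝒢 : Filtration ℝ≥0 mΩ}
  {ψ : ℝ → ℝ} {Z : ℝ≥0 → Ω → ℝ}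

/-- The iterated time integrals over `(s, t)` of the heat kernels with variances
`ε (n - 1), …, ε 0` along the path of `Z`. -/
noncomputable def iteratedOccupation (Z : ℝ≥0 → Ω → ℝ) (ε : ℕ → ℝ) (t : ℝ) :
    ℕ → ℝ → Ω → ℝ≥0∞
  | 0, _, _ => 1
  | n + 1, s, ω => ∫⁻ r in Set.Ioo s t, ENNReal.ofReal (heatKernel (ε n) (Z r.toNNReal ω)) *
      iteratedOccupation Z ε t n r ω

/-- The approximate local time `∫_s^t p_ε(Z_r) dr` of `Z` at zero. -/
noncomputable def approxLocalTime (Z : ℝ≥0 → Ω → ℝ) (ε s t : ℝ) (ω : Ω) : ℝ :=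
  ∫ r in s..t, heatKernel ε (Z r.toNNReal ω)

lemma IsLevyProcess.measurable_toNNReal (hZ : IsLevyProcess P 𝒢 ψ Z) :
    Measurable fun q : ℝ × Ω => Z q.1.toNNReal q.2 :=
  hZ.measurable_uncurry.comp (f := fun q : ℝ × Ω => (q.1.toNNReal, q.2)) (by fun_prop)

lemma measurable_iteratedOccupation (hZ : IsLevyProcess P 𝒢 ψ Z) (ε : ℕ → ℝ) (t : ℝ) :
    ∀ n, Measurable (Function.uncurry (iteratedOccupation Z ε t n))
  | 0 => measurable_const
  | n + 1 => by
    have ih := measurable_iteratedOccupation hZ ε t n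
    have h1 : Measurable fun q : (ℝ × Ω) × ℝ => Set.indicator {q : (ℝ × Ω) × ℝ | q.1.1 < q.2 ∧ q.2 < t}
        (fun q => ENNReal.ofReal (heatKernel (ε n) (Z q.2.toNNReal q.1.2)) *
          iteratedOccupation Z ε t n q.2 q.1.2) q := by
      refine Measurable.indicator (Measurable.mul ?_ ?_) ?_
      · exact ((continuous_heatKernel _).measurable.comp (hZ.measurable_toNNReal.comp
          (f := fun q : (ℝ × Ω) × ℝ => (q.2, q.1.2)) (by fun_prop))).ennreal_ofReal
      · exact ih.comp (f := fun q : (ℝ × Ω) × ℝ => (q.2, q.1.2)) (by fun_prop)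
      · exact (measurableSet_lt (measurable_fst.comp measurable_fst) measurable_snd).inter
          (measurableSet_lt measurable_snd measurable_const)
    have h2 := h1.lintegral_prod_right' (ν := (volume : Measure ℝ))
    convert h2 using 1
    ext ⟨s, ω⟩
    rw [Function.uncurry_apply_pair, iteratedOccupation, ← lintegral_indicator measurableSet_Ioo]
    rfl

/-- The moment formula: iterated application of the Markov property. -/
theorem lintegral_mul_iteratedOccupation [IsProbabilityMeasure P] (hZ : IsLevyProcess P 𝒢 ψ Z)
    (hψ : StableLikeExponent ψ) {ε : ℕ → ℝ} (hε : ∀ k, 0 < ε k) (t : ℝ) :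
    ∀ (n : ℕ) (s : ℝ), 0 ≤ s → s < t → ∀ G : Ω → ℝ≥0∞, Measurable[𝒢 s.toNNReal] G →
      ∫⁻ ω, G ω * iteratedOccupation Z ε t n s ω ∂P
        = ∫⁻ ω, G ω * greenTerm ψ ε n (t - s) (Z s.toNNReal ω) ∂P
  | 0, s, _, hst, G, _ => by
    simp only [iteratedOccupation, greenTerm, unitStep_of_pos (sub_pos.2 hst)]
  | n + 1, s, hs, hst, G, hG => by
    have hG' : Measurable G := hG.mono (𝒢.le _) le_rfl
    have hJ := measurable_iteratedOccupation hZ ε t n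
    have hZm := hZ.measurable_toNNReal
    have hU := measurable_greenTerm hψ ε n
    have hm1 : Measurable fun q : Ω × ℝ => G q.1 *
        (ENNReal.ofReal (heatKernel (ε n) (Z q.2.toNNReal q.1)) *
          iteratedOccupation Z ε t n q.2 q.1) := by
      refine (hG'.comp measurable_fst).mul (Measurable.mul ?_ ?_)
      · exact ((continuous_heatKernel _).measurable.comp
          (hZm.comp (f := fun q : Ω × ℝ => (q.2, q.1)) (by fun_prop))).ennreal_ofReal
      · exact hJ.comp (f := fun q : Ω × ℝ => (q.2, q.1)) (by fun_prop)
    have hm2 : Measurable fun q : ℝ × Ω => G q.2 *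
        ∫⁻ w, transDensity ψ (q.1 - s) (√(ε n) * w - Z s.toNNReal q.2) *
          greenTerm ψ ε n (-(q.1 - s) + (t - s)) (√(ε n) * w) ∂gaussianReal 0 1 := by
      refine (hG'.comp measurable_snd).mul ?_
      exact (measurable_lintegral_greenTerm_integrand hψ ε n (t - s)).comp
        (f := fun q : ℝ × Ω => (q.1 - s, Z s.toNNReal q.2))
        ((measurable_fst.sub_const s).prodMk ((hZ.measurable _).comp measurable_snd))
    calc ∫⁻ ω, G ω * iteratedOccupation Z ε t (n + 1) s ω ∂P
        = ∫⁻ ω, (∫⁻ r in Set.Ioo s t, G ω *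
            (ENNReal.ofReal (heatKernel (ε n) (Z r.toNNReal ω)) *
              iteratedOccupation Z ε t n r ω)) ∂P := by
          refine lintegral_congr fun ω => ?_
          rw [iteratedOccupation, lintegral_const_mul]
          have := hJ
          refine Measurable.mul ?_ ?_
          · exact ((continuous_heatKernel _).measurable.comp
              (hZm.comp (f := fun r : ℝ => (r, ω)) (by fun_prop))).ennreal_ofReal
          · exact hJ.comp (f := fun r : ℝ => (r, ω)) (by fun_prop)
      _ = ∫⁻ r in Set.Ioo s t, ∫⁻ ω, G ω * (ENNReal.ofReal (heatKernel (ε n) (Z r.toNNReal ω)) *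
            iteratedOccupation Z ε t n r ω) ∂P := by
          rw [lintegral_lintegral_swap hm1.aemeasurable]
      _ = ∫⁻ r in Set.Ioo s t, ∫⁻ ω, G ω *
            (∫⁻ w, transDensity ψ (r - s) (√(ε n) * w - Z s.toNNReal ω) *
              greenTerm ψ ε n (-(r - s) + (t - s)) (√(ε n) * w) ∂gaussianReal 0 1) ∂P := by
          refine setLIntegral_congr_fun measurableSet_Ioo fun r hr => ?_
          have hr0 : 0 ≤ r := hs.trans hr.1.le
          have hsr : s.toNNReal < r.toNNReal := (Real.toNNReal_lt_toNNReal_iff (hs.trans_lt hr.1)).2 hr.1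
          -- The heat kernel at time `r` is absorbed into the weight, which is known at time `r`.
          -- The induction hypothesis handles the times after `r`, and the Markov property from `s`
          -- to `r` then averages over `Z r`.
          have hZr : Measurable[𝒢 r.toNNReal] fun ω =>
              G ω * ENNReal.ofReal (heatKernel (ε n) (Z r.toNNReal ω)) :=
            Measurable.mul (hG.mono (𝒢.mono hsr.le) le_rfl)
              (ENNReal.measurable_ofReal.comp
                ((continuous_heatKernel _).measurable.comp (hZ.adapted r.toNNReal)))
          have ih := lintegral_mul_iteratedOccupation hZ hψ hε t n r hr0 hr.2 _ hZr
          have hgm : Measurable fun z => greenTerm ψ ε n (t - r) z :=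
            hU.comp (f := fun z : ℝ => (t - r, z)) (by fun_prop)
          have hhm : Measurable fun z => ENNReal.ofReal (heatKernel (ε n) z) :=
            (continuous_heatKernel _).measurable.ennreal_ofReal
          have hmark := hZ.lintegral_mul_comp hψ hsr hG (h := fun z =>
            ENNReal.ofReal (heatKernel (ε n) z) * greenTerm ψ ε n (t - r) z) (hhm.mul hgm)
          simp only [mul_assoc] at ih hmark
          rw [ih, hmark]
          refine lintegral_congr fun ω => ?_
          congr 1
          rw [lintegral_heatKernel_mul (hε n), Real.coe_toNNReal _ hr0, Real.coe_toNNReal _ hs]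
          · refine lintegral_congr fun w => ?_
            rw [mul_comm, show -(r - s) + (t - s) = t - r by ring]
          · exact hgm.mul ((hψ.continuous_transDensity _).measurable.comp (by fun_prop))
      _ = ∫⁻ ω, (∫⁻ r in Set.Ioo s t, G ω *
            (∫⁻ w, transDensity ψ (r - s) (√(ε n) * w - Z s.toNNReal ω) *
              greenTerm ψ ε n (-(r - s) + (t - s)) (√(ε n) * w) ∂gaussianReal 0 1)) ∂P := by
          rw [lintegral_lintegral_swap hm2.aemeasurable]
      _ = ∫⁻ ω, G ω * greenTerm ψ ε (n + 1) (t - s) (Z s.toNNReal ω) ∂P := by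
          refine lintegral_congr fun ω => ?_
          have hm3 : Measurable fun u => ∫⁻ w, transDensity ψ u (√(ε n) * w - Z s.toNNReal ω) *
              greenTerm ψ ε n (-u + (t - s)) (√(ε n) * w) ∂gaussianReal 0 1 :=
            (measurable_lintegral_greenTerm_integrand hψ ε n (t - s)).comp
              (f := fun u => (u, Z s.toNNReal ω)) (by fun_prop)
          have hm4 := hm3.comp (measurable_id.sub_const s)
          simp only [Function.comp_def, id] at hm4
          rw [lintegral_const_mul _ hm4, greenTerm]
          congr 1
          -- The substitution `u = r - s` passes from elapsed to absolute time; outside `(s, t)`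
          -- either the density or the remaining potential vanishes.
          rw [eq_comm, ← lintegral_sub_right_eq_self _ s, ← lintegral_indicator measurableSet_Ioo]
          refine lintegral_congr fun r => ?_
          by_cases hr : r ∈ Set.Ioo s t
          · rw [Set.indicator_of_mem hr]
          · rw [Set.indicator_of_notMem hr, eq_comm, lintegral_eq_zero_of_ae_eq_zero]
            refine ae_of_all _ fun w => ?_
            rcases le_or_gt r s with h | h
            · simp [transDensity_of_nonpos ψ (sub_nonpos.2 h)]
            · have : t ≤ r := by
                by_contra h'
                exact hr ⟨h, not_le.1 h'⟩
              simp [greenTerm_of_nonpos ψ ε n (sub_nonpos.2 this)]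

lemma lintegral_iteratedOccupation [IsProbabilityMeasure P] (hZ : IsLevyProcess P 𝒢 ψ Z)
    (hψ : StableLikeExponent ψ) {ε : ℕ → ℝ} (hε : ∀ k, 0 < ε k) {t : ℝ} (ht : 0 < t) (n : ℕ) :
    ∫⁻ ω, iteratedOccupation Z ε t n 0 ω ∂P = greenTerm ψ ε n t 0 := by
  have h := lintegral_mul_iteratedOccupation hZ hψ hε t n 0 le_rfl ht (fun _ => 1)
    measurable_const
  simp only [one_mul, sub_zero, Real.toNNReal_zero] at h
  rw [h, lintegral_congr_ae (g := fun _ => greenTerm ψ ε n t 0)]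
  · simp
  · filter_upwards [hZ.zero] with ω hω
    rw [hω]

lemma IsLevyProcess.isRightContDensity (hZ : IsLevyProcess P 𝒢 ψ Z) {ε : ℝ} (hε : 0 < ε)
    (ω : Ω) : IsRightContDensity fun r : ℝ => heatKernel ε (Z r.toNNReal ω) where
  measurable := (continuous_heatKernel ε).measurable.comp
    (hZ.measurable_toNNReal.comp (f := fun r : ℝ => (r, ω)) (by fun_prop))
  nonneg r := heatKernel_nonneg hε _
  bounded := ⟨_, fun r => heatKernel_le hε _⟩
  rightCont r := by
    refine (continuous_heatKernel ε).continuousAt.comp_continuousWithinAt ?_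
    exact (hZ.rightCont ω r.toNNReal).comp
      (t := Set.Ici r.toNNReal) continuous_real_toNNReal.continuousWithinAt
      fun r' hr' => Real.toNNReal_le_toNNReal hr'

lemma iteratedOccupation_const (hZ : IsLevyProcess P 𝒢 ψ Z) {ε : ℝ} (hε : 0 < ε) (t : ℝ) (ω : Ω) :
    ∀ (n : ℕ) (s : ℝ), s ≤ t → iteratedOccupation Z (fun _ => ε) t n s ω
      = ENNReal.ofReal (approxLocalTime Z ε s t ω ^ n / n.factorial)
  | 0, _, _ => by simp [iteratedOccupation]
  | n + 1, s, hst => by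
    rw [iteratedOccupation, approxLocalTime,
      ← (hZ.isRightContDensity hε ω).lintegral_mul_pow hst n]
    refine setLIntegral_congr_fun measurableSet_Ioo fun r hr => ?_
    rw [iteratedOccupation_const hZ hε t ω n r hr.2.le]
    rfl

/-- The moments of the approximate local time. -/
theorem lintegral_approxLocalTime_pow [IsProbabilityMeasure P] (hZ : IsLevyProcess P 𝒢 ψ Z)
    (hψ : StableLikeExponent ψ) {ε t : ℝ} (hε : 0 < ε) (ht : 0 < t) (n : ℕ) :
    ∫⁻ ω, ENNReal.ofReal (approxLocalTime Z ε 0 t ω ^ n / n.factorial) ∂P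
      = greenTerm ψ (fun _ => ε) n t 0 := by
  rw [← lintegral_iteratedOccupation hZ hψ (fun _ => hε) ht]
  refine lintegral_congr fun ω => ?_
  rw [iteratedOccupation_const hZ hε t ω n 0 ht.le]

/-- The mixed second moments of the approximate local times. -/
theorem lintegral_approxLocalTime_mul [IsProbabilityMeasure P] (hZ : IsLevyProcess P 𝒢 ψ Z)
    (hψ : StableLikeExponent ψ) {ε δ t : ℝ} (hε : 0 < ε) (hδ : 0 < δ) (ht : 0 < t) :
    ∫⁻ ω, ENNReal.ofReal (approxLocalTime Z ε 0 t ω * approxLocalTime Z δ 0 t ω) ∂P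
      = greenTerm ψ (fun k => if k = 0 then δ else ε) 2 t 0
        + greenTerm ψ (fun k => if k = 0 then ε else δ) 2 t 0 := by
  have hpos : ∀ {a b : ℝ}, 0 < a → 0 < b → ∀ k : ℕ, 0 < if k = 0 then a else b := by
    intro a b ha hb k; split_ifs <;> assumption
  -- In the twofold iterated integral the outer kernel has index one and the inner kernel index
  -- zero.
  have hstep : ∀ {a b : ℝ}, 0 < a → 0 < b → ∀ ω,
      iteratedOccupation Z (fun k => if k = 0 then b else a) t 2 0 ω
        = ∫⁻ r in Set.Ioo 0 t, ENNReal.ofReal (heatKernel a (Z r.toNNReal ω)) *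
          ENNReal.ofReal (∫ u in r..t, heatKernel b (Z u.toNNReal ω)) := by
    intro a b ha hb ω
    rw [iteratedOccupation]
    refine setLIntegral_congr_fun measurableSet_Ioo fun r hr => ?_
    simp only [iteratedOccupation, one_ne_zero, if_false, if_true, mul_one]
    congr 1
    exact IsRightContDensity.lintegral_Ioo_eq hr.2.le
      ((hZ.isRightContDensity hb ω).intervalIntegrable _ _)
      fun u _ => (hZ.isRightContDensity hb ω).nonneg u
  rw [← lintegral_iteratedOccupation hZ hψ (hpos hδ hε) ht,
    ← lintegral_iteratedOccupation hZ hψ (hpos hε hδ) ht, ← lintegral_add_left]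
  · refine lintegral_congr fun ω => ?_
    rw [hstep hε hδ, hstep hδ hε]
    exact ((hZ.isRightContDensity hε ω).lintegral_mul_add_mul (hZ.isRightContDensity hδ ω)
      ht.le).symm
  · exact Measurable.of_uncurry_left (measurable_iteratedOccupation hZ _ t 2)

end Moments

/-! ### The local time and its Laplace transform -/

section LocalTime

variable {Ω : Type*} {mΩ : MeasurableSpace Ω} {P : Measure Ω} {𝒢 : Filtration ℝ≥0 mΩ}
  {ψ : ℝ → ℝ} {Z : ℝ≥0 → Ω → ℝ}

lemma measurable_approxLocalTime (hZ : IsLevyProcess P 𝒢 ψ Z) (ε s t : ℝ) :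
    Measurable (approxLocalTime Z ε s t) := by
  have h1 : StronglyMeasurable fun q : Ω × ℝ => heatKernel ε (Z q.2.toNNReal q.1) :=
    ((continuous_heatKernel ε).measurable.comp
      (hZ.measurable_toNNReal.comp (f := fun q : Ω × ℝ => (q.2, q.1))
        (by fun_prop))).stronglyMeasurable
  exact (h1.integral_prod_right' (ν := volume.restrict (Set.Ioc s t))).measurable.sub
    (h1.integral_prod_right' (ν := volume.restrict (Set.Ioc t s))).measurable

lemma approxLocalTime_nonneg (hZ : IsLevyProcess P 𝒢 ψ Z) {ε t : ℝ} (hε : 0 < ε) (ht : 0 ≤ t)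
    (ω : Ω) : 0 ≤ approxLocalTime Z ε 0 t ω :=
  (hZ.isRightContDensity hε ω).integral_nonneg ht

lemma approxLocalTime_mono (hZ : IsLevyProcess P 𝒢 ψ Z) {ε s t : ℝ} (hε : 0 < ε) (hs : 0 ≤ s)
    (hst : s ≤ t) (ω : Ω) : approxLocalTime Z ε 0 s ω ≤ approxLocalTime Z ε 0 t ω :=
  intervalIntegral.integral_mono_interval le_rfl hs hst
    (ae_of_all _ (hZ.isRightContDensity hε ω).nonneg)
    ((hZ.isRightContDensity hε ω).intervalIntegrable 0 t)

lemma memLp_approxLocalTime [IsFiniteMeasure P] (hZ : IsLevyProcess P 𝒢 ψ Z) {ε : ℝ} (hε : 0 < ε)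
    (s t : ℝ) (q : ℝ≥0∞) : MemLp (approxLocalTime Z ε s t) q P := by
  refine MemLp.of_bound (measurable_approxLocalTime hZ ε s t).aestronglyMeasurable
    (1 / (2 * Real.pi * ε) ^ (1 / 2 : ℝ) * |t - s|) (ae_of_all _ fun ω => ?_)
  refine intervalIntegral.norm_integral_le_of_norm_le_const fun r _ => ?_
  exact (Real.norm_of_nonneg (heatKernel_nonneg hε _)).trans_le (heatKernel_le hε _)

lemma tsum_ofReal_mul_pow {x a : ℝ} (r : ℝ≥0) (ha : 0 ≤ a) (k : ℕ)
    (h : HasSum (fun n => (r * a) ^ (2 * n + k) / (2 * n + k).factorial) x) :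
    ∑' n : ℕ, (r : ℝ≥0∞) ^ (2 * n + k) * ENNReal.ofReal (a ^ (2 * n + k) / (2 * n + k).factorial)
      = ENNReal.ofReal x := by
  rw [← h.tsum_eq, ENNReal.ofReal_tsum_of_nonneg (fun n => by positivity) h.summable]
  refine tsum_congr fun n => ?_
  rw [mul_pow, mul_div_assoc, ENNReal.ofReal_mul (by positivity), ENNReal.ofReal_pow (by simp),
    ENNReal.ofReal_coe_nnreal]

/-- The Laplace transform of the approximate local time, through its moments. -/
lemma lintegral_exp_approxLocalTime_add [IsProbabilityMeasure P] (hZ : IsLevyProcess P 𝒢 ψ Z)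
    (hψ : StableLikeExponent ψ) (r : ℝ≥0) {ε t : ℝ} (hε : 0 < ε) (ht : 0 < t) :
    ∫⁻ ω, ENNReal.ofReal (Real.exp (-(r * approxLocalTime Z ε 0 t ω))) ∂P
      + ∑' n : ℕ, (r : ℝ≥0∞) ^ (2 * n + 1) * greenTerm ψ (fun _ => ε) (2 * n + 1) t 0
      = ∑' n : ℕ, (r : ℝ≥0∞) ^ (2 * n) * greenTerm ψ (fun _ => ε) (2 * n) t 0 := by
  have hA := measurable_approxLocalTime hZ ε 0 t
  have hm : ∀ n : ℕ, Measurable fun ω => (r : ℝ≥0∞) ^ n *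
      ENNReal.ofReal (approxLocalTime Z ε 0 t ω ^ n / n.factorial) := fun n => by fun_prop
  simp_rw [← lintegral_approxLocalTime_pow hZ hψ hε ht]
  have h1 : ∀ k : ℕ, ∑' n : ℕ, (r : ℝ≥0∞) ^ (2 * n + k) *
      ∫⁻ ω, ENNReal.ofReal (approxLocalTime Z ε 0 t ω ^ (2 * n + k) / (2 * n + k).factorial) ∂P
      = ∫⁻ ω, (∑' n : ℕ, (r : ℝ≥0∞) ^ (2 * n + k) *
        ENNReal.ofReal (approxLocalTime Z ε 0 t ω ^ (2 * n + k) / (2 * n + k).factorial)) ∂P := by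
    intro k
    rw [lintegral_tsum fun n => (hm _).aemeasurable]
    refine tsum_congr fun n => ?_
    rw [lintegral_const_mul _ (by fun_prop)]
  have h0 := h1 0
  simp only [add_zero] at h0
  rw [h1, h0, ← lintegral_add_left (by fun_prop)]
  refine lintegral_congr fun ω => ?_
  have ha := approxLocalTime_nonneg hZ hε ht.le ω
  have hr : 0 ≤ (r : ℝ) * approxLocalTime Z ε 0 t ω := mul_nonneg r.2 ha
  -- The odd and even parts of the exponential series are `sinh` and `cosh`, and `exp (-x) = cosh x
  -- - sinh x`.
  rw [tsum_ofReal_mul_pow r ha 1 (Real.hasSum_sinh _)]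
  have h2 := tsum_ofReal_mul_pow r ha 0 (Real.hasSum_cosh _)
  simp only [add_zero] at h2
  rw [h2, ← ENNReal.ofReal_add (Real.exp_pos _).le (Real.sinh_nonneg_iff.2 hr),
    ← Real.cosh_sub_sinh, sub_add_cancel]

/-- Dominated convergence for the counting measure, with the convergent renewal series as majorant.
-/
lemma tendsto_tsum_greenTerm (hψ : StableLikeExponent ψ) (r : ℝ≥0) (t : ℝ) (e : ℕ → ℕ)
    (he : Function.Injective e) :
    Tendsto (fun ε : ℝ => ∑' n : ℕ, (r : ℝ≥0∞) ^ e n * greenTerm ψ (fun _ => ε) (e n) t 0)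
      (𝓝[>] 0) (𝓝 (∑' n : ℕ, (r : ℝ≥0∞) ^ e n *
        renewalTerm (fun t => transDensity ψ t 0) (e n) t)) := by
  have hsum := tsum_renewalTerm_lt_top hψ.potentialKernel t r
  have hlt := (ENNReal.tsum_comp_le_tsum_of_injective he (fun n => (r : ℝ≥0∞) ^ n *
    renewalTerm (fun t => transDensity ψ t 0) n t)).trans_lt hsum
  simp_rw [← lintegral_count]
  refine tendsto_lintegral_filter_of_dominated_convergence (fun n => (r : ℝ≥0∞) ^ e n *
    renewalTerm (fun t => transDensity ψ t 0) (e n) t) ?_ ?_ ?_ ?_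
  · exact Eventually.of_forall fun _ => measurable_of_countable _
  · exact Eventually.of_forall fun ε => ae_of_all _ fun n =>
      mul_le_mul_right (greenTerm_le hψ _ _ _ _) _
  · rw [lintegral_count]
    exact hlt.ne
  · refine ae_of_all _ fun n => ENNReal.Tendsto.const_mul ?_ (Or.inr (by simp))
    exact tendsto_greenTerm hψ (fun _ => tendsto_id.mono_left nhdsWithin_le_nhds) _ _ _
      tendsto_const_nhds

lemma tendsto_lintegral_exp_approxLocalTime [IsProbabilityMeasure P]
    (hZ : IsLevyProcess P 𝒢 ψ Z) (hψ : StableLikeExponent ψ) (r : ℝ≥0) {t : ℝ} (ht : 0 < t) :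
    Tendsto (fun ε => ∫⁻ ω, ENNReal.ofReal (Real.exp (-(r * approxLocalTime Z ε 0 t ω))) ∂P)
      (𝓝[>] 0) (𝓝 (relaxation (fun t => transDensity ψ t 0) r t)) := by
  have h1 := tendsto_tsum_greenTerm hψ r t (fun n => 2 * n) fun a b h => by simpa using h
  have h2 := tendsto_tsum_greenTerm hψ r t (fun n => 2 * n + 1) fun a b h => by simpa using h
  have h3 := ENNReal.Tendsto.sub h1 h2 (Or.inr (renewalOdd_lt_top hψ.potentialKernel r t).ne)
  refine h3.congr' ?_
  filter_upwards [self_mem_nhdsWithin] with ε hε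
  refine (ENNReal.eq_sub_of_add_eq ?_ (lintegral_exp_approxLocalTime_add hZ hψ r hε ht)).symm
  refine ne_top_of_le_ne_top (renewalOdd_lt_top hψ.potentialKernel r t).ne ?_
  exact ENNReal.tsum_le_tsum fun n => mul_le_mul_right (greenTerm_le hψ _ _ _ _) _

/-- The sign and the monotonicity pass to the limit from the Laplace transforms of the
approximations, which are non-negative and decrease in `t` because the approximate local times
increase. -/
lemma IsLevyProcess.isRelaxation_relaxation [IsProbabilityMeasure P]
    (hZ : IsLevyProcess P 𝒢 ψ Z) (hψ : StableLikeExponent ψ) (r : ℝ≥0) :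
    IsRelaxation (fun t => transDensity ψ t 0) r
      (relaxation (fun t => transDensity ψ t 0) r) := by
  have hp := hψ.potentialKernel
  refine _root_.isRelaxation_relaxation hp r (fun t => ?_) fun s hs t ht hst => ?_
  · rcases le_or_gt t 0 with ht | ht
    · simp [renewalOdd, renewalTerm_of_nonpos hp.of_nonpos _ ht]
    · refine le_of_tendsto_of_tendsto
        (tendsto_tsum_greenTerm hψ r t (fun n => 2 * n + 1) fun a b h => by simpa using h)
        (tendsto_tsum_greenTerm hψ r t (fun n => 2 * n) fun a b h => by simpa using h) ?_
      filter_upwards [self_mem_nhdsWithin] with ε hε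
      rw [← lintegral_exp_approxLocalTime_add hZ hψ r hε ht]
      exact le_add_self
  · refine le_of_tendsto_of_tendsto (tendsto_lintegral_exp_approxLocalTime hZ hψ r ht)
      (tendsto_lintegral_exp_approxLocalTime hZ hψ r hs) ?_
    filter_upwards [self_mem_nhdsWithin] with ε hε
    refine lintegral_mono fun ω => ENNReal.ofReal_le_ofReal (Real.exp_le_exp.2 ?_)
    exact neg_le_neg (mul_le_mul_of_nonneg_left
      (approxLocalTime_mono hZ hε (Set.mem_Ioi.1 hs).le hst ω) r.2)

/-- The limit is the same however the two variances tend to zero. Expanding the square of a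
difference therefore gives the Cauchy property. -/
lemma tendsto_lintegral_approxLocalTime_mul [IsProbabilityMeasure P]
    (hZ : IsLevyProcess P 𝒢 ψ Z) (hψ : StableLikeExponent ψ) {t : ℝ} (ht : 0 < t) {ι : Type*}
    {l : Filter ι} [l.IsCountablyGenerated] {a b : ι → ℝ} (ha : Tendsto a l (𝓝[>] 0))
    (hb : Tendsto b l (𝓝[>] 0)) :
    Tendsto (fun i => ∫⁻ ω, ENNReal.ofReal
        (approxLocalTime Z (a i) 0 t ω * approxLocalTime Z (b i) 0 t ω) ∂P) l
      (𝓝 (renewalTerm (fun t => transDensity ψ t 0) 2 t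
        + renewalTerm (fun t => transDensity ψ t 0) 2 t)) := by
  have ha' := ha.mono_right nhdsWithin_le_nhds
  have hb' := hb.mono_right nhdsWithin_le_nhds
  have h : ∀ {a b : ι → ℝ}, Tendsto a l (𝓝 0) → Tendsto b l (𝓝 0) →
      Tendsto (fun i => greenTerm ψ (fun k => if k = 0 then a i else b i) 2 t 0) l
        (𝓝 (renewalTerm (fun t => transDensity ψ t 0) 2 t)) := by
    intro a b ha hb
    refine tendsto_greenTerm hψ (ε := fun i k => if k = 0 then a i else b i) (fun k => ?_) 2 t _
      tendsto_const_nhds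
    by_cases hk : k = 0
    · simpa [hk] using ha
    · simpa [hk] using hb
  refine ((h hb' ha').add (h ha' hb')).congr' ?_
  filter_upwards [ha.eventually self_mem_nhdsWithin, hb.eventually self_mem_nhdsWithin] with i h1 h2
  exact (lintegral_approxLocalTime_mul hZ hψ h1 h2 ht).symm

lemma tendsto_eLpNorm_approxLocalTime_sub [IsProbabilityMeasure P]
    (hZ : IsLevyProcess P 𝒢 ψ Z) (hψ : StableLikeExponent ψ) {t : ℝ} (ht : 0 < t) :
    Tendsto (fun q : ℝ × ℝ => eLpNorm
        (approxLocalTime Z q.1 0 t - approxLocalTime Z q.2 0 t) 2 P)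
      (𝓝[>] 0 ×ˢ 𝓝[>] 0) (𝓝 0) := by
  have hA := fun ε => measurable_approxLocalTime hZ ε 0 t
  have hfin := renewalTerm_ne_top hψ.potentialKernel 2 t
  have h11 := tendsto_lintegral_approxLocalTime_mul hZ hψ ht (l := 𝓝[>] (0 : ℝ) ×ˢ 𝓝[>] (0 : ℝ))
    tendsto_fst tendsto_fst
  have h22 := tendsto_lintegral_approxLocalTime_mul hZ hψ ht (l := 𝓝[>] (0 : ℝ) ×ˢ 𝓝[>] (0 : ℝ))
    tendsto_snd tendsto_snd
  have h12 := tendsto_lintegral_approxLocalTime_mul hZ hψ ht (l := 𝓝[>] (0 : ℝ) ×ˢ 𝓝[>] (0 : ℝ))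
    tendsto_fst tendsto_snd
  -- With `A` and `B` the two approximations, `E[(A - B)²] = E[A²] + E[B²] - 2 E[A B]`, and the
  -- limits cancel.
  have h3 := ENNReal.Tendsto.sub (h11.add h22) (h12.add h12) (Or.inl (by simp [hfin]))
  rw [tsub_self] at h3
  have h4 := ((ENNReal.continuous_rpow_const (y := (1 / 2 : ℝ))).tendsto 0).comp h3
  rw [ENNReal.zero_rpow_of_pos (by norm_num)] at h4
  refine h4.congr' ?_
  have hpos : ∀ᶠ q : ℝ × ℝ in 𝓝[>] (0 : ℝ) ×ˢ 𝓝[>] (0 : ℝ), 0 < q.1 ∧ 0 < q.2 :=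
    (tendsto_fst.eventually self_mem_nhdsWithin).and (tendsto_snd.eventually self_mem_nhdsWithin)
  have hne := h12.eventually
    (gt_mem_nhds (ENNReal.add_lt_top.2 ⟨hfin.lt_top, hfin.lt_top⟩))
  filter_upwards [hpos, hne] with q hq hq'
  rw [eLpNorm_eq_lintegral_rpow_enorm_toReal (by simp) (by simp), ENNReal.toReal_ofNat,
    Function.comp_apply]
  congr 1
  refine (ENNReal.eq_sub_of_add_eq (by simp [hq'.ne]) ?_).symm
  rw [← lintegral_add_left (by fun_prop), ← lintegral_add_left (by fun_prop),
    ← lintegral_add_right _ (by fun_prop)]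
  refine lintegral_congr fun ω => ?_
  have h1 := approxLocalTime_nonneg hZ hq.1 ht.le ω
  have h2 := approxLocalTime_nonneg hZ hq.2 ht.le ω
  rw [Pi.sub_apply, ENNReal.rpow_ofNat, Real.enorm_eq_ofReal_abs, ← ENNReal.ofReal_pow (by simp),
    sq_abs, ← ENNReal.ofReal_add (by positivity) (by positivity),
    ← ENNReal.ofReal_add (by positivity) (by positivity),
    ← ENNReal.ofReal_add (by positivity) (by positivity)]
  congr 1
  ring

/-- The approximate local times converge in `L²`. -/
theorem exists_tendsto_eLpNorm_approxLocalTime [IsProbabilityMeasure P]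
    (hZ : IsLevyProcess P 𝒢 ψ Z) (hψ : StableLikeExponent ψ) {t : ℝ} (ht : 0 < t) :
    ∃ L : Ω → ℝ, MemLp L 2 P ∧
      Tendsto (fun ε : ℝ => eLpNorm (fun ω => approxLocalTime Z ε 0 t ω - L ω) 2 P)
        (𝓝[>] 0) (𝓝 0) := by
  classical
  obtain ⟨F, hF⟩ : ∃ F : ℝ → Lp ℝ 2 P, ∀ ε (hε : 0 < ε),
      F ε = (memLp_approxLocalTime hZ hε 0 t 2).toLp _ :=
    ⟨fun ε => if hε : 0 < ε then (memLp_approxLocalTime hZ hε 0 t 2).toLp _ else 0,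
      fun ε hε => dif_pos hε⟩
  have hpos : ∀ᶠ q : ℝ × ℝ in 𝓝[>] (0 : ℝ) ×ˢ 𝓝[>] (0 : ℝ), 0 < q.1 ∧ 0 < q.2 :=
    (tendsto_fst.eventually self_mem_nhdsWithin).and (tendsto_snd.eventually self_mem_nhdsWithin)
  have hc : Cauchy (map F (𝓝[>] 0)) := by
    rw [cauchy_map_iff', tendsto_uniformity_iff_dist_tendsto_zero]
    have h1 := (ENNReal.tendsto_toReal ENNReal.zero_ne_top).comp
      (tendsto_eLpNorm_approxLocalTime_sub hZ hψ ht)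
    rw [ENNReal.toReal_zero] at h1
    refine h1.congr' ?_
    filter_upwards [hpos] with q hq
    rw [Function.comp_apply, dist_edist, hF _ hq.1, hF _ hq.2, Lp.edist_toLp_toLp]
  obtain ⟨L, hL⟩ := cauchy_map_iff_exists_tendsto.1 hc
  refine ⟨L, Lp.memLp L, ?_⟩
  refine ((Lp.tendsto_Lp_iff_tendsto_eLpNorm' _ _).1 hL).congr' ?_
  filter_upwards [self_mem_nhdsWithin] with ε hε
  refine eLpNorm_congr_ae ?_
  rw [hF ε hε]
  filter_upwards [(memLp_approxLocalTime hZ hε 0 t 2).coeFn_toLp] with ω hω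
  rw [Pi.sub_apply, hω]

/-- An `L²` limit of the approximate local times is nonnegative, its Laplace transform is the
relaxation function, and its moments are finite. -/
theorem localTime_properties [IsProbabilityMeasure P]
    (hZ : IsLevyProcess P 𝒢 ψ Z) (hψ : StableLikeExponent ψ) {t : ℝ} (ht : 0 < t) {L : Ω → ℝ}
    (hL : MemLp L 2 P)
    (hlim : Tendsto (fun ε : ℝ => eLpNorm (fun ω => approxLocalTime Z ε 0 t ω - L ω) 2 P)
        (𝓝[>] 0) (𝓝 0)) :
    (∀ᵐ ω ∂P, 0 ≤ L ω) ∧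
      (∀ r : ℝ≥0, ∫⁻ ω, ENNReal.ofReal (Real.exp (-(r * L ω))) ∂P
        = relaxation (fun t => transDensity ψ t 0) r t) ∧
      ∀ n : ℕ, ∫⁻ ω, ENNReal.ofReal (L ω ^ n) ∂P < ∞ := by
  have hA := fun ε => measurable_approxLocalTime hZ ε 0 t
  -- Convergence in `L²` yields almost sure convergence along a sequence of variances, which
  -- suffices for all three claims.
  obtain ⟨ε, hε, hae⟩ := (tendstoInMeasure_of_tendsto_eLpNorm (two_ne_zero)
    (fun ε => (hA ε).aestronglyMeasurable) hL.1 hlim).exists_seq_tendsto_ae'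
  have hεpos : ∀ᶠ k in atTop, 0 < ε k := hε.eventually self_mem_nhdsWithin
  refine ⟨?_, fun r => ?_, fun n => ?_⟩
  · filter_upwards [hae] with ω hω
    refine ge_of_tendsto hω ?_
    filter_upwards [hεpos] with k hk using approxLocalTime_nonneg hZ hk ht.le ω
  · refine tendsto_nhds_unique ?_
      ((tendsto_lintegral_exp_approxLocalTime hZ hψ r ht).comp hε)
    refine tendsto_lintegral_filter_of_dominated_convergence (fun _ => 1) ?_ ?_ (by simp) ?_
    · exact Eventually.of_forall fun k => by fun_prop
    · filter_upwards [hεpos] with k hk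
      refine ae_of_all _ fun ω => ?_
      rw [ENNReal.ofReal_le_one, Real.exp_le_one_iff, neg_nonpos]
      exact mul_nonneg r.2 (approxLocalTime_nonneg hZ hk ht.le ω)
    · filter_upwards [hae] with ω hω
      exact ENNReal.tendsto_ofReal ((Real.continuous_exp.tendsto _).comp (hω.const_mul _).neg)
  · have hfac : (0 : ℝ) < n.factorial := by positivity
    -- Fatou's lemma along the sequence, with the uniform bound on the moments of the
    -- approximations.
    have h1 : ∫⁻ ω, ENNReal.ofReal (L ω ^ n / n.factorial) ∂P
        ≤ renewalTerm (fun t => transDensity ψ t 0) n t := by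
      calc ∫⁻ ω, ENNReal.ofReal (L ω ^ n / n.factorial) ∂P
          = ∫⁻ ω, liminf (fun k => ENNReal.ofReal
              (approxLocalTime Z (ε k) 0 t ω ^ n / n.factorial)) atTop ∂P := by
            refine lintegral_congr_ae ?_
            filter_upwards [hae] with ω hω
            exact (ENNReal.tendsto_ofReal ((hω.pow n).div_const _)).liminf_eq.symm
        _ ≤ liminf (fun k => ∫⁻ ω, ENNReal.ofReal
              (approxLocalTime Z (ε k) 0 t ω ^ n / n.factorial) ∂P) atTop :=
            lintegral_liminf_le fun k => by fun_prop
        _ ≤ _ := by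
            refine liminf_le_of_frequently_le' (Eventually.frequently ?_)
            filter_upwards [hεpos] with k hk
            rw [lintegral_approxLocalTime_pow hZ hψ hk ht]
            exact greenTerm_le hψ _ _ _ _
    have h2 : ∀ ω, ENNReal.ofReal (L ω ^ n)
        = n.factorial * ENNReal.ofReal (L ω ^ n / n.factorial) := fun ω => by
      rw [← ENNReal.ofReal_natCast, ← ENNReal.ofReal_mul hfac.le, mul_div_cancel₀ _ hfac.ne']
    simp_rw [h2]
    rw [lintegral_const_mul' _ _ (by simp)]
    exact ENNReal.mul_lt_top (by simp)
      (h1.trans_lt (renewalTerm_ne_top hψ.potentialKernel n t).lt_top)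

end LocalTime

/-! ### Karamata's theorem and negative moments -/

section Tauberian

variable {Ω : Type*} {mΩ : MeasurableSpace Ω} {P : Measure Ω} [IsProbabilityMeasure P] {L : Ω → ℝ}
  {C : ℝ}

lemma exp_neg_mul_mem_Icc {r x : ℝ} (hr : 0 ≤ r) (hx : 0 ≤ x) :
    Real.exp (-(r * x)) ∈ Set.Icc (0 : ℝ) 1 :=
  ⟨(Real.exp_pos _).le, Real.exp_le_one_iff.2 (neg_nonpos.2 (mul_nonneg hr hx))⟩

lemma integrable_comp_exp_neg_mul (hL : AEMeasurable L P) (h0 : ∀ᵐ ω ∂P, 0 ≤ L ω)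
    {g : ℝ → ℝ} (hg : Continuous g) {r : ℝ} (hr : 0 ≤ r) :
    Integrable (fun ω => g (Real.exp (-(r * L ω))) * Real.exp (-(r * L ω))) P := by
  obtain ⟨M, hM⟩ := isCompact_Icc.exists_bound_of_continuousOn
    (f := fun x => g x * x) (s := Set.Icc (0 : ℝ) 1) (by fun_prop)
  refine Integrable.of_bound (C := M) ?_ ?_
  · exact AEMeasurable.aestronglyMeasurable (by fun_prop)
  · filter_upwards [h0] with ω hω
    exact hM _ (exp_neg_mul_mem_Icc hr hω)

/-- For the monomial `x ^ n` the expectation is the Laplace transform at `(n + 1) r`, so the limit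
is `C / (n + 1)`, which is `C` times the integral of `x ^ n` over `[0, 1]`. Linearity does the rest.
-/
lemma tendsto_laplace_polynomial (hL : AEMeasurable L P) (h0 : ∀ᵐ ω ∂P, 0 ≤ L ω)
    (h : Tendsto (fun r : ℝ => r * ∫ ω, Real.exp (-(r * L ω)) ∂P) atTop (𝓝 C))
    (q : Polynomial ℝ) :
    Tendsto (fun r : ℝ => r * ∫ ω, q.eval (Real.exp (-(r * L ω))) * Real.exp (-(r * L ω)) ∂P)
      atTop (𝓝 (C * ∫ x in (0 : ℝ)..1, q.eval x)) := by
  induction q using Polynomial.induction_on' with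
  | add q₁ q₂ h₁ h₂ =>
    have e1 : C * ∫ x in (0 : ℝ)..1, (q₁ + q₂).eval x
        = C * (∫ x in (0 : ℝ)..1, q₁.eval x) + C * ∫ x in (0 : ℝ)..1, q₂.eval x := by
      simp_rw [Polynomial.eval_add]
      rw [intervalIntegral.integral_add (q₁.continuous.intervalIntegrable _ _)
        (q₂.continuous.intervalIntegrable _ _), mul_add]
    rw [e1]
    refine (h₁.add h₂).congr' ?_
    filter_upwards [eventually_ge_atTop 0] with r hr
    rw [← mul_add, ← integral_add (integrable_comp_exp_neg_mul hL h0 q₁.continuous hr)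
      (integrable_comp_exp_neg_mul hL h0 q₂.continuous hr)]
    simp_rw [Polynomial.eval_add, add_mul]
  | monomial n a =>
    have hn : (0 : ℝ) < n + 1 := by positivity
    have e1 : C * ∫ x in (0 : ℝ)..1, (Polynomial.monomial n a).eval x = a / (n + 1) * C := by
      simp only [Polynomial.eval_monomial, intervalIntegral.integral_const_mul, integral_pow]
      simp
      ring
    rw [e1]
    refine ((h.comp (tendsto_id.const_mul_atTop hn)).const_mul (a / (n + 1))).congr fun r => ?_
    simp only [Function.comp_apply, id, Polynomial.eval_monomial]
    have e2 : ∀ ω, a * Real.exp (-(r * L ω)) ^ n * Real.exp (-(r * L ω))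
        = a * Real.exp (-((n + 1) * r * L ω)) := fun ω => by
      rw [mul_assoc, ← pow_succ, ← Real.exp_nat_mul]
      congr 2
      push_cast
      ring
    simp_rw [e2]
    rw [integral_const_mul]
    field_simp

lemma tendsto_laplace_continuous (hL : AEMeasurable L P) (h0 : ∀ᵐ ω ∂P, 0 ≤ L ω)
    (h : Tendsto (fun r : ℝ => r * ∫ ω, Real.exp (-(r * L ω)) ∂P) atTop (𝓝 C))
    {g : ℝ → ℝ} (hg : Continuous g) :
    Tendsto (fun r : ℝ => r * ∫ ω, g (Real.exp (-(r * L ω))) * Real.exp (-(r * L ω)) ∂P)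
      atTop (𝓝 (C * ∫ x in (0 : ℝ)..1, g x)) := by
  rw [Metric.tendsto_nhds]
  intro δ hδ
  have hD : 0 < 2 * |C| + 2 := by positivity
  -- Three errors have to fit into `δ`: `η (|C| + 1)` from the Weierstrass approximation under the
  -- expectation, `η` from the polynomial limit and `|C| η` from the integral.
  obtain ⟨η, hη, hηδ⟩ : ∃ η > 0, η * (2 * |C| + 2) = δ :=
    ⟨δ / (2 * |C| + 2), by positivity, by field_simp⟩
  obtain ⟨q, hq⟩ := exists_polynomial_near_of_continuousOn 0 1 g hg.continuousOn η hη
  have h1 := Metric.tendsto_nhds.1 (tendsto_laplace_polynomial hL h0 h q) η hη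
  have h2 := h.eventually (gt_mem_nhds (lt_of_le_of_lt (le_abs_self C) (lt_add_one |C|)))
  have h3 : |(∫ x in (0 : ℝ)..1, q.eval x) - ∫ x in (0 : ℝ)..1, g x| ≤ η := by
    rw [← intervalIntegral.integral_sub (q.continuous.intervalIntegrable _ _)
      (hg.intervalIntegrable _ _)]
    have := intervalIntegral.norm_integral_le_of_norm_le_const (a := (0 : ℝ)) (b := 1)
      (f := fun x => q.eval x - g x) (C := η) fun x hx => by
        rw [Set.uIoc_of_le zero_le_one] at hx
        exact (hq x (Set.Ioc_subset_Icc_self hx)).le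
    simpa using this
  filter_upwards [h1, h2, eventually_ge_atTop 0] with r hr1 hr2 hr
  have hie : Integrable (fun ω => Real.exp (-(r * L ω))) P := by
    simpa using integrable_comp_exp_neg_mul hL h0 (g := fun _ => 1) continuous_const hr
  have h4 : |(∫ ω, g (Real.exp (-(r * L ω))) * Real.exp (-(r * L ω)) ∂P)
      - ∫ ω, q.eval (Real.exp (-(r * L ω))) * Real.exp (-(r * L ω)) ∂P|
      ≤ η * ∫ ω, Real.exp (-(r * L ω)) ∂P := by
    rw [← integral_sub (integrable_comp_exp_neg_mul hL h0 hg hr)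
      (integrable_comp_exp_neg_mul hL h0 q.continuous hr), ← integral_const_mul]
    rw [← Real.norm_eq_abs]
    refine norm_integral_le_of_norm_le (hie.const_mul η) ?_
    filter_upwards [h0] with ω hω
    rw [← sub_mul, norm_mul, Real.norm_of_nonneg (Real.exp_pos _).le, Real.norm_eq_abs,
      abs_sub_comm]
    exact mul_le_mul_of_nonneg_right (hq _ (exp_neg_mul_mem_Icc hr hω)).le (Real.exp_pos _).le
  rw [Real.dist_eq] at hr1 ⊢
  have h5 : |r * (∫ ω, g (Real.exp (-(r * L ω))) * Real.exp (-(r * L ω)) ∂P)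
      - r * ∫ ω, q.eval (Real.exp (-(r * L ω))) * Real.exp (-(r * L ω)) ∂P|
      ≤ η * (|C| + 1) := by
    rw [← mul_sub, abs_mul, abs_of_nonneg hr]
    calc _ ≤ r * (η * ∫ ω, Real.exp (-(r * L ω)) ∂P) := mul_le_mul_of_nonneg_left h4 hr
      _ = η * (r * ∫ ω, Real.exp (-(r * L ω)) ∂P) := by ring
      _ ≤ _ := mul_le_mul_of_nonneg_left hr2.le hη.le
  have h6 : |C * (∫ x in (0 : ℝ)..1, q.eval x) - C * ∫ x in (0 : ℝ)..1, g x| ≤ |C| * η := by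
    rw [← mul_sub, abs_mul]
    exact mul_le_mul_of_nonneg_left h3 (abs_nonneg _)
  calc _ ≤ _ := abs_sub_le _ (r * ∫ ω, q.eval (Real.exp (-(r * L ω))) *
        Real.exp (-(r * L ω)) ∂P) _
    _ ≤ η * (|C| + 1) + _ := add_le_add h5 (abs_sub_le _ (C * ∫ x in (0 : ℝ)..1, q.eval x) _)
    _ < η * (|C| + 1) + (η + |C| * η) := by gcongr 1; exact add_lt_add_of_lt_of_le hr1 h6
    _ = δ := by rw [← hηδ]; ring

/-- A continuous function that vanishes on `(-∞, a]` and equals `x⁻¹` on `[b, ∞)`. -/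
noncomputable def cutoffInv (a b x : ℝ) : ℝ := max 0 (min 1 ((x - a) / (b - a))) * (max x a)⁻¹

lemma continuous_cutoffInv {a : ℝ} (ha : 0 < a) (b : ℝ) : Continuous (cutoffInv a b) := by
  unfold cutoffInv
  have : ∀ x, max x a ≠ 0 := fun x => (ha.trans_le (le_max_right _ _)).ne'
  fun_prop (disch := assumption)

lemma cutoffInv_nonneg {a : ℝ} (ha : 0 < a) (b x : ℝ) : 0 ≤ cutoffInv a b x :=
  mul_nonneg (le_max_left _ _) (inv_nonneg.2 (ha.le.trans (le_max_right _ _)))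

lemma cutoffInv_of_le {a b x : ℝ} (hab : a < b) (h : x ≤ a) : cutoffInv a b x = 0 := by
  have h1 : (x - a) / (b - a) ≤ 0 :=
    div_nonpos_of_nonpos_of_nonneg (sub_nonpos.2 h) (sub_pos.2 hab).le
  rw [cutoffInv, max_eq_left ((min_le_right _ _).trans h1), zero_mul]

lemma cutoffInv_of_ge {a b x : ℝ} (hab : a < b) (h : b ≤ x) : cutoffInv a b x = x⁻¹ := by
  have h1 : 1 ≤ (x - a) / (b - a) := by
    rw [le_div_iff₀ (sub_pos.2 hab)]
    linarith
  rw [cutoffInv, min_eq_left h1, max_eq_right zero_le_one, one_mul, max_eq_left (hab.le.trans h)]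

lemma cutoffInv_le {a b x : ℝ} (ha : 0 < a) (h : a ≤ x) : cutoffInv a b x ≤ x⁻¹ := by
  rw [cutoffInv, max_eq_left h]
  exact mul_le_of_le_one_left (inv_nonneg.2 (ha.le.trans h))
    (max_le zero_le_one (min_le_left _ _))

lemma cutoffInv_mul_le {a b x : ℝ} (ha : 0 < a) (hab : a < b) : cutoffInv a b x * x ≤ 1 := by
  rcases le_total x a with h | h
  · rw [cutoffInv_of_le hab h, zero_mul]
    exact zero_le_one
  · have hx := ha.trans_le h
    calc _ ≤ x⁻¹ * x := mul_le_mul_of_nonneg_right (cutoffInv_le ha h) hx.le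
      _ = 1 := inv_mul_cancel₀ hx.ne'

lemma integral_cutoffInv_le {a b : ℝ} (ha : 0 < a) (hab : a < b) (ha1 : a ≤ 1) :
    ∫ x in (0 : ℝ)..1, cutoffInv a b x ≤ -Real.log a := by
  have hc := continuous_cutoffInv ha b
  rw [← intervalIntegral.integral_add_adjacent_intervals (hc.intervalIntegrable 0 a)
    (hc.intervalIntegrable a 1)]
  have h1 : ∫ x in (0 : ℝ)..a, cutoffInv a b x = 0 := by
    rw [intervalIntegral.integral_congr (g := fun _ => (0 : ℝ))]
    · simp
    · intro x hx
      rw [Set.uIcc_of_le ha.le] at hx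
      exact cutoffInv_of_le hab hx.2
  have h2 : ∫ x in a..1, x⁻¹ = -Real.log a := by
    rw [integral_inv_of_pos ha one_pos, Real.log_div one_ne_zero ha.ne', Real.log_one, zero_sub]
  rw [h1, zero_add, ← h2]
  refine intervalIntegral.integral_mono_on ha1 (hc.intervalIntegrable _ _) ?_ fun x hx =>
    cutoffInv_le ha hx.1
  refine intervalIntegral.intervalIntegrable_inv (fun x hx => ?_) continuousOn_id
  rw [Set.uIcc_of_le ha1] at hx
  exact (ha.trans_le hx.1).ne'

lemma le_integral_cutoffInv {a b : ℝ} (ha : 0 < a) (hab : a < b) (hb1 : b ≤ 1) :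
    -Real.log b ≤ ∫ x in (0 : ℝ)..1, cutoffInv a b x := by
  have hc := continuous_cutoffInv ha b
  have hb := ha.trans hab
  have h2 : ∫ x in b..1, x⁻¹ = -Real.log b := by
    rw [integral_inv_of_pos hb one_pos, Real.log_div one_ne_zero hb.ne', Real.log_one, zero_sub]
  rw [← h2, intervalIntegral.integral_congr (g := cutoffInv a b)]
  · exact intervalIntegral.integral_mono_interval hb.le hb1 le_rfl
      (ae_of_all _ fun x => cutoffInv_nonneg ha b x) (hc.intervalIntegrable _ _)
  · intro x hx
    rw [Set.uIcc_of_le hb1] at hx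
    exact (cutoffInv_of_ge hab hx.1).symm

/-- Karamata's Tauberian theorem, for the index one. -/
theorem tendsto_measureReal_le_of_tendsto_laplace (hL : AEMeasurable L P)
    (h0 : ∀ᵐ ω ∂P, 0 ≤ L ω) (hC : 0 ≤ C)
    (h : Tendsto (fun r : ℝ => r * ∫ ω, Real.exp (-(r * L ω)) ∂P) atTop (𝓝 C)) :
    Tendsto (fun ε : ℝ => ε⁻¹ * P.real {ω | L ω ≤ ε}) (𝓝[>] 0) (𝓝 C) := by
  have hmeas : ∀ ε, NullMeasurableSet {ω | L ω ≤ ε} P := fun ε =>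
    hL.nullMeasurableSet_preimage measurableSet_Iic
  have hreal : ∀ ε, P.real {ω | L ω ≤ ε} = ∫ ω, Set.indicator {ω | L ω ≤ ε} 1 ω ∂P := fun ε => by
    rw [integral_indicator₀ (hmeas ε)]
    simp
  have hind : ∀ ε, Integrable (Set.indicator {ω | L ω ≤ ε} (1 : Ω → ℝ)) P := fun ε =>
    (integrable_const (1 : ℝ)).indicator₀ (hmeas ε)
  -- With `x = exp (-(r * L))`, the event `L ≤ 1 / r` is `x ≥ exp (-1)`, whose indicator is `g x *
  -- x` for `g x = 1 / x` on `[exp (-1), 1]` and zero below. The integral of this `g` is one, and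
  -- `cutoffInv` approximates it by continuous functions from both sides.
  have hmem : ∀ r : ℝ, 0 < r → ∀ ω, L ω ≤ r⁻¹ ↔ Real.exp (-1) ≤ Real.exp (-(r * L ω)) := by
    intro r hr ω
    rw [Real.exp_le_exp, neg_le_neg_iff, ← le_div_iff₀' hr, one_div]
  have hup : ∀ a, 0 < a → a < Real.exp (-1) → ∀ᶠ r : ℝ in atTop, r * P.real {ω | L ω ≤ r⁻¹} ≤
      r * ∫ ω, cutoffInv a (Real.exp (-1)) (Real.exp (-(r * L ω))) * Real.exp (-(r * L ω)) ∂P := by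
    intro a ha hab
    filter_upwards [eventually_gt_atTop 0] with r hr
    refine mul_le_mul_of_nonneg_left ?_ hr.le
    rw [hreal]
    refine integral_mono (hind _)
      (integrable_comp_exp_neg_mul hL h0 (continuous_cutoffInv ha _) hr.le) fun ω => ?_
    by_cases hω : L ω ≤ r⁻¹
    · rw [Set.indicator_of_mem (by exact hω), cutoffInv_of_ge hab ((hmem r hr ω).1 hω),
        inv_mul_cancel₀ (Real.exp_pos _).ne', Pi.one_apply]
    · rw [Set.indicator_of_notMem (by exact hω)]
      exact mul_nonneg (cutoffInv_nonneg ha _ _) (Real.exp_pos _).le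
  have hlow : ∀ b, Real.exp (-1) < b → ∀ᶠ r : ℝ in atTop,
      r * ∫ ω, cutoffInv (Real.exp (-1)) b (Real.exp (-(r * L ω))) * Real.exp (-(r * L ω)) ∂P ≤
      r * P.real {ω | L ω ≤ r⁻¹} := by
    intro b hb
    filter_upwards [eventually_gt_atTop 0] with r hr
    refine mul_le_mul_of_nonneg_left ?_ hr.le
    rw [hreal]
    refine integral_mono
      (integrable_comp_exp_neg_mul hL h0 (continuous_cutoffInv (Real.exp_pos _) _) hr.le)
      (hind _) fun ω => ?_
    by_cases hω : L ω ≤ r⁻¹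
    · rw [Set.indicator_of_mem (by exact hω)]
      exact cutoffInv_mul_le (Real.exp_pos _) hb
    · rw [Set.indicator_of_notMem (by exact hω)]
      rw [hmem r hr, not_le] at hω
      simp only
      rw [cutoffInv_of_le hb hω.le, zero_mul]
  have key : Tendsto (fun r : ℝ => r * P.real {ω | L ω ≤ r⁻¹}) atTop (𝓝 C) := by
    -- Moving one cut-off point to `exp (-1 + δ)` or `exp (-1 - δ)` changes the logarithmic integral
    -- by at most `δ`, hence the bounds `C (1 - δ)` and `C (1 + δ)`.
    have hδ : ∀ s : ℝ, Tendsto (fun δ : ℝ => C * (1 + s * δ)) (𝓝[>] 0) (𝓝 C) := fun s => by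
      have : Continuous fun δ : ℝ => C * (1 + s * δ) := by fun_prop
      simpa using (this.tendsto 0).mono_left nhdsWithin_le_nhds
    refine tendsto_order.2 ⟨fun c hc => ?_, fun c hc => ?_⟩
    · obtain ⟨δ, hδc, hδ0, hδ1⟩ := (((hδ (-1)).eventually (lt_mem_nhds hc)).and
        (Ioo_mem_nhdsGT one_pos)).exists
      have hab : Real.exp (-1) < Real.exp (-1 + δ) := Real.exp_lt_exp.2 (by linarith)
      have h1 := tendsto_laplace_continuous hL h0 h
        (continuous_cutoffInv (Real.exp_pos (-1)) (Real.exp (-1 + δ)))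
      have h2 := le_integral_cutoffInv (Real.exp_pos _) hab (Real.exp_le_one_iff.2 (by linarith))
      rw [Real.log_exp] at h2
      have h3 : c < C * ∫ x in (0 : ℝ)..1, cutoffInv (Real.exp (-1)) (Real.exp (-1 + δ)) x :=
        hδc.trans_le (mul_le_mul_of_nonneg_left (by linarith) hC)
      filter_upwards [h1.eventually (lt_mem_nhds h3), hlow _ hab] with r hr1 hr2
      exact hr1.trans_le hr2
    · obtain ⟨δ, hδc, hδ0, hδ1⟩ := (((hδ 1).eventually (gt_mem_nhds hc)).and
        (Ioo_mem_nhdsGT one_pos)).exists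
      have hab : Real.exp (-1 - δ) < Real.exp (-1) := Real.exp_lt_exp.2 (by linarith)
      have h1 := tendsto_laplace_continuous hL h0 h
        (continuous_cutoffInv (Real.exp_pos (-1 - δ)) (Real.exp (-1)))
      have h2 := integral_cutoffInv_le (Real.exp_pos _) hab (Real.exp_le_one_iff.2 (by linarith))
      rw [Real.log_exp] at h2
      have h3 : C * ∫ x in (0 : ℝ)..1, cutoffInv (Real.exp (-1 - δ)) (Real.exp (-1)) x < c :=
        (mul_le_mul_of_nonneg_left (by linarith) hC).trans_lt hδc
      filter_upwards [h1.eventually (gt_mem_nhds h3), hup _ (Real.exp_pos _) hab] with r hr1 hr2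
      exact hr2.trans_lt hr1
  refine (key.comp tendsto_inv_nhdsGT_zero).congr fun ε => ?_
  simp only [Function.comp_apply, inv_inv]

/-- The probability is at most that of `L ≤ ε`, which is `ε` times a convergent quantity. Thus
negative powers of `L` are almost surely finite. -/
lemma measure_le_zero_of_tendsto
    (h : Tendsto (fun ε : ℝ => ε⁻¹ * P.real {ω | L ω ≤ ε}) (𝓝[>] 0) (𝓝 C)) :
    P {ω | L ω ≤ 0} = 0 := by
  have h1 : Tendsto (fun ε : ℝ => ε * (ε⁻¹ * P.real {ω | L ω ≤ ε})) (𝓝[>] 0) (𝓝 (0 * C)) :=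
    (tendsto_id.mono_left nhdsWithin_le_nhds).mul h
  rw [zero_mul] at h1
  have h2 : P.real {ω | L ω ≤ 0} ≤ 0 := by
    refine ge_of_tendsto h1 ?_
    filter_upwards [self_mem_nhdsWithin] with ε hε
    rw [mul_inv_cancel_left₀ (ne_of_gt hε)]
    exact measureReal_mono fun ω (hω : L ω ≤ 0) => hω.trans (le_of_lt hε)
  exact (measureReal_eq_zero_iff).1 (le_antisymm h2 measureReal_nonneg)

/-- The behaviour of the distribution function at zero decides which negative moments are
finite. -/
theorem lintegral_rpow_neg_lt_top_iff (hL : AEMeasurable L P) (hC : 0 < C)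
    (h : Tendsto (fun ε : ℝ => ε⁻¹ * P.real {ω | L ω ≤ ε}) (𝓝[>] 0) (𝓝 C)) {p : ℝ} (hp : 0 < p) :
    ∫⁻ ω, ENNReal.ofReal (L ω) ^ (-p) ∂P < ∞ ↔ p < 1 := by
  have hpos : ∀ᵐ ω ∂P, 0 < L ω := by
    rw [ae_iff]
    simpa using measure_le_zero_of_tendsto h
  -- Layer-cake formula for `1 / L`, whose upper tail is the lower tail of `L`.
  have h1 : ∫⁻ ω, ENNReal.ofReal (L ω) ^ (-p) ∂P
      = ENNReal.ofReal p * ∫⁻ t in Set.Ioi (0 : ℝ), P {ω | L ω ≤ t⁻¹} *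
        ENNReal.ofReal (t ^ (p - 1)) := by
    calc ∫⁻ ω, ENNReal.ofReal (L ω) ^ (-p) ∂P = ∫⁻ ω, ENNReal.ofReal ((L ω)⁻¹ ^ p) ∂P := by
          refine lintegral_congr_ae ?_
          filter_upwards [hpos] with ω hω
          rw [ENNReal.ofReal_rpow_of_pos hω, Real.inv_rpow hω.le, Real.rpow_neg hω.le]
      _ = ENNReal.ofReal p * ∫⁻ t in Set.Ioi (0 : ℝ), P {ω | t ≤ (L ω)⁻¹} *
            ENNReal.ofReal (t ^ (p - 1)) :=
          lintegral_rpow_eq_lintegral_meas_le_mul P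
            (hpos.mono fun ω hω => inv_nonneg.2 hω.le) hL.inv hp
      _ = _ := by
          congr 1
          refine setLIntegral_congr_fun measurableSet_Ioi fun t ht => ?_
          congr 1
          refine measure_congr ?_
          filter_upwards [hpos] with ω hω
          exact propext (le_inv_comm₀ ht hω)
  have h2 : Tendsto (fun t : ℝ => t * P.real {ω | L ω ≤ t⁻¹}) atTop (𝓝 C) := by
    refine (h.comp tendsto_inv_atTop_nhdsGT_zero).congr fun t => ?_
    simp only [Function.comp_apply, inv_inv]
  -- Beyond `t₀` the tail is comparable with `1 / t`, so the layer-cake integrand is comparable with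
  -- `t ^ (p - 2)`, which is integrable at infinity exactly when `p < 1`.
  obtain ⟨t₀, ht₀, hb⟩ : ∃ t₀ : ℝ, 0 < t₀ ∧ ∀ t > t₀,
      C / 2 * t⁻¹ ≤ P.real {ω | L ω ≤ t⁻¹} ∧ P.real {ω | L ω ≤ t⁻¹} ≤ 2 * C * t⁻¹ := by
    have h3 := (h2.eventually (lt_mem_nhds (show C / 2 < C by linarith))).and
      (h2.eventually (gt_mem_nhds (show C < 2 * C by linarith)))
    obtain ⟨a, ha⟩ := eventually_atTop.1 h3
    refine ⟨max a 1, lt_max_of_lt_right one_pos, fun t ht => ?_⟩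
    have ht0 : 0 < t := one_pos.trans ((le_max_right _ _).trans_lt ht)
    have := ha t ((le_max_left _ _).trans ht.le)
    rw [← div_eq_mul_inv, ← div_eq_mul_inv, div_le_iff₀ ht0, le_div_iff₀ ht0, mul_comm _ t]
    exact ⟨this.1.le, this.2.le⟩
  have hrpow : ∀ t > t₀, t⁻¹ * t ^ (p - 1) = t ^ (p - 2) := fun t ht => by
    have ht0 := ht₀.trans ht
    rw [← Real.rpow_neg_one, ← Real.rpow_add ht0]
    congr 1
    ring
  have hofReal : ∀ t, P {ω | L ω ≤ t⁻¹} = ENNReal.ofReal (P.real {ω | L ω ≤ t⁻¹}) := fun t =>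
    (ofReal_measureReal).symm
  have hm : Measurable fun t : ℝ => t ^ (p - 2) := by fun_prop
  rw [h1, ENNReal.mul_lt_top_iff]
  simp only [ENNReal.ofReal_lt_top, true_and, ENNReal.ofReal_eq_zero, not_le.2 hp, false_or]
  constructor
  · intro h3
    replace h3 : ∫⁻ t in Set.Ioi (0 : ℝ), P {ω | L ω ≤ t⁻¹} * ENNReal.ofReal (t ^ (p - 1)) < ∞ := by
      rcases h3 with h3 | h3
      · exact h3
      · rw [h3]; exact ENNReal.zero_lt_top
    have h4 : ∫⁻ t in Set.Ioi t₀, ENNReal.ofReal (C / 2 * t ^ (p - 2)) < ∞ := by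
      refine lt_of_le_of_lt ?_ ((lintegral_mono_set (Set.Ioi_subset_Ioi ht₀.le)).trans_lt h3)
      refine setLIntegral_mono' measurableSet_Ioi fun t ht => ?_
      rw [hofReal, ← ENNReal.ofReal_mul measureReal_nonneg, ← hrpow t ht, ← mul_assoc]
      exact ENNReal.ofReal_le_ofReal (mul_le_mul_of_nonneg_right (hb t ht).1
        (Real.rpow_nonneg (ht₀.trans ht).le _))
    have h5 : IntegrableOn (fun t : ℝ => C / 2 * t ^ (p - 2)) (Set.Ioi t₀) := by
      refine ⟨(hm.const_mul _).aestronglyMeasurable, ?_⟩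
      rw [hasFiniteIntegral_iff_ofReal]
      · exact h4
      · refine (ae_restrict_iff' measurableSet_Ioi).2 (ae_of_all _ fun t ht => ?_)
        exact mul_nonneg (by positivity) (Real.rpow_nonneg (ht₀.trans ht).le _)
    have h6 : IntegrableOn (fun t : ℝ => t ^ (p - 2)) (Set.Ioi t₀) := by
      refine (h5.const_mul (C / 2)⁻¹).congr (ae_of_all _ fun t => ?_)
      field_simp
    have := (integrableOn_Ioi_rpow_iff ht₀).1 h6
    linarith
  · intro hp1
    left
    rw [← Set.Ioc_union_Ioi_eq_Ioi ht₀.le]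
    refine (lintegral_union_le _ _ _).trans_lt (ENNReal.add_lt_top.2 ⟨?_, ?_⟩)
    · have h3 : IntegrableOn (fun t : ℝ => t ^ (p - 1)) (Set.Ioc 0 t₀) :=
        (intervalIntegrable_iff_integrableOn_Ioc_of_le ht₀.le).1
          (intervalIntegral.intervalIntegrable_rpow' (by linarith))
      refine lt_of_le_of_lt ?_ h3.lintegral_lt_top
      refine lintegral_mono fun t => ?_
      exact mul_le_of_le_one_left zero_le prob_le_one
    · have h3 : IntegrableOn (fun t : ℝ => 2 * C * t ^ (p - 2)) (Set.Ioi t₀) :=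
        (integrableOn_Ioi_rpow_of_lt (by linarith) ht₀).const_mul _
      refine lt_of_le_of_lt ?_ h3.lintegral_lt_top
      refine setLIntegral_mono' measurableSet_Ioi fun t ht => ?_
      rw [hofReal, ← ENNReal.ofReal_mul measureReal_nonneg, ← hrpow t ht, ← mul_assoc]
      exact ENNReal.ofReal_le_ofReal (mul_le_mul_of_nonneg_right (hb t ht).2
        (Real.rpow_nonneg (ht₀.trans ht).le _))

lemma lintegral_ofReal_rpow_lt_top (hmom : ∀ n : ℕ, ∫⁻ ω, ENNReal.ofReal (L ω ^ n) ∂P < ∞) {q : ℝ}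
    (hq : 0 ≤ q) : ∫⁻ ω, ENNReal.ofReal (L ω) ^ q ∂P < ∞ := by
  obtain ⟨n, hn⟩ := exists_nat_ge q
  refine lt_of_le_of_lt (lintegral_mono (g := fun ω => 1 + ENNReal.ofReal (L ω ^ n)) fun ω => ?_) ?_
  · rcases le_total (L ω) 1 with h | h
    · exact (ENNReal.rpow_le_one (ENNReal.ofReal_le_one.2 h) hq).trans le_self_add
    · refine le_trans ?_ le_add_self
      rw [ENNReal.ofReal_pow (zero_le_one.trans h), ← ENNReal.rpow_natCast]
      exact ENNReal.rpow_le_rpow_of_exponent_le (ENNReal.one_le_ofReal.2 h) hn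
  · rw [lintegral_add_left measurable_const]
    simpa using hmom n

end Tauberian

/-! ### The main theorem -/

/-- Existence, lower tail and negative moments of the collision local time of two independent
symmetric stable processes. -/
theorem mainTheorem3 (α₁ α₂ T : ℝ) (hα₁ : 0 < α₁) (hα₁' : α₁ ≤ 2) (hα₂ : 0 < α₂) (hα₂' : α₂ ≤ 2)
    (hmax : 1 < max α₁ α₂) (hT : 0 < T) :
    ∃ C : ℝ, 0 < C ∧
      ∀ (Ω : Type*) [mΩ : MeasurableSpace Ω] (P : Measure Ω) [IsProbabilityMeasure P]
        (ℱ : Filtration ℝ≥0 mΩ) (X Y : ℝ≥0 → Ω → ℝ),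
        IsSymmetricStable P ℱ α₁ X → IsSymmetricStable P ℱ α₂ Y →
        IndepFun (fun ω t => X t ω) (fun ω t => Y t ω) P →
          (∃ L : Ω → ℝ, IsCollisionLocalTime P 2 X Y T L) ∧
          ∀ L : Ω → ℝ, IsCollisionLocalTime P 2 X Y T L →
            (∀ᵐ ω ∂P, 0 ≤ L ω) ∧
            Tendsto (fun ε : ℝ => ε⁻¹ * P.real {ω | L ω ≤ ε}) (𝓝[>] 0) (𝓝 C) ∧
            ∀ p : ℝ, (∫⁻ ω, ENNReal.ofReal (L ω) ^ (-p) ∂P) < ∞ ↔ p < 1 := by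
  have hψ := stableLikeExponent_add hα₁ hα₁' hα₂ hα₂' hmax
  have hp := hψ.potentialKernel
  -- The constant must be fixed before the probability space, while a Sonine partner is only
  -- constructed from a given process. Its existence depends on `α₁` and `α₂` alone, so a partner is
  -- chosen if there is one; the default value `1` is irrelevant, since any admissible pair of
  -- processes excludes that case.
  obtain ⟨C, hC, hCκ⟩ : ∃ C : ℝ, 0 < C ∧ ((∃ κ, IsSoninePartner
      (fun t => transDensity (fun u => |u| ^ α₁ + |u| ^ α₂) t 0) κ) →
      ∃ κ, IsSoninePartner (fun t => transDensity (fun u => |u| ^ α₁ + |u| ^ α₂) t 0) κ ∧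
        (κ T).toReal = C) := by
    by_cases h : ∃ κ, IsSoninePartner
      (fun t => transDensity (fun u => |u| ^ α₁ + |u| ^ α₂) t 0) κ
    · obtain ⟨κ, hκ⟩ := h
      exact ⟨(κ T).toReal, ENNReal.toReal_pos (hκ.pos hp hT).ne' (hκ.ne_top hp T),
        fun _ => ⟨κ, hκ, rfl⟩⟩
    · exact ⟨1, one_pos, fun h' => absurd h' h⟩
  refine ⟨C, hC, ?_⟩
  intro Ω mΩ P _ ℱ X Y hX hY hXY
  obtain ⟨𝒢, hZ⟩ := hX.isLevyProcess_sub hY hXY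
  have hrel := hZ.isRelaxation_relaxation hψ
  obtain ⟨κ, hκ, hκC⟩ := hCκ (exists_isSoninePartner hp fun n => hrel (n + 1))
  refine ⟨exists_tendsto_eLpNorm_approxLocalTime hZ hψ hT, fun L hL => ?_⟩
  obtain ⟨h0, hlap, hmom⟩ := localTime_properties hZ hψ hT hL.1 hL.2
  have hLm : AEMeasurable L P := hL.1.1.aemeasurable
  have h1 : Tendsto (fun r : ℝ => r * ∫ ω, Real.exp (-(r * L ω)) ∂P) atTop (𝓝 C) := by
    have h2 := (ENNReal.tendsto_toReal (hκ.ne_top hp T)).comp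
      (hκ.tendsto_relaxation hp tendsto_real_toNNReal_atTop
        (Eventually.of_forall fun r : ℝ => hrel r.toNNReal) hT)
    rw [hκC] at h2
    refine h2.congr' ?_
    filter_upwards [eventually_ge_atTop 0] with r hr
    have h3 := hlap r.toNNReal
    rw [Real.coe_toNNReal _ hr] at h3
    rw [Function.comp_apply, ENNReal.toReal_mul, ENNReal.coe_toReal, Real.coe_toNNReal _ hr, ← h3,
      integral_eq_lintegral_of_nonneg_ae (ae_of_all _ fun _ => (Real.exp_pos _).le)
        (AEMeasurable.aestronglyMeasurable (by fun_prop))]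
  have h2 := tendsto_measureReal_le_of_tendsto_laplace hLm h0 hC.le h1
  refine ⟨h0, h2, fun p => ?_⟩
  -- For `p ≤ 0` the moment has a non-negative exponent and is controlled by the integer moments;
  -- the lower tail matters only for `p > 0`.
  rcases le_or_gt p 0 with hp0 | hp0
  · exact iff_of_true (lintegral_ofReal_rpow_lt_top hmom (neg_nonneg.2 hp0)) (hp0.trans_lt one_pos)
  · exact lintegral_rpow_neg_lt_top_iff hLm hC h2 hp0
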